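/- Let $n\ge 2$, let $U\subseteq\mathbb R^{n-1}\times\mathbb R$ be a connected nonempty open set with coordinates $(x^1,\dots,x^{n-1},u)$, and let $h_{ij}(u,x)$ be a smooth field of symmetric nondegenerate $(n-1)\times(n-1)$ matrices on $U$ (positive definite in the properly Riemannian case). Let $V^n$ be the space $U$ with the metric $$ds^2=du^2+h_{ij}(u,x^k)\,dx^i\,dx^j ,$$ and consider the minimal surface Lagrangian $$L=\sqrt{|h|+|h|\,h^{ij}u_{,i}u_{,j}},\qquad |h|=|\det(h_{ij})| ,$$ at the first jets $(x,u,u_{,i})$ over $U$ where the radicand is positive. Let $G_N$ be its Noether algebra, that is, the real vector space of the smooth vector fields $X=\xi^i(x,u)\,\partial_{x^i}+\eta(x,u)\,\partial_u$ on $U$ for which there are smooth functions $A^i(x,u)$ on $U$ with $$X^{[1]}L+L\,D_i\xi^i=D_iA^i ,$$ where $D_i=\partial_{x^i}+u_{,i}\partial_u$ on functions of $(x,u)$ and $X^{[1]}=X+(D_i\eta-u_{,j}D_i\xi^j)\,\partial_{u_{,i}}$ is the first prolongation of $X$. Then $\dim G_N$ is finite and at most $\tfrac12 n(n+1)$, and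 $\dim G_N=\tfrac12 n(n+1)$ if and only if $V^n$ is maximally symmetric, i.e. its Killing vector fields form a space of dimension $\tfrac12 n(n+1)$. If $\dim G_N=\tfrac12 n(n+1)$, then $V^n$ has constant curvature, i.e. there is a constant $K$ with $R_{abcd}=K(g_{ac}g_{bd}-g_{ad}g_{bc})$ on $U$. If $U$ is simply connected, then $\dim G_N=\tfrac12 n(n+1)$ if and only if $V^n$ has constant curvature. -/

import Mathlib

open scoped ContDiff
open TopologicalSpace

namespace MinimalSurface

/-- Labels of the `m + 1` coordinates: `Sum.inl i` labels `x^i` for `i : Fin m`,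
and `Sum.inr ()` labels `u`. -/
abbrev Idx (m : ℕ) : Type := Fin m ⊕ Unit

/-- Points `(x, u)` of the coordinate space. -/
abbrev Point (m : ℕ) : Type := Idx m → ℝ

/-- The label of the coordinate `u`. -/
abbrev uIdx {m : ℕ} : Idx m := Sum.inr ()

/-- Partial derivative of `f` with respect to the coordinate `a`, at `z`. -/
noncomputable def pd {m : ℕ} (a : Idx m) (f : Point m → ℝ) (z : Point m) : ℝ :=
  fderiv ℝ f z (Pi.single a 1)

/-- The total derivative `D_i f = f_{,i} + u_i f_{,u}` of a function `f` of `(x, u)`, at the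
point `z = (x, u)` and the first jet coordinates `p = (u_1, …, u_m)`. -/
noncomputable def totalD {m : ℕ} (i : Fin m) (f : Point m → ℝ) (z : Point m)
    (p : Fin m → ℝ) : ℝ :=
  pd (Sum.inl i) f z + p i * pd uIdx f z

/-- The quantity `|h| + |h| h^{ij} u_i u_j`, where `|h|` is the absolute value of the
determinant of `(h_{ij})`. -/
noncomputable def radicand {m : ℕ} (h : Point m → Matrix (Fin m) (Fin m) ℝ) (z : Point m)
    (p : Fin m → ℝ) : ℝ :=
  |(h z).det| + |(h z).det| * ∑ i, ∑ j, (h z)⁻¹ i j * p i * p j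

/-- The minimal surface Lagrangian `L = √(|h| + |h| h^{ij} u_i u_j)`. -/
noncomputable def lagrangian {m : ℕ} (h : Point m → Matrix (Fin m) (Fin m) ℝ) (z : Point m)
    (p : Fin m → ℝ) : ℝ :=
  Real.sqrt (radicand h z p)

/-- The coefficient `η_i = D_i η - u_j D_i ξ^j` of `∂/∂u_i` in the first prolongation of
`X = ξ^j ∂_{x^j} + η ∂_u`. -/
noncomputable def prolongCoeff {m : ℕ} (X : Point m → Point m) (i : Fin m) (z : Point m)
    (p : Fin m → ℝ) : ℝ :=
  totalD i (fun w => X w uIdx) z p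
    - ∑ j, p j * totalD i (fun w => X w (Sum.inl j)) z p

/-- The first prolongation `X^{[1]} = ξ^i ∂_{x^i} + η ∂_u + η_i ∂_{u_i}` applied to a
function `F` of `(x, u, u_i)`. -/
noncomputable def prolong {m : ℕ} (X : Point m → Point m) (F : Point m → (Fin m → ℝ) → ℝ)
    (z : Point m) (p : Fin m → ℝ) : ℝ :=
  (∑ a, X z a * pd a (fun w => F w p) z)
    + ∑ i, prolongCoeff X i z p * fderiv ℝ (F z) p (Pi.single i 1)

/-- The Noether condition `X^{[1]} L + L D_i ξ^i = D_i A^i` for the minimal surface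
Lagrangian, at every first jet over `U` at which the radicand is positive. -/
def NoetherCondition {m : ℕ} (U : Opens (Point m)) (h : Point m → Matrix (Fin m) (Fin m) ℝ)
    (X : Point m → Point m) (A : Point m → Fin m → ℝ) : Prop :=
  ∀ z ∈ U, ∀ p : Fin m → ℝ, 0 < radicand h z p →
    prolong X (lagrangian h) z p
        + lagrangian h z p * ∑ i, totalD i (fun w => X w (Sum.inl i)) z p
      = ∑ i, totalD i (fun w => A w i) z p

/-- `X` is a smooth vector field on `U`; it is extended by zero outside `U`, so that vector
fields on `U` are equal as soon as they agree on `U`. -/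
structure IsFieldOn {m : ℕ} (U : Opens (Point m)) (X : Point m → Point m) : Prop where
  smooth : ∀ a, ContDiffOn ℝ ∞ (fun z => X z a) U
  zero_outside : ∀ z, z ∉ U → X z = 0

theorem differentiableAt_of_mem {m : ℕ} {U : Opens (Point m)} {f : Point m → ℝ}
    (hf : ContDiffOn ℝ ∞ f U) {z : Point m} (hz : z ∈ U) : DifferentiableAt ℝ f z :=
  (hf.differentiableOn (by simp)).differentiableAt (U.isOpen.mem_nhds hz)

theorem pd_add {m : ℕ} {U : Opens (Point m)} {f g : Point m → ℝ}
    (hf : ContDiffOn ℝ ∞ f U) (hg : ContDiffOn ℝ ∞ g U) {z : Point m} (hz : z ∈ U)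
    (a : Idx m) : pd a (fun w => f w + g w) z = pd a f z + pd a g z := by
  unfold pd
  rw [fderiv_fun_add (differentiableAt_of_mem hf hz) (differentiableAt_of_mem hg hz)]
  rfl

theorem pd_smul {m : ℕ} {U : Opens (Point m)} {f : Point m → ℝ}
    (hf : ContDiffOn ℝ ∞ f U) {z : Point m} (hz : z ∈ U) (c : ℝ)
    (a : Idx m) : pd a (fun w => c * f w) z = c * pd a f z := by
  unfold pd
  rw [fderiv_const_mul (differentiableAt_of_mem hf hz)]
  rfl

theorem pd_zero {m : ℕ} (a : Idx m) (z : Point m) : pd a (fun _ => (0 : ℝ)) z = 0 := by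
  simp [pd]

theorem IsFieldOn.zero {m : ℕ} (U : Opens (Point m)) : IsFieldOn U 0 :=
  ⟨fun _ => contDiffOn_const, fun _ _ => rfl⟩

theorem IsFieldOn.add {m : ℕ} {U : Opens (Point m)} {X Y : Point m → Point m}
    (hX : IsFieldOn U X) (hY : IsFieldOn U Y) : IsFieldOn U (X + Y) :=
  ⟨fun a => (hX.smooth a).add (hY.smooth a),
    fun z hz => by simp [hX.zero_outside z hz, hY.zero_outside z hz]⟩

theorem IsFieldOn.smul {m : ℕ} {U : Opens (Point m)} {X : Point m → Point m}
    (c : ℝ) (hX : IsFieldOn U X) : IsFieldOn U (c • X) :=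
  ⟨fun a => contDiffOn_const.mul (hX.smooth a),
    fun z hz => by simp [hX.zero_outside z hz]⟩

/-- The Noether algebra `G_N`: the real vector space of the smooth vector fields `X` on `U`
that satisfy the Noether condition with some smooth gauge field `A^i(x, u)` on `U`. -/
noncomputable def noetherAlgebra {m : ℕ} (U : Opens (Point m))
    (h : Point m → Matrix (Fin m) (Fin m) ℝ) : Submodule ℝ (Point m → Point m) where
  carrier := {X | IsFieldOn U X ∧
    ∃ A : Point m → Fin m → ℝ, (∀ i, ContDiffOn ℝ ∞ (fun z => A z i) U) ∧
      NoetherCondition U h X A}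
  zero_mem' := by
    refine ⟨IsFieldOn.zero U, 0, fun _ => contDiffOn_const, fun z _ p _ => ?_⟩
    simp [prolong, prolongCoeff, totalD, pd_zero]
  add_mem' := by
    rintro X Y ⟨hX, A, hA, hXA⟩ ⟨hY, B, hB, hYB⟩
    refine ⟨hX.add hY, A + B, fun i => (hA i).add (hB i), fun z hz p hp => ?_⟩
    have e1 := hXA z hz p hp
    have e2 := hYB z hz p hp
    have f1 : ∀ (i : Fin m) (a : Idx m), totalD i (fun w => (X + Y) w a) z p
        = totalD i (fun w => X w a) z p + totalD i (fun w => Y w a) z p := by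
      intro i a
      simp only [totalD, Pi.add_apply, pd_add (hX.smooth a) (hY.smooth a) hz]
      ring
    have f2 : ∀ i : Fin m, totalD i (fun w => (A + B) w i) z p
        = totalD i (fun w => A w i) z p + totalD i (fun w => B w i) z p := by
      intro i
      simp only [totalD, Pi.add_apply, pd_add (hA i) (hB i) hz]
      ring
    have f3 : ∀ i : Fin m, prolongCoeff (X + Y) i z p
        = prolongCoeff X i z p + prolongCoeff Y i z p := by
      intro i
      simp only [prolongCoeff, f1, mul_add, Finset.sum_add_distrib]
      ring
    have f4 : prolong (X + Y) (lagrangian h) z p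
        = prolong X (lagrangian h) z p + prolong Y (lagrangian h) z p := by
      simp only [prolong, f3, Pi.add_apply, add_mul, Finset.sum_add_distrib]
      ring
    simp only [f1, f2, f4, Finset.sum_add_distrib]
    linarith
  smul_mem' := by
    rintro c X ⟨hX, A, hA, hXA⟩
    refine ⟨hX.smul c, c • A, fun i => contDiffOn_const.mul (hA i), fun z hz p hp => ?_⟩
    have e1 := hXA z hz p hp
    have f1 : ∀ (i : Fin m) (a : Idx m), totalD i (fun w => (c • X) w a) z p
        = c * totalD i (fun w => X w a) z p := by
      intro i a
      simp only [totalD, Pi.smul_apply, smul_eq_mul, pd_smul (hX.smooth a) hz]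
      ring
    have f2 : ∀ i : Fin m, totalD i (fun w => (c • A) w i) z p
        = c * totalD i (fun w => A w i) z p := by
      intro i
      simp only [totalD, Pi.smul_apply, smul_eq_mul, pd_smul (hA i) hz]
      ring
    have f3 : ∀ i : Fin m, prolongCoeff (c • X) i z p = c * prolongCoeff X i z p := by
      intro i
      simp only [prolongCoeff, f1, mul_sub, Finset.mul_sum, mul_left_comm]
    have f4 : prolong (c • X) (lagrangian h) z p = c * prolong X (lagrangian h) z p := by
      simp only [prolong, f3, Pi.smul_apply, smul_eq_mul, mul_add, Finset.mul_sum, mul_assoc]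
    simp only [f1, f2, f4, ← Finset.mul_sum]
    linear_combination c * e1

/-- The metric `g = du² + h_{ij}(u, x) dx^i dx^j`, as a matrix of functions. -/
def metric {m : ℕ} (h : Point m → Matrix (Fin m) (Fin m) ℝ) (z : Point m) :
    Matrix (Idx m) (Idx m) ℝ :=
  Matrix.fromBlocks (h z) 0 0 1

/-- The components `(L_X g)_{ab}` of the Lie derivative of the metric `g`. -/
noncomputable def lieMetric {m : ℕ} (h : Point m → Matrix (Fin m) (Fin m) ℝ)
    (X : Point m → Point m) (a b : Idx m) (z : Point m) : ℝ :=
  ∑ c, (X z c * pd c (fun w => metric h w a b) z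
    + metric h z c b * pd a (fun w => X w c) z
    + metric h z a c * pd b (fun w => X w c) z)

/-- The space of the Killing vector fields of `g` on `U`. -/
noncomputable def killingAlgebra {m : ℕ} (U : Opens (Point m))
    (h : Point m → Matrix (Fin m) (Fin m) ℝ) : Submodule ℝ (Point m → Point m) where
  carrier := {X | IsFieldOn U X ∧ ∀ z ∈ U, ∀ a b, lieMetric h X a b z = 0}
  zero_mem' := by
    refine ⟨IsFieldOn.zero U, fun z _ a b => ?_⟩
    simp [lieMetric, pd_zero]
  add_mem' := by
    rintro X Y ⟨hX, kX⟩ ⟨hY, kY⟩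
    refine ⟨hX.add hY, fun z hz a b => ?_⟩
    have e : lieMetric h (X + Y) a b z = lieMetric h X a b z + lieMetric h Y a b z := by
      simp only [lieMetric, ← Finset.sum_add_distrib]
      refine Finset.sum_congr rfl fun c _ => ?_
      simp only [Pi.add_apply, pd_add (hX.smooth c) (hY.smooth c) hz]
      ring
    rw [e, kX z hz, kY z hz, add_zero]
  smul_mem' := by
    rintro c X ⟨hX, kX⟩
    refine ⟨hX.smul c, fun z hz a b => ?_⟩
    have e : lieMetric h (c • X) a b z = c * lieMetric h X a b z := by
      simp only [lieMetric, Finset.mul_sum]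
      refine Finset.sum_congr rfl fun d _ => ?_
      simp only [Pi.smul_apply, smul_eq_mul, pd_smul (hX.smooth d) hz]
      ring
    rw [e, kX z hz, mul_zero]

/-- The space is maximally symmetric: with `n = m + 1` its dimension, the Killing vector
fields form a space of dimension `n (n + 1) / 2`. -/
def IsMaximallySymmetric {m : ℕ} (U : Opens (Point m))
    (h : Point m → Matrix (Fin m) (Fin m) ℝ) : Prop :=
  Module.finrank ℝ (killingAlgebra U h) = (m + 1) * (m + 2) / 2

/-- The Christoffel symbols `Γ^a_{bc}` of `g`. -/
noncomputable def christoffel {m : ℕ} (h : Point m → Matrix (Fin m) (Fin m) ℝ)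
    (a b c : Idx m) (z : Point m) : ℝ :=
  (1 / 2) * ∑ d, (metric h z)⁻¹ a d *
    (pd b (fun w => metric h w d c) z + pd c (fun w => metric h w d b) z
      - pd d (fun w => metric h w b c) z)

/-- The components `R^a_{bcd}` of the Riemann curvature tensor of `g`. -/
noncomputable def riemann {m : ℕ} (h : Point m → Matrix (Fin m) (Fin m) ℝ)
    (a b c d : Idx m) (z : Point m) : ℝ :=
  pd c (christoffel h a d b) z - pd d (christoffel h a c b) z
    + ∑ e, (christoffel h a c e z * christoffel h e d b z
      - christoffel h a d e z * christoffel h e c b z)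

/-- The metric `g` has constant curvature on `U`: there is a constant `K` with
`R_{abcd} = K (g_{ac} g_{bd} - g_{ad} g_{bc})` on `U`. -/
def HasConstantCurvature {m : ℕ} (U : Opens (Point m))
    (h : Point m → Matrix (Fin m) (Fin m) ℝ) : Prop :=
  ∃ K : ℝ, ∀ z ∈ U, ∀ a b c d : Idx m,
    ∑ e, metric h z a e * riemann h e b c d z
      = K * (metric h z a c * metric h z b d - metric h z a d * metric h z b c)

end MinimalSurface

/-!
# The Noether algebra of the minimal surface Lagrangian

Write `g = du² + h_{ij} dx^i dx^j` and let `S = L_X g`. Multiplied by `2 L`, the left-hand side of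
the Noether condition for `X` is a polynomial in the jet coordinates whose cubic terms cancel; in
terms of `v = h⁻¹ p` it is, up to the factor `|h|`,
`tr_h S + 2 S_{iu} v^i + (S_{uu} + tr_h S) h(v, v) - S_{ij} v^i v^j`
(`two_mul_lagrangian_mul_noether`). The right-hand side becomes `2 L` times an affine function of
`v`. Along a line on which `h(v, v) ≠ 0` the radicand `L²` is `|h| (1 + κ t²)` with `κ ≠ 0`, which
is not a square, so both sides vanish. What remains is `S_{iu} = 0`, `tr_h S = 0` and
`S_{ij} = S_{uu} h_{ij}`; the trace gives `S = 0` (`eq_zero_of_noether_identity`). Conversely `S = 0`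
makes the left-hand side vanish. Hence the Noether algebra is the algebra of Killing fields
(`noetherAlgebra_eq_killingAlgebra`), and the theorem becomes one on Killing fields.

*The bound.* The one-form `ξ` dual to a Killing field and its skew covariant derivative `F = ∇ξ`
satisfy the closed linear system `∇ξ = F`, `∇_e F_{ca} = R^d_{eca} ξ_d` (`pd_covGrad_of_skew`). A
solution that vanishes at one point of a connected domain vanishes (`eqOn_zero_of_norm_fderiv_le`),
so a Killing field is determined by its 1-jet `(ξ, F)` at one point. The 1-jets form the space of
skew matrices of size `n + 1` (`killingJet_injective`, `finrank_jets`).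

*Maximal symmetry implies constant curvature.* If every skew jet is attained, the integrability
condition of the system (`integrability_of_skew`) holds for all `(ξ, F)` at every point. With `ξ = 0`
it is a pointwise identity that forces `R_{abcd} = κ (g_{ac} g_{bd} - g_{ad} g_{bc})` for a function
`κ` (`curvature_eq_scalar`); with `F = 0` it forces `dκ = 0`. The second step replaces Schur's lemma
and also covers surfaces.

*The converse.* In constant curvature `K` the system `Hess f = -K f g` for `(f, df)` is integrable,
so on a simply connected domain it has a fundamental solution: local parallel sections come from
transport along segments (`exists_parallel_ball`), their germs form a covering, and the covering has
a global section (`exists_parallel_section`). For solutions `f_A` and a skew matrix `M` the form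
`M_{AB} f_A df_B` is dual to a Killing field, and every skew jet arises in this way
(`killingJet_surjective`).
-/

namespace MinimalSurface

/-! ### Unique continuation for linear differential inequalities, and transport along segments -/

section LinearPDE

open Set Metric Filter Topology

variable {E V : Type*} [NormedAddCommGroup E] [NormedSpace ℝ E]
  [NormedAddCommGroup V] [NormedSpace ℝ V]

/-- Grönwall's inequality along the segments issuing from `z₀`. -/
theorem eventually_eq_zero_of_norm_fderiv_le {U : Set E} (hU : IsOpen U) {s : E → V}
    {s' : E → E →L[ℝ] V} {C : E → ℝ} (hC : ContinuousOn C U)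
    (hs : ∀ z ∈ U, HasFDerivAt s (s' z) z) (hb : ∀ z ∈ U, ‖s' z‖ ≤ C z * ‖s z‖)
    {z₀ : E} (hz₀ : z₀ ∈ U) (h0 : s z₀ = 0) : ∀ᶠ z in 𝓝 z₀, s z = 0 := by
  have hCat : ContinuousAt C z₀ := hC.continuousAt (hU.mem_nhds hz₀)
  have h1 : ∀ᶠ z in 𝓝 z₀, C z < C z₀ + 1 := hCat.eventually_lt_const (by linarith)
  obtain ⟨r, hr, hball⟩ := Metric.eventually_nhds_iff_ball.1 (h1.and (hU.mem_nhds hz₀))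
  refine Metric.eventually_nhds_iff_ball.2 ⟨r, hr, fun z hz => ?_⟩
  have hmem : ∀ t ∈ Icc (0 : ℝ) 1, z₀ + t • (z - z₀) ∈ ball z₀ r := by
    intro t ht
    rw [mem_ball_iff_norm] at hz ⊢
    rw [add_sub_cancel_left, norm_smul, Real.norm_of_nonneg ht.1]
    exact (mul_le_of_le_one_left (norm_nonneg _) ht.2).trans_lt hz
  have hd : ∀ t ∈ Icc (0 : ℝ) 1, HasDerivAt (fun t : ℝ => s (z₀ + t • (z - z₀)))
      (s' (z₀ + t • (z - z₀)) (z - z₀)) t := by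
    intro t ht
    have hl : HasDerivAt (fun t : ℝ => z₀ + t • (z - z₀)) (z - z₀) t := by
      simpa using ((hasDerivAt_id t).smul_const (z - z₀)).const_add z₀
    exact (hs _ (hball _ (hmem t ht)).2).comp_hasDerivAt t hl
  have key := eq_zero_of_abs_deriv_le_mul_abs_self_of_eq_zero_right (a := 0) (b := 1)
    (K := (C z₀ + 1) * ‖z - z₀‖)
    (fun t ht => (hd t ht).continuousAt.continuousWithinAt)
    (fun t ht => (hd t (Ico_subset_Icc_self ht)).hasDerivWithinAt) (by simpa using h0)
    (fun t ht => by
      have hm := hball _ (hmem t (Ico_subset_Icc_self ht))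
      refine (ContinuousLinearMap.le_opNorm _ _).trans ?_
      have h2 := (hb _ hm.2).trans (mul_le_mul_of_nonneg_right hm.1.le (norm_nonneg _))
      calc _ ≤ (C z₀ + 1) * ‖s (z₀ + t • (z - z₀))‖ * ‖z - z₀‖ :=
            mul_le_mul_of_nonneg_right h2 (norm_nonneg _)
        _ = _ := by ring)
  simpa using key 1 (right_mem_Icc.2 zero_le_one)

/-- Unique continuation: a function whose derivative is bounded by a locally bounded multiple of
its own norm vanishes on a connected open set as soon as it vanishes at one point. -/
theorem eqOn_zero_of_norm_fderiv_le {U : Set E} (hU : IsOpen U) (hUc : IsPreconnected U)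
    {s : E → V} {s' : E → E →L[ℝ] V} {C : E → ℝ} (hC : ContinuousOn C U)
    (hs : ∀ z ∈ U, HasFDerivAt s (s' z) z) (hb : ∀ z ∈ U, ‖s' z‖ ≤ C z * ‖s z‖)
    {z₀ : E} (hz₀ : z₀ ∈ U) (h0 : s z₀ = 0) : ∀ z ∈ U, s z = 0 := by
  have hloc := fun {z} (hz : z ∈ U) (h : s z = 0) =>
    eventually_eq_zero_of_norm_fderiv_le hU hC hs hb hz h
  have hsub : U ⊆ {z | ∀ᶠ y in 𝓝 z, s y = 0} := by
    refine hUc.subset_of_closure_inter_subset isOpen_setOfPred_eventually_nhds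
      ⟨z₀, hz₀, hloc hz₀ h0⟩ fun z hz => hloc hz.2 ?_
    by_contra hne
    have hev : ∀ᶠ y in 𝓝 z, s y ≠ 0 := (hs z hz.2).continuousAt.eventually_ne hne
    obtain ⟨y, hy1, hy2⟩ := mem_closure_iff_nhds.1 hz.1 _ hev
    exact hy1 hy2.self_of_nhds
  exact fun z hz => (hsub hz).self_of_nhds

end LinearPDE

section FlatConnection

open Set Metric Filter Topology

variable {E 𝔸 : Type*} [NormedAddCommGroup E] [NormedSpace ℝ E]
  [NormedRing 𝔸] [NormedAlgebra ℝ 𝔸]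

/-- `S` is a parallel section at `z` of the linear connection with connection form `A`:
its derivative in the direction `w` is `A z w * S z`. -/
def IsParallelAt (A : E → E →L[ℝ] 𝔸) (S : E → 𝔸) (z : E) : Prop :=
  HasFDerivAt S (((ContinuousLinearMap.mul ℝ 𝔸).flip (S z)).comp (A z)) z

/-- Grönwall's inequality in the form used below; the constants suffice because
`exp (1 / 2) ≤ 2`. -/
theorem gronwall_unit_interval {f f' : ℝ → 𝔸} {ε : ℝ} (hε : 0 ≤ ε)
    (hf : ∀ t ∈ Icc (0 : ℝ) 1, HasDerivWithinAt f (f' t) (Icc 0 1) t) (h0 : f 0 = 0)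
    (hb : ∀ t ∈ Icc (0 : ℝ) 1, ‖f' t‖ ≤ 1 / 2 * ‖f t‖ + ε) :
    ∀ t ∈ Icc (0 : ℝ) 1, ‖f t‖ ≤ 2 * ε := by
  intro t ht
  have key := norm_le_gronwallBound_of_norm_deriv_right_le (f := f) (f' := f') (a := 0) (b := 1)
    (δ := 0) (K := 1 / 2) (ε := ε) (fun t ht => (hf t ht).continuousWithinAt)
    (fun t ht => (hf t (Ico_subset_Icc_self ht)).mono_of_mem_nhdsWithin
      (Icc_mem_nhdsGE_of_mem ht)) (by simp [h0])
    (fun t ht => hb t (Ico_subset_Icc_self ht)) t ht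
  rw [gronwallBound_of_K_ne_0 (by norm_num)] at key
  have h1 : Real.exp (1 / 2 * (t - 0)) ≤ 2 := by
    have h2 : Real.exp (1 / 2 * (t - 0)) ≤ Real.exp (1 / 2) :=
      Real.exp_le_exp.2 (by linarith [ht.2])
    have h3 : Real.exp (1 / 2) * Real.exp (1 / 2) = Real.exp 1 := by
      rw [← Real.exp_add]; norm_num
    have := Real.exp_one_lt_d9
    nlinarith [Real.exp_pos (1 / 2)]
  refine key.trans ?_
  have : ε * (Real.exp (1 / 2 * (t - 0)) - 1) ≤ ε * 1 :=
    mul_le_mul_of_nonneg_left (by linarith) hε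
  simp only [zero_mul, zero_add, div_div_eq_mul_div, div_one]
  linarith

/-- Solutions of the transport equation along the segment from `z₀` to `z₀ + w`. -/
theorem exists_radial_transport [CompleteSpace 𝔸] {A : E → E →L[ℝ] 𝔸} {z₀ w : E}
    (hA : ∀ t ∈ Icc (0 : ℝ) 1, ContinuousAt A (z₀ + t • w))
    (hb : ∀ t ∈ Icc (0 : ℝ) 1, ‖A (z₀ + t • w) w‖ ≤ 1 / 2) :
    ∃ Y : ℝ → 𝔸, Y 0 = 1 ∧ (∀ t ∈ Icc (0 : ℝ) 1,
      HasDerivWithinAt Y (A (z₀ + t • w) w * Y t) (Icc 0 1) t) ∧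
      ∀ t ∈ Icc (0 : ℝ) 1, ‖Y t‖ ≤ 2 * ‖(1 : 𝔸)‖ := by
  have hpl : IsPicardLindelof (fun t y => A (z₀ + t • w) w * y)
      (⟨0, left_mem_Icc.2 zero_le_one⟩ : Icc (0 : ℝ) 1) (1 : 𝔸) (‖(1 : 𝔸)‖₊ + 1) 0
      (‖(1 : 𝔸)‖₊ + 1) (1 / 2) := by
    refine ⟨fun t ht => LipschitzOnWith.of_dist_le_mul fun x _ y _ => ?_, fun x _ => ?_,
      fun t ht x hx => ?_, by simp⟩
    · rw [dist_eq_norm, dist_eq_norm, ← mul_sub]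
      exact (norm_mul_le _ _).trans (by
        simpa using mul_le_mul_of_nonneg_right (hb t ht) (norm_nonneg (x - y)))
    · intro t ht
      have h1 : ContinuousAt (fun t : ℝ => A (z₀ + t • w)) t :=
        ContinuousAt.comp (f := fun t : ℝ => z₀ + t • w) (hA t ht) (by fun_prop)
      exact ((h1.clm_apply continuousAt_const).mul continuousAt_const).continuousWithinAt
    · refine (norm_mul_le _ _).trans ?_
      have h1 : ‖x‖ ≤ ‖(1 : 𝔸)‖ + (‖(1 : 𝔸)‖ + 1) := by
        have h2 : ‖x - 1‖ ≤ ‖(1 : 𝔸)‖ + 1 := by simpa [dist_eq_norm] using hx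
        calc ‖x‖ = ‖1 + (x - 1)‖ := by rw [add_sub_cancel]
          _ ≤ _ := (norm_add_le _ _).trans (by linarith)
      have h3 := mul_le_mul (hb t ht) h1 (norm_nonneg _) (by norm_num)
      simp only [NNReal.coe_add, coe_nnnorm, NNReal.coe_one]
      linarith
  obtain ⟨Y, hY0, hY⟩ := hpl.exists_eq_forall_mem_Icc_hasDerivWithinAt₀
  refine ⟨Y, hY0, hY, fun t ht => ?_⟩
  have h0 := gronwall_unit_interval (f := fun t => Y t - 1)
    (ε := 1 / 2 * ‖(1 : 𝔸)‖) (by positivity) (fun t ht => (hY t ht).sub_const 1)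
    (by simp [hY0]) (fun t ht => ?_) t ht
  · have h4 : ‖Y t‖ ≤ ‖Y t - 1‖ + ‖(1 : 𝔸)‖ := by
      simpa using norm_add_le (Y t - 1) 1
    linarith
  · refine (norm_mul_le _ _).trans ?_
    have h4 : ‖Y t‖ ≤ ‖Y t - 1‖ + ‖(1 : 𝔸)‖ := by
      simpa using norm_add_le (Y t - 1) 1
    have h3 := mul_le_mul (hb t ht) h4 (norm_nonneg _) (by norm_num)
    linarith

end FlatConnection

section FlatConnection

open Set Metric Filter Topology

variable {E 𝔸 : Type*} [NormedAddCommGroup E] [NormedSpace ℝ E]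
  [NormedRing 𝔸] [NormedAlgebra ℝ 𝔸]

/-- A twice differentiable map satisfies uniform first- and second-order Taylor bounds on a small
ball. The radius is small against the bound `M`, so that Grönwall factors stay bounded. -/
theorem exists_ball_taylor_bounds {F : Type*} [NormedAddCommGroup F] [NormedSpace ℝ F]
    {U : Set E} (hU : IsOpen U) {A : E → F} (hA : ContDiffOn ℝ 2 A U)
    {z₀ : E} (hz₀ : z₀ ∈ U) :
    ∃ r > 0, ∃ M > 0, ∃ K ≥ 0, ball z₀ r ⊆ U ∧ M * r ≤ 1 / 2 ∧
      (∀ z ∈ ball z₀ r, ‖A z‖ ≤ M) ∧ (∀ z ∈ ball z₀ r, ‖fderiv ℝ A z‖ ≤ M) ∧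
      ∀ z ∈ ball z₀ r, ∀ y ∈ ball z₀ r,
        ‖A y - A z‖ ≤ M * ‖y - z‖ ∧ ‖A y - A z - fderiv ℝ A z (y - z)‖ ≤ K * ‖y - z‖ ^ 2 := by
  have hnhds := hU.mem_nhds hz₀
  have hAt : ContDiffAt ℝ 2 A z₀ := hA.contDiffAt hnhds
  have hD : ContDiffAt ℝ 1 (fderiv ℝ A) z₀ := hAt.fderiv_right (by norm_num)
  obtain ⟨K, t, ht, hK⟩ := hD.exists_lipschitzOnWith
  have h1 : ∀ᶠ z in 𝓝 z₀, ‖A z‖ < ‖A z₀‖ + 1 :=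
    hAt.continuousAt.norm.eventually_lt_const (by linarith)
  have h2 : ∀ᶠ z in 𝓝 z₀, ‖fderiv ℝ A z‖ < ‖fderiv ℝ A z₀‖ + 1 :=
    hD.continuousAt.norm.eventually_lt_const (by linarith)
  have h3 : ∀ᶠ z in 𝓝 z₀, z ∈ U := hnhds
  have h4 : ∀ᶠ z in 𝓝 z₀, z ∈ t := ht
  obtain ⟨R, hR, hball⟩ := Metric.eventually_nhds_iff_ball.1
    ((h1.and h2).and (h3.and h4))
  set M := ‖A z₀‖ + ‖fderiv ℝ A z₀‖ + 1
  have hM : 0 < M := by positivity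
  refine ⟨min R (1 / (2 * M)), by positivity, M, hM, K, K.2, fun z hz => ?_, ?_, fun z hz => ?_,
    fun z hz => ?_, fun z hz y hy => ?_⟩
  · exact (hball z (ball_subset_ball (min_le_left _ _) hz)).2.1
  · calc M * min R (1 / (2 * M)) ≤ M * (1 / (2 * M)) :=
        mul_le_mul_of_nonneg_left (min_le_right _ _) hM.le
      _ = 1 / 2 := by field_simp
  · have := (hball z (ball_subset_ball (min_le_left _ _) hz)).1.1
    have h3 := norm_nonneg (fderiv ℝ A z₀)
    simp only [M]; linarith
  · have := (hball z (ball_subset_ball (min_le_left _ _) hz)).1.2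
    have h3 := norm_nonneg (A z₀)
    simp only [M]; linarith
  · have hz' := ball_subset_ball (min_le_left _ _) hz
    have hy' := ball_subset_ball (min_le_left _ _) hy
    have hseg : segment ℝ z y ⊆ ball z₀ R := (convex_ball z₀ R).segment_subset hz' hy'
    have hdiff : ∀ x ∈ segment ℝ z y, HasFDerivWithinAt A (fderiv ℝ A x) (segment ℝ z y) x :=
      fun x hx => ((hA.differentiableOn (by norm_num)).differentiableAt
        (hU.mem_nhds (hball x (hseg hx)).2.1)).hasFDerivAt.hasFDerivWithinAt
    constructor
    · refine (convex_segment z y).norm_image_sub_le_of_norm_hasFDerivWithin_le hdiff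
        (fun x hx => ?_) (left_mem_segment ℝ z y) (right_mem_segment ℝ z y)
      have := (hball x (hseg hx)).1.2
      have h3 := norm_nonneg (A z₀)
      simp only [M]; linarith
    · have := (convex_segment z y).norm_image_sub_le_of_norm_hasFDerivWithin_le'
        (φ := fderiv ℝ A z) (C := K * ‖y - z‖) hdiff
        (fun x hx => ?_) (left_mem_segment ℝ z y) (right_mem_segment ℝ z y)
      · rw [pow_two, ← mul_assoc]; exact this
      · have h4 := hK.dist_le_mul x (hball x (hseg hx)).2.2 z (hball z hz').2.2
        rw [dist_eq_norm, dist_eq_norm] at h4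
        exact h4.trans (mul_le_mul_of_nonneg_left (norm_sub_le_of_mem_segment hx) K.2)

/-- The difference of the transports along two neighbouring segments is, to first order, given by
the connection form: this is where flatness enters. -/
theorem norm_radial_transport_sub_le {U : Set E} {A : E → E →L[ℝ] 𝔸} {z₀ : E}
    (hflat : ∀ z ∈ U, ∀ u w, fderiv ℝ A z u w + A z w * A z u = fderiv ℝ A z w u + A z u * A z w)
    (hAd : ∀ z ∈ U, DifferentiableAt ℝ A z)
    {r M K N : ℝ} (hr : 0 < r) (hM : 0 < M) (hK : 0 ≤ K) (hN : 0 ≤ N) (hU : ball z₀ r ⊆ U)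
    (hMr : M * r ≤ 1 / 2)
    (hA : ∀ z ∈ ball z₀ r, ‖A z‖ ≤ M) (hA' : ∀ z ∈ ball z₀ r, ‖fderiv ℝ A z‖ ≤ M)
    (hT : ∀ z ∈ ball z₀ r, ∀ y ∈ ball z₀ r,
        ‖A y - A z‖ ≤ M * ‖y - z‖ ∧ ‖A y - A z - fderiv ℝ A z (y - z)‖ ≤ K * ‖y - z‖ ^ 2)
    {v w : E} (hv : ‖v‖ < r) (hvw : ‖v + w‖ < r) {Y Y' : ℝ → 𝔸} (hY0 : Y 0 = 1) (hY0' : Y' 0 = 1)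
    (hY : ∀ t ∈ Icc (0 : ℝ) 1, HasDerivWithinAt Y (A (z₀ + t • v) v * Y t) (Icc 0 1) t)
    (hY' : ∀ t ∈ Icc (0 : ℝ) 1,
      HasDerivWithinAt Y' (A (z₀ + t • (v + w)) (v + w) * Y' t) (Icc 0 1) t)
    (hYb : ∀ t ∈ Icc (0 : ℝ) 1, ‖Y' t‖ ≤ N) :
    ‖Y' 1 - Y 1 - A (z₀ + v) w * Y 1‖
      ≤ 2 * (K * r * N + M * N + 4 * M * (M * r + M) * N * (r + 1)) * ‖w‖ ^ 2 := by
  have hmem : ∀ {x : E}, ‖x‖ < r → ∀ t ∈ Icc (0 : ℝ) 1, z₀ + t • x ∈ ball z₀ r := by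
    intro x hx t ht
    rw [mem_ball_iff_norm, add_sub_cancel_left, norm_smul, Real.norm_of_nonneg ht.1]
    exact (mul_le_of_le_one_left (norm_nonneg _) ht.2).trans_lt hx
  have hdisp : ∀ t : ℝ, z₀ + t • (v + w) - (z₀ + t • v) = t • w := by
    intro t; rw [smul_add]; abel
  have htw : ∀ t ∈ Icc (0 : ℝ) 1, ‖t • w‖ ≤ ‖w‖ := fun t ht => by
    rw [norm_smul, Real.norm_of_nonneg ht.1]
    exact mul_le_of_le_one_left (norm_nonneg _) ht.2
  have hw0 := norm_nonneg w
  have happ : ∀ z ∈ ball z₀ r, ∀ x, ‖A z x‖ ≤ M * ‖x‖ := fun z hz x =>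
    (A z).le_of_opNorm_le (hA z hz) x
  have happ' : ∀ z ∈ ball z₀ r, ∀ x y, ‖fderiv ℝ A z x y‖ ≤ M * ‖x‖ * ‖y‖ := fun z hz x y =>
    ((fderiv ℝ A z x).le_opNorm y).trans (mul_le_mul_of_nonneg_right
      ((fderiv ℝ A z).le_of_opNorm_le (hA' z hz) x) (norm_nonneg _))
  have happv : ∀ t ∈ Icc (0 : ℝ) 1, ‖A (z₀ + t • v) v‖ ≤ 1 / 2 := fun t ht =>
    (happ _ (hmem hv t ht) v).trans ((mul_le_mul_of_nonneg_left hv.le hM.le).trans hMr)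
  -- The two transports differ by `O(‖w‖)`
  have hZ : ∀ t ∈ Icc (0 : ℝ) 1, ‖Y' t - Y t‖ ≤ 2 * ((M * r + M) * ‖w‖ * N) := by
    refine gronwall_unit_interval (by positivity) (fun t ht => (hY' t ht).sub (hY t ht))
      (by simp [hY0, hY0']) fun t ht => ?_
    have e : A (z₀ + t • (v + w)) (v + w) * Y' t - A (z₀ + t • v) v * Y t
        = A (z₀ + t • v) v * (Y' t - Y t)
          + ((A (z₀ + t • (v + w)) - A (z₀ + t • v)) (v + w) + A (z₀ + t • v) w) * Y' t := by
      simp only [sub_apply, map_add]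
      noncomm_ring
    rw [e]
    refine (norm_add_le _ _).trans (add_le_add ?_ ?_)
    · exact (norm_mul_le _ _).trans (mul_le_mul_of_nonneg_right (happv t ht) (norm_nonneg _))
    · refine (norm_mul_le _ _).trans (mul_le_mul ?_ (hYb t ht) (norm_nonneg _) (by positivity))
      have h1 := (hT _ (hmem hv t ht) _ (hmem hvw t ht)).1
      rw [hdisp] at h1
      have h2 : ‖(A (z₀ + t • (v + w)) - A (z₀ + t • v)) (v + w)‖ ≤ M * ‖w‖ * r :=
        (ContinuousLinearMap.le_opNorm _ _).trans (mul_le_mul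
          (h1.trans (mul_le_mul_of_nonneg_left (htw t ht) hM.le)) hvw.le (norm_nonneg _)
          (by positivity))
      have h3 := happ _ (hmem hv t ht) w
      calc _ ≤ _ := norm_add_le _ _
        _ ≤ M * ‖w‖ * r + M * ‖w‖ := add_le_add h2 h3
        _ = _ := by ring
  have hγ : ∀ t : ℝ, HasDerivAt (fun t : ℝ => z₀ + t • v) v t := fun t => by
    simpa using ((hasDerivAt_id t).smul_const v).const_add z₀
  have hAγ : ∀ t ∈ Icc (0 : ℝ) 1, HasDerivAt (fun t : ℝ => A (z₀ + t • v) w)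
      (fderiv ℝ A (z₀ + t • v) v w) t := by
    intro t ht
    have h1 := (hAd _ (hU (hmem hv t ht))).hasFDerivAt.comp_hasDerivAt t (hγ t)
    simpa using h1.clm_apply (hasDerivAt_const t w)
  have hE := gronwall_unit_interval
    (f := fun t => Y' t - Y t - t • (A (z₀ + t • v) w * Y t))
    (f' := fun t => A (z₀ + t • (v + w)) (v + w) * Y' t - A (z₀ + t • v) v * Y t
      - (t • (fderiv ℝ A (z₀ + t • v) v w * Y t + A (z₀ + t • v) w * (A (z₀ + t • v) v * Y t))
        + (1 : ℝ) • (A (z₀ + t • v) w * Y t)))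
    (ε := (K * r * N + M * N + 4 * M * (M * r + M) * N * (r + 1)) * ‖w‖ ^ 2)
    (by positivity)
    (fun t ht => ((hY' t ht).sub (hY t ht)).sub ((hasDerivAt_id t).hasDerivWithinAt.smul
      ((hAγ t ht).hasDerivWithinAt.mul (hY t ht)))) (by simp [hY0, hY0']) ?_ 1
      (right_mem_Icc.2 zero_le_one)
  · simpa [mul_assoc] using hE
  intro t ht
  have hz := hmem hv t ht
  have hfl := hflat _ (hU hz) v w
  have e : A (z₀ + t • (v + w)) (v + w) * Y' t - A (z₀ + t • v) v * Y t
      - (t • (fderiv ℝ A (z₀ + t • v) v w * Y t + A (z₀ + t • v) w * (A (z₀ + t • v) v * Y t))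
        + (1 : ℝ) • (A (z₀ + t • v) w * Y t))
      = A (z₀ + t • v) v * (Y' t - Y t - t • (A (z₀ + t • v) w * Y t))
        + ((A (z₀ + t • (v + w)) - A (z₀ + t • v) - fderiv ℝ A (z₀ + t • v) (t • w)) (v + w) * Y' t
          + t • (fderiv ℝ A (z₀ + t • v) w w * Y' t)
          + t • (fderiv ℝ A (z₀ + t • v) w v * (Y' t - Y t))
          + A (z₀ + t • v) w * (Y' t - Y t)) := by
    have hfl' : fderiv ℝ A (z₀ + t • v) v w = fderiv ℝ A (z₀ + t • v) w v
        + A (z₀ + t • v) v * A (z₀ + t • v) w - A (z₀ + t • v) w * A (z₀ + t • v) v :=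
      eq_sub_of_add_eq hfl
    rw [hfl']
    simp only [sub_apply, map_add, map_smul, smul_apply,
      one_smul, smul_add, smul_sub, mul_sub, sub_mul, add_mul, smul_mul_assoc,
      mul_smul_comm, mul_assoc]
    abel
  rw [e]
  have ht1 : ‖t‖ ≤ 1 := by rw [Real.norm_of_nonneg ht.1]; exact ht.2
  have hZt := hZ t ht
  refine (norm_add_le _ _).trans (add_le_add ?_ ?_)
  · exact (norm_mul_le _ _).trans (mul_le_mul_of_nonneg_right (happv t ht) (norm_nonneg _))
  have h1 : ‖(A (z₀ + t • (v + w)) - A (z₀ + t • v) - fderiv ℝ A (z₀ + t • v) (t • w)) (v + w)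
      * Y' t‖ ≤ K * ‖w‖ ^ 2 * r * N := by
    refine (norm_mul_le _ _).trans (mul_le_mul ?_ (hYb t ht) (norm_nonneg _) (by positivity))
    have h2 := (hT _ hz _ (hmem hvw t ht)).2
    rw [hdisp] at h2
    exact (ContinuousLinearMap.le_opNorm _ _).trans (mul_le_mul (h2.trans
      (mul_le_mul_of_nonneg_left (pow_le_pow_left₀ (norm_nonneg _) (htw t ht) 2) hK))
      hvw.le (norm_nonneg _) (by positivity))
  have hsm : ∀ x : 𝔸, ‖t • x‖ ≤ ‖x‖ := fun x => by
    rw [norm_smul]; exact mul_le_of_le_one_left (norm_nonneg _) ht1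
  have h2 : ‖t • (fderiv ℝ A (z₀ + t • v) w w * Y' t)‖ ≤ M * ‖w‖ * ‖w‖ * N :=
    (hsm _).trans ((norm_mul_le _ _).trans (mul_le_mul (happ' _ hz _ _) (hYb t ht)
      (norm_nonneg _) (by positivity)))
  have h3 : ‖t • (fderiv ℝ A (z₀ + t • v) w v * (Y' t - Y t))‖
      ≤ M * ‖w‖ * r * (2 * ((M * r + M) * ‖w‖ * N)) :=
    (hsm _).trans ((norm_mul_le _ _).trans (mul_le_mul ((happ' _ hz _ _).trans
      (mul_le_mul_of_nonneg_left hv.le (by positivity))) hZt (norm_nonneg _) (by positivity)))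
  have h4 : ‖A (z₀ + t • v) w * (Y' t - Y t)‖ ≤ M * ‖w‖ * (2 * ((M * r + M) * ‖w‖ * N)) :=
    (norm_mul_le _ _).trans (mul_le_mul (happ _ hz _) hZt (norm_nonneg _) (by positivity))
  have h5 := norm_add₄_le (a := (A (z₀ + t • (v + w)) - A (z₀ + t • v) - fderiv ℝ A (z₀ + t • v)
    (t • w)) (v + w) * Y' t) (b := t • (fderiv ℝ A (z₀ + t • v) w w * Y' t))
    (c := t • (fderiv ℝ A (z₀ + t • v) w v * (Y' t - Y t)))
    (d := A (z₀ + t • v) w * (Y' t - Y t))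
  refine h5.trans ((add_le_add (add_le_add (add_le_add h1 h2) h3) h4).trans ?_)
  have h6 : 0 ≤ M * (M * r + M) * N * (r + 1) * ‖w‖ ^ 2 := by positivity
  nlinarith [h6]

end FlatConnection

/-! ### Parallel sections of a flat connection over a simply connected domain -/

section FlatConnection

open Set Metric Filter Topology

variable {E 𝔸 : Type*} [NormedAddCommGroup E] [NormedSpace ℝ E]
  [NormedRing 𝔸] [NormedAlgebra ℝ 𝔸]

/-- A flat linear connection has, near every point, an invertible parallel section: it is obtained
by parallel transport along the segments issuing from that point. -/
theorem exists_parallel_ball [CompleteSpace 𝔸] {U : Set E} (hU : IsOpen U) {A : E → E →L[ℝ] 𝔸}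
    (hA : ContDiffOn ℝ 2 A U)
    (hflat : ∀ z ∈ U, ∀ u w, fderiv ℝ A z u w + A z w * A z u = fderiv ℝ A z w u + A z u * A z w)
    {z₀ : E} (hz₀ : z₀ ∈ U) :
    ∃ r > 0, ball z₀ r ⊆ U ∧ ∃ S : E → 𝔸, S z₀ = 1 ∧
      ∀ z ∈ ball z₀ r, IsParallelAt A S z ∧ IsUnit (S z) := by
  obtain ⟨r, hr, M, hM, K, hK, hrU, hMr, hAb, hA'b, hT⟩ := exists_ball_taylor_bounds hU hA hz₀
  have hAd : ∀ z ∈ U, DifferentiableAt ℝ A z := fun z hz =>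
    (hA.differentiableOn (by norm_num)).differentiableAt (hU.mem_nhds hz)
  have hmem : ∀ {x : E}, ‖x‖ < r → ∀ t ∈ Icc (0 : ℝ) 1, z₀ + t • x ∈ ball z₀ r := by
    intro x hx t ht
    rw [mem_ball_iff_norm, add_sub_cancel_left, norm_smul, Real.norm_of_nonneg ht.1]
    exact (mul_le_of_le_one_left (norm_nonneg _) ht.2).trans_lt hx
  have hex : ∀ w : E, ∃ Y : ℝ → 𝔸, ‖w‖ < r → Y 0 = 1 ∧ (∀ t ∈ Icc (0 : ℝ) 1,
      HasDerivWithinAt Y (A (z₀ + t • w) w * Y t) (Icc 0 1) t) ∧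
      ∀ t ∈ Icc (0 : ℝ) 1, ‖Y t‖ ≤ 2 * ‖(1 : 𝔸)‖ := by
    intro w
    by_cases hw : ‖w‖ < r
    · obtain ⟨Y, hY⟩ := exists_radial_transport (A := A) (z₀ := z₀) (w := w)
        (fun t ht => (hAd _ (hrU (hmem hw t ht))).continuousAt)
        (fun t ht => ((A _).le_of_opNorm_le (hAb _ (hmem hw t ht)) w).trans
          ((mul_le_mul_of_nonneg_left hw.le hM.le).trans hMr))
      exact ⟨Y, fun _ => hY⟩
    · exact ⟨0, fun h => absurd h hw⟩
  choose Y hY using hex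
  have hpar : ∀ z ∈ ball z₀ r, IsParallelAt A (fun z => Y (z - z₀) 1) z := by
    intro z hz
    have hv : ‖z - z₀‖ < r := by rwa [mem_ball_iff_norm] at hz
    set C := 2 * (K * r * (2 * ‖(1 : 𝔸)‖) + M * (2 * ‖(1 : 𝔸)‖)
      + 4 * M * (M * r + M) * (2 * ‖(1 : 𝔸)‖) * (r + 1))
    have hbd : ∀ᶠ w in 𝓝 (0 : E), ‖Y (z + w - z₀) 1 - Y (z - z₀) 1 - A z w * Y (z - z₀) 1‖
        ≤ C * ‖‖w‖ ^ 2‖ := by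
      have h1 : ∀ᶠ w in 𝓝 (0 : E), ‖z - z₀ + w‖ < r := by
        have hc : ContinuousAt (fun w : E => ‖z - z₀ + w‖) 0 := by fun_prop
        exact hc.eventually_lt_const (by simpa using hv)
      filter_upwards [h1] with w hw
      have key := norm_radial_transport_sub_le hflat hAd hr hM hK (by positivity) hrU hMr hAb hA'b
        hT hv hw (hY _ hv).1 (hY _ hw).1 (hY _ hv).2.1 (hY _ hw).2.1 (hY _ hw).2.2
      rw [add_sub_cancel, show z - z₀ + w = z + w - z₀ by abel] at key
      simpa [C] using key
    rw [IsParallelAt, hasFDerivAt_iff_isLittleO_nhds_zero]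
    have hO : (fun w : E => ‖w‖ ^ 2) =o[𝓝 0] fun w : E => w := by
      simpa using (Asymptotics.isLittleO_norm_pow_id one_lt_two : (fun w : E => ‖w‖ ^ 2) =o[𝓝 0] id)
    exact (Asymptotics.IsBigO.of_bound C hbd).trans_isLittleO hO
  have h1 : Y (z₀ - z₀) 1 = 1 := by
    have h0 : ‖z₀ - z₀‖ < r := by simpa using hr
    have := gronwall_unit_interval (f := fun t => Y (z₀ - z₀) t - 1) (ε := 0) le_rfl
      (fun t ht => ((hY _ h0).2.1 t ht).sub_const 1) (sub_eq_zero.2 (hY _ h0).1)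
      (fun t _ => by simp) 1 (right_mem_Icc.2 zero_le_one)
    rw [mul_zero] at this
    exact sub_eq_zero.1 (norm_le_zero_iff.1 this)
  have hunit : ∀ᶠ z in 𝓝 z₀, IsUnit (Y (z - z₀) 1) := by
    have hc : ContinuousAt (fun z => Y (z - z₀) 1) z₀ := (hpar z₀ (mem_ball_self hr)).continuousAt
    refine hc.eventually (Units.isOpen.mem_nhds ?_)
    change IsUnit (Y (z₀ - z₀) 1)
    rw [h1]
    exact isUnit_one
  obtain ⟨ρ, hρ, hball⟩ := Metric.eventually_nhds_iff_ball.1 hunit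
  refine ⟨min r ρ, lt_min hr hρ, (ball_subset_ball (min_le_left _ _)).trans hrU,
    fun z => Y (z - z₀) 1, h1, fun z hz => ⟨hpar z (ball_subset_ball (min_le_left _ _) hz),
      hball z (ball_subset_ball (min_le_right _ _) hz)⟩⟩

theorem IsParallelAt.mul_const {A : E → E →L[ℝ] 𝔸} {S : E → 𝔸} {z : E} (h : IsParallelAt A S z)
    (c : 𝔸) : IsParallelAt A (fun z => S z * c) z := by
  have h1 : HasFDerivAt (fun z => S z * c) _ z :=
    (((ContinuousLinearMap.mul ℝ 𝔸).flip c).hasFDerivAt).comp z h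
  refine h1.congr_fderiv ?_
  ext w
  simp [mul_assoc]

theorem IsParallelAt.sub {A : E → E →L[ℝ] 𝔸} {S T : E → 𝔸} {z : E} (hS : IsParallelAt A S z)
    (hT : IsParallelAt A T z) : IsParallelAt A (fun z => S z - T z) z := by
  refine (HasFDerivAt.fun_sub hS hT).congr_fderiv ?_
  ext w
  simp

/-- Parallel sections over a connected open set that agree at one point agree everywhere. -/
theorem IsParallelAt.eqOn {W : Set E} (hW : IsOpen W) (hWc : IsPreconnected W)
    {A : E → E →L[ℝ] 𝔸} (hA : ContinuousOn A W) {S T : E → 𝔸}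
    (hS : ∀ z ∈ W, IsParallelAt A S z) (hT : ∀ z ∈ W, IsParallelAt A T z) {z₀ : E} (hz₀ : z₀ ∈ W)
    (h0 : S z₀ = T z₀) : ∀ z ∈ W, S z = T z := by
  intro z hz
  refine sub_eq_zero.1 (eqOn_zero_of_norm_fderiv_le hW hWc hA.norm
    (fun z hz => (hS z hz).sub (hT z hz)) (fun z _ => ?_) hz₀ (sub_eq_zero.2 h0) z hz)
  refine ContinuousLinearMap.opNorm_le_bound _ (by positivity) fun w => ?_
  refine (norm_mul_le _ _).trans ?_
  calc ‖A z w‖ * ‖S z - T z‖ ≤ ‖A z‖ * ‖w‖ * ‖S z - T z‖ :=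
        mul_le_mul_of_nonneg_right ((A z).le_opNorm w) (norm_nonneg _)
    _ = _ := by ring

/-- A copy of `α` with the discrete topology, the fibre of the covering of parallel sections. -/
structure DiscreteCopy (α : Type*) where
  /-- The underlying element. -/
  val : α

instance (α : Type*) : TopologicalSpace (DiscreteCopy α) := ⊥

instance (α : Type*) : DiscreteTopology (DiscreteCopy α) := ⟨rfl⟩

/-- The germs of parallel sections form a covering of `U`. Its chart around `i` reads off, from
the value at `x` of a parallel section, its value at `i`; the coordinate changes are locally
constant, hence continuous for the discrete topology of the fibre. -/
noncomputable def parallelCore {U : Set E} (A : E → E →L[ℝ] 𝔸)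
    (hA : ContinuousOn A U) (r : U → ℝ) (S : U → E → 𝔸) (hr : ∀ i, 0 < r i)
    (hrU : ∀ i : U, ball (i : E) (r i) ⊆ U)
    (hS : ∀ i : U, ∀ z ∈ ball (i : E) (r i), IsParallelAt A (S i) z ∧ IsUnit (S i z)) :
    FiberBundleCore U U (DiscreteCopy 𝔸) where
  baseSet i := Subtype.val ⁻¹' ball (i : E) (r i)
  isOpen_baseSet i := isOpen_ball.preimage continuous_subtype_val
  indexAt x := x
  mem_baseSet_at x := mem_ball_self (hr x)
  coordChange i j x v := ⟨Ring.inverse (S j x) * (S i x * v.val)⟩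
  coordChange_self i x hx v := by
    rw [← mul_assoc, Ring.inverse_mul_cancel _ (hS i x hx).2, one_mul]
  continuousOn_coordChange i j := by
    rcases Set.eq_empty_or_nonempty (ball (i : E) (r i) ∩ ball (j : E) (r j)) with he | ⟨y, hy⟩
    · refine fun p hp => absurd (show (p.1 : E) ∈ ball (i : E) (r i) ∩ ball (j : E) (r j) from hp.1)
        ?_
      simp [he]
    set c := Ring.inverse (S j y) * S i y with hc
    have hconst : ∀ z ∈ ball (i : E) (r i) ∩ ball (j : E) (r j), S i z = S j z * c := by
      refine IsParallelAt.eqOn (isOpen_ball.inter isOpen_ball)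
        ((convex_ball _ _).inter (convex_ball _ _)).isPreconnected
        (hA.mono fun z hz => hrU i hz.1) (fun z hz => (hS i z hz.1).1)
        (fun z hz => (hS j z hz.2).1.mul_const c) hy ?_
      rw [hc, ← mul_assoc, Ring.mul_inverse_cancel _ (hS j y hy.2).2, one_mul]
    have hcont : Continuous fun p : U × DiscreteCopy 𝔸 =>
        (⟨c * p.2.val⟩ : DiscreteCopy 𝔸) :=
      (continuous_of_discreteTopology (f := fun v : DiscreteCopy 𝔸 =>
        (⟨c * v.val⟩ : DiscreteCopy 𝔸))).comp continuous_snd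
    refine hcont.continuousOn.congr fun p hp => ?_
    have hp1 : (p.1 : E) ∈ ball (i : E) (r i) ∩ ball (j : E) (r j) := hp.1
    change (⟨Ring.inverse (S j p.1) * (S i p.1 * _)⟩ : DiscreteCopy 𝔸) = ⟨c * _⟩
    rw [hconst _ hp1, mul_assoc, ← mul_assoc, Ring.inverse_mul_cancel _ (hS j _ hp1.2).2, one_mul]
  coordChange_comp i j k x hx v := by
    have hu := (hS j x hx.1.2).2
    rw [← mul_assoc (S j x), Ring.mul_inverse_cancel _ hu, one_mul]

/-- Over a simply connected domain a flat linear connection has a global invertible parallel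
section with prescribed value at one point. -/
theorem exists_parallel_section [CompleteSpace 𝔸] {U : Set E} (hU : IsOpen U)
    [SimplyConnectedSpace U] {A : E → E →L[ℝ] 𝔸} (hA : ContDiffOn ℝ 2 A U)
    (hflat : ∀ z ∈ U, ∀ u w, fderiv ℝ A z u w + A z w * A z u = fderiv ℝ A z w u + A z u * A z w)
    {z₀ : E} (hz₀ : z₀ ∈ U) :
    ∃ S : E → 𝔸, S z₀ = 1 ∧ ∀ z ∈ U, IsParallelAt A S z := by
  have hloc : ∀ i : U, ∃ r > 0, ball (i : E) r ⊆ U ∧ ∃ S : E → 𝔸, S i = 1 ∧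
      ∀ z ∈ ball (i : E) r, IsParallelAt A S z ∧ IsUnit (S z) :=
    fun i => exists_parallel_ball hU hA hflat i.2
  choose r hr hrU S hS1 hS using hloc
  let Z := parallelCore A hA.continuousOn r S hr hrU hS
  have hcov : IsCoveringMap Z.proj :=
    IsCoveringMap.mk _ (fun _ => DiscreteCopy 𝔸) (fun x => Z.localTriv x)
      (fun x => Z.mem_baseSet_at x)
  have : LocallyPathConnectedSpace U := hU.locallyPathConnectedSpace
  obtain ⟨σ, ⟨hσ0, hσ⟩, -⟩ := hcov.existsUnique_continuousMap_lifts (ContinuousMap.id U)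
    ⟨z₀, hz₀⟩ ⟨⟨z₀, hz₀⟩, (⟨1⟩ : DiscreteCopy 𝔸)⟩ rfl
  have hproj : ∀ x : U, (σ x).proj = x := fun x => congrFun hσ x
  -- the values of the lift in the charts of the covering
  obtain ⟨vl, hvl1, hvl⟩ : ∃ vl : Z.TotalSpace → 𝔸,
      vl ⟨⟨z₀, hz₀⟩, (⟨1⟩ : DiscreteCopy 𝔸)⟩ = 1 ∧ ∀ (i : U) (e : Z.TotalSpace),
        ((Z.localTriv i) e).2.val = Ring.inverse (S i e.proj) * (S e.proj e.proj * vl e) :=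
    ⟨fun e => DiscreteCopy.val (α := 𝔸) e.snd, rfl, fun _ _ => rfl⟩
  obtain ⟨s, hs1, hs⟩ : ∃ s : U → 𝔸, s ⟨z₀, hz₀⟩ = 1 ∧ ∀ i x : U,
      ((Z.localTriv i) (σ x)).2.val = Ring.inverse (S i x) * s x := by
    refine ⟨fun x => vl (σ x), ?_, fun i x => ?_⟩
    · beta_reduce; rw [hσ0, hvl1]
    · rw [hvl, hS1, one_mul, hproj]
  classical
  refine ⟨fun z => if h : z ∈ U then s ⟨z, h⟩ else 0, ?_, fun z hz => ?_⟩
  · simp only [hz₀, dif_pos, hs1]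
  let i : U := ⟨z, hz⟩
  -- in the chart around `z` the section is continuous with discrete values
  have hmem : ∀ x : U, (x : E) ∈ ball (i : E) (r i) → σ x ∈ (Z.localTriv i).source := by
    intro x hx
    rw [(Z.localTriv i).mem_source]
    change ((σ x).proj : E) ∈ ball (i : E) (r i)
    rw [hproj]
    exact hx
  have hcont : ContinuousAt (fun x : U => ((Z.localTriv i) (σ x)).2) i := by
    refine continuous_snd.continuousAt.comp (ContinuousAt.comp
      ((Z.localTriv i).continuousAt (hmem i (mem_ball_self (hr i)))) σ.continuous.continuousAt)
  set c : 𝔸 := ((Z.localTriv i) (σ i)).2.val with hc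
  have hev : ∀ᶠ x : U in 𝓝 i, ((Z.localTriv i) (σ x)).2.val = c ∧ (x : E) ∈ ball (i : E) (r i) := by
    refine Filter.Eventually.and ?_ ((isOpen_ball.preimage continuous_subtype_val).mem_nhds
      (mem_ball_self (hr i)))
    have := hcont.eventually_mem ((isOpen_discrete {((Z.localTriv i) (σ i)).2}).mem_nhds rfl)
    exact this.mono fun x hx => congrArg DiscreteCopy.val hx
  have hevE : ∀ᶠ y in 𝓝 z, (if h : y ∈ U then s ⟨y, h⟩ else 0)
      = S i y * c := by
    have : 𝓝 z = Filter.map Subtype.val (𝓝 i) :=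
      (hU.isOpenEmbedding_subtypeVal.map_nhds_eq i).symm
    rw [this, Filter.eventually_map]
    filter_upwards [hev] with x hx
    rw [dif_pos x.2, ← hx.1, hs, ← mul_assoc, Ring.mul_inverse_cancel _ (hS i x hx.2).2, one_mul]
  have hp := ((hS i z (mem_ball_self (hr i))).1.mul_const c)
  have hz' := hevE.self_of_nhds
  unfold IsParallelAt at hp ⊢
  beta_reduce at hp ⊢
  rw [hz']
  exact hp.congr_of_eventuallyEq hevE

end FlatConnection

/-! ### Calculus of coordinate derivatives of functions and matrices -/

section Calculus

variable {m : ℕ} {U : Opens (Point m)} {f g : Point m → ℝ} {z : Point m}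

theorem pd_congr (hfg : ∀ w ∈ U, f w = g w) (hz : z ∈ U) (a : Idx m) : pd a f z = pd a g z := by
  have h1 : f =ᶠ[nhds z] g := by
    filter_upwards [U.isOpen.mem_nhds hz] with w hw using hfg w hw
  rw [pd, pd, h1.fderiv_eq]

theorem pd_const (c : ℝ) (a : Idx m) (z : Point m) : pd a (fun _ => c) z = 0 := by
  simp [pd]

theorem pd_sub (hf : ContDiffOn ℝ ∞ f U) (hg : ContDiffOn ℝ ∞ g U) (hz : z ∈ U) (a : Idx m) :
    pd a (fun w => f w - g w) z = pd a f z - pd a g z := by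
  unfold pd
  rw [fderiv_fun_sub (differentiableAt_of_mem hf hz) (differentiableAt_of_mem hg hz)]
  rfl

theorem pd_mul (hf : ContDiffOn ℝ ∞ f U) (hg : ContDiffOn ℝ ∞ g U) (hz : z ∈ U) (a : Idx m) :
    pd a (fun w => f w * g w) z = pd a f z * g z + f z * pd a g z := by
  unfold pd
  rw [fderiv_fun_mul (differentiableAt_of_mem hf hz) (differentiableAt_of_mem hg hz)]
  simp only [add_apply, smul_apply, smul_eq_mul]
  ring

theorem pd_sum {κ : Type*} (s : Finset κ) {f : κ → Point m → ℝ}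
    (hf : ∀ k, ContDiffOn ℝ ∞ (f k) U) (hz : z ∈ U) (a : Idx m) :
    pd a (fun w => ∑ k ∈ s, f k w) z = ∑ k ∈ s, pd a (f k) z := by
  unfold pd
  rw [fderiv_fun_sum fun k _ => differentiableAt_of_mem (hf k) hz]
  simp

theorem contDiffOn_pd (hf : ContDiffOn ℝ ∞ f U) (a : Idx m) : ContDiffOn ℝ ∞ (pd a f) U := by
  have h1 : ContDiffOn ℝ ∞ (fderiv ℝ f) U := hf.fderiv_of_isOpen U.isOpen (by simp)
  exact h1.clm_apply contDiffOn_const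

theorem pd_comm (hf : ContDiffOn ℝ ∞ f U) (hz : z ∈ U) (a b : Idx m) :
    pd a (pd b f) z = pd b (pd a f) z := by
  have hat : ContDiffAt ℝ ∞ f z := hf.contDiffAt (U.isOpen.mem_nhds hz)
  have h1 : DifferentiableAt ℝ (fderiv ℝ f) z :=
    (hat.fderiv_right (m := 1) (by norm_cast)).differentiableAt (by simp)
  have h2 : ∀ a b : Idx m, pd a (pd b f) z
      = fderiv ℝ (fderiv ℝ f) z (Pi.single a 1) (Pi.single b 1) := by
    intro a b
    change fderiv ℝ (fun w => fderiv ℝ f w (Pi.single b 1)) z (Pi.single a 1) = _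
    rw [fderiv_clm_apply h1 (differentiableAt_const _)]
    simp
  rw [h2, h2]
  exact (hat.isSymmSndFDerivAt (by simp only [minSmoothness_of_isRCLikeNormedField]; norm_cast)) _ _

theorem contDiffOn_fun_sum {κ : Type*} (s : Finset κ) {f : κ → Point m → ℝ}
    (hf : ∀ k, ContDiffOn ℝ ∞ (f k) U) : ContDiffOn ℝ ∞ (fun w => ∑ k ∈ s, f k w) U :=
  ContDiffOn.sum fun k _ => hf k

end Calculus

section MatrixCalculus

variable {m : ℕ} {U : Opens (Point m)} {z : Point m} {J : Type*}

/-- The entrywise partial derivative of a matrix of functions. -/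
noncomputable def pdMat (a : Idx m) (M : Point m → Matrix J J ℝ) (z : Point m) : Matrix J J ℝ :=
  Matrix.of fun i j => pd a (fun w => M w i j) z

theorem pdMat_mul [Fintype J] {M N : Point m → Matrix J J ℝ}
    (hM : ∀ i j, ContDiffOn ℝ ∞ (fun w => M w i j) U) (hN : ∀ i j, ContDiffOn ℝ ∞ (fun w => N w i j) U) (hz : z ∈ U) (a : Idx m) :
    pdMat a (fun w => M w * N w) z = pdMat a M z * N z + M z * pdMat a N z := by
  ext i j
  simp only [pdMat, Matrix.of_apply, Matrix.add_apply, Matrix.mul_apply]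
  rw [pd_sum Finset.univ (fun k => (hM i k).mul (hN k j)) hz, ← Finset.sum_add_distrib]
  exact Finset.sum_congr rfl fun k _ => pd_mul (hM i k) (hN k j) hz a

theorem pdMat_add {M N : Point m → Matrix J J ℝ} (hM : ∀ i j, ContDiffOn ℝ ∞ (fun w => M w i j) U)
    (hN : ∀ i j, ContDiffOn ℝ ∞ (fun w => N w i j) U) (hz : z ∈ U) (a : Idx m) :
    pdMat a (fun w => M w + N w) z = pdMat a M z + pdMat a N z := by
  ext i j
  exact pd_add (hM i j) (hN i j) hz a

theorem pdMat_transpose (a : Idx m) (M : Point m → Matrix J J ℝ) (z : Point m) :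
    pdMat a (fun w => (M w).transpose) z = (pdMat a M z).transpose := rfl

theorem pdMat_congr {M N : Point m → Matrix J J ℝ} (h : ∀ w ∈ U, M w = N w) (hz : z ∈ U)
    (a : Idx m) : pdMat a M z = pdMat a N z := by
  ext i j
  exact pd_congr (fun w hw => by rw [h w hw]) hz a

theorem pdMat_comm {M : Point m → Matrix J J ℝ} (hM : ∀ i j, ContDiffOn ℝ ∞ (fun w => M w i j) U)
    (hz : z ∈ U) (a b : Idx m) : pdMat a (pdMat b M) z = pdMat b (pdMat a M) z := by
  ext i j
  exact pd_comm (hM i j) hz a b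

variable [Fintype J] [DecidableEq J]

theorem contDiffOn_det {M : Point m → Matrix J J ℝ}
    (hM : ∀ i j, ContDiffOn ℝ ∞ (fun w => M w i j) U) :
    ContDiffOn ℝ ∞ (fun w => (M w).det) U := by
  simp only [Matrix.det_apply]
  refine ContDiffOn.sum fun σ _ => ContDiffOn.const_smul _ ?_
  exact contDiffOn_prod fun i _ => hM _ _

theorem contDiffOn_adjugate {M : Point m → Matrix J J ℝ}
    (hM : ∀ i j, ContDiffOn ℝ ∞ (fun w => M w i j) U) (i j : J) :
    ContDiffOn ℝ ∞ (fun w => (M w).adjugate i j) U := by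
  simp only [Matrix.adjugate_apply]
  refine contDiffOn_det fun k l => ?_
  by_cases hk : k = j
  · subst hk; simpa using contDiffOn_const
  · simpa [Matrix.updateRow_ne hk] using hM k l

theorem contDiffOn_inv {M : Point m → Matrix J J ℝ}
    (hM : ∀ i j, ContDiffOn ℝ ∞ (fun w => M w i j) U) (hdet : ∀ w ∈ U, (M w).det ≠ 0) (i j : J) :
    ContDiffOn ℝ ∞ (fun w => (M w)⁻¹ i j) U := by
  simp only [Matrix.inv_def, Ring.inverse_eq_inv', Matrix.smul_apply, smul_eq_mul]
  exact ((contDiffOn_det hM).inv hdet).mul (contDiffOn_adjugate hM i j)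

/-- The derivative of the inverse matrix. -/
theorem pdMat_inv {M : Point m → Matrix J J ℝ} (hM : ∀ i j, ContDiffOn ℝ ∞ (fun w => M w i j) U)
    (hdet : ∀ w ∈ U, (M w).det ≠ 0) (hz : z ∈ U) (a : Idx m) :
    pdMat a (fun w => (M w)⁻¹) z = -((M z)⁻¹ * pdMat a M z * (M z)⁻¹) := by
  have hu : ∀ w ∈ U, IsUnit (M w).det := fun w hw => isUnit_iff_ne_zero.2 (hdet w hw)
  have h1 : pdMat a (fun w => M w * (M w)⁻¹) z = 0 := by
    rw [pdMat_congr (N := fun _ => (1 : Matrix J J ℝ))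
      (fun w hw => Matrix.mul_nonsing_inv _ (hu w hw)) hz]
    ext i j
    exact pd_const _ a z
  rw [pdMat_mul hM (contDiffOn_inv hM hdet) hz] at h1
  have h2 : M z * pdMat a (fun w => (M w)⁻¹) z = -(pdMat a M z * (M z)⁻¹) :=
    eq_neg_of_add_eq_zero_right h1
  calc pdMat a (fun w => (M w)⁻¹) z
      = (M z)⁻¹ * (M z * pdMat a (fun w => (M w)⁻¹) z) := by
        rw [← mul_assoc, Matrix.nonsing_inv_mul _ (hu z hz), one_mul]
    _ = _ := by rw [h2, mul_neg, ← mul_assoc]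

/-- Jacobi's formula for the derivative of a determinant. -/
theorem pd_det {M : Point m → Matrix J J ℝ} (hM : ∀ i j, ContDiffOn ℝ ∞ (fun w => M w i j) U)
    (hdet : ∀ w ∈ U, (M w).det ≠ 0) (hz : z ∈ U) (a : Idx m) :
    pd a (fun w => (M w).det) z = (M z).det * ∑ i, ∑ j, (M z)⁻¹ i j * pdMat a M z j i := by
  have hd : ∀ i j, DifferentiableAt ℝ (fun w => M w i j) z :=
    fun i j => differentiableAt_of_mem (hM i j) hz
  have h1 : pd a (fun w => (M w).det) z
      = ∑ i, ((M z).updateCol i fun k => pdMat a M z k i).det := by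
    have hprod : ∀ σ : Equiv.Perm J, pd a (fun w => ∏ i, M w (σ i) i) z
        = ∑ i, ∏ k, (M z).updateCol i (fun k => pdMat a M z k i) (σ k) k := by
      intro σ
      rw [pd, fderiv_finsetProd fun i _ => hd (σ i) i]
      simp only [sum_apply, smul_apply, smul_eq_mul]
      refine Finset.sum_congr rfl fun i _ => ?_
      rw [← Finset.prod_erase_mul _ _ (Finset.mem_univ i), Matrix.updateCol_self]
      congr 1
      refine Finset.prod_congr rfl fun k hk => ?_
      rw [Matrix.updateCol_ne (Finset.ne_of_mem_erase hk)]
    have hsm : ∀ σ : Equiv.Perm J, ContDiffOn ℝ ∞ (fun w => ∏ i, M w (σ i) i) U :=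
      fun σ => contDiffOn_prod fun i _ => hM (σ i) i
    simp only [Matrix.det_apply']
    rw [pd_sum Finset.univ (fun σ => contDiffOn_const.mul (hsm σ)) hz, Finset.sum_comm]
    refine Finset.sum_congr rfl fun σ _ => ?_
    rw [pd_smul (hsm σ) hz, hprod, Finset.mul_sum]
  rw [h1, Finset.mul_sum]
  refine Finset.sum_congr rfl fun i _ => ?_
  rw [← Matrix.cramer_apply, Matrix.cramer_eq_adjugate_mulVec, Matrix.mulVec, dotProduct,
    Finset.mul_sum]
  refine Finset.sum_congr rfl fun j _ => ?_
  rw [Matrix.inv_def, Ring.inverse_eq_inv', Matrix.smul_apply, smul_eq_mul, ← mul_assoc,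
    ← mul_assoc, mul_inv_cancel₀ (hdet z hz), one_mul]

end MatrixCalculus

/-! ### The Levi-Civita connection and the curvature of the metric -/

section Metric

variable {m : ℕ} {U : Opens (Point m)} {h : Point m → Matrix (Fin m) (Fin m) ℝ} {z : Point m}

/-- `h` is a smooth field of symmetric nondegenerate matrices on `U`. -/
structure IsMetricOn (U : Opens (Point m)) (h : Point m → Matrix (Fin m) (Fin m) ℝ) : Prop where
  smooth : ∀ i j, ContDiffOn ℝ ∞ (fun z => h z i j) U
  symm : ∀ z ∈ U, (h z).IsSymm
  nondeg : ∀ z ∈ U, (h z).det ≠ 0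

namespace IsMetricOn

theorem metric_smooth (H : IsMetricOn U h) (a b : Idx m) :
    ContDiffOn ℝ ∞ (fun z => metric h z a b) U := by
  rcases a with i | i <;> rcases b with j | j
  · exact H.smooth i j
  · exact contDiffOn_const
  · exact contDiffOn_const
  · exact contDiffOn_const

theorem metric_isSymm (H : IsMetricOn U h) (hz : z ∈ U) : (metric h z).IsSymm := by
  rw [Matrix.IsSymm, metric, Matrix.fromBlocks_transpose, H.symm z hz]
  simp

theorem metric_symm (H : IsMetricOn U h) (hz : z ∈ U) (a b : Idx m) :
    metric h z a b = metric h z b a := (H.metric_isSymm hz).apply b a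

theorem metric_det (H : IsMetricOn U h) (hz : z ∈ U) : (metric h z).det ≠ 0 := by
  simpa [metric] using H.nondeg z hz

theorem metric_isUnit_det (H : IsMetricOn U h) (hz : z ∈ U) : IsUnit (metric h z).det :=
  isUnit_iff_ne_zero.2 (H.metric_det hz)

theorem inv_smooth (H : IsMetricOn U h) (a b : Idx m) :
    ContDiffOn ℝ ∞ (fun z => (metric h z)⁻¹ a b) U :=
  contDiffOn_inv H.metric_smooth (fun _ hw => H.metric_det hw) a b

theorem inv_symm (H : IsMetricOn U h) (hz : z ∈ U) (a b : Idx m) :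
    (metric h z)⁻¹ a b = (metric h z)⁻¹ b a :=
  (H.metric_isSymm hz).inv.apply b a

theorem sum_metric_mul_inv (H : IsMetricOn U h) (hz : z ∈ U) (a b : Idx m) :
    ∑ c, metric h z a c * (metric h z)⁻¹ c b = if a = b then 1 else 0 := by
  rw [← Matrix.mul_apply, Matrix.mul_nonsing_inv _ (H.metric_isUnit_det hz), Matrix.one_apply]

/-- Lowering an index is injective. -/
theorem eq_of_lower_eq (H : IsMetricOn U h) (hz : z ∈ U) {v w : Idx m → ℝ}
    (hvw : ∀ a, ∑ e, metric h z a e * v e = ∑ e, metric h z a e * w e) : v = w := by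
  have h1 : (metric h z).mulVec v = (metric h z).mulVec w := funext hvw
  exact Matrix.mulVec_injective_of_isUnit
    ((Matrix.isUnit_iff_isUnit_det _).2 (H.metric_isUnit_det hz)) h1

theorem christoffel_smooth (H : IsMetricOn U h) (a b c : Idx m) :
    ContDiffOn ℝ ∞ (christoffel h a b c) U := by
  refine contDiffOn_const.mul (contDiffOn_fun_sum _ fun d => (H.inv_smooth a d).mul ?_)
  exact ((contDiffOn_pd (H.metric_smooth d c) b).add (contDiffOn_pd (H.metric_smooth d b) c)).sub
    (contDiffOn_pd (H.metric_smooth b c) d)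

theorem christoffel_symm (H : IsMetricOn U h) (hz : z ∈ U) (a b c : Idx m) :
    christoffel h a b c z = christoffel h a c b z := by
  unfold christoffel
  congr 1
  refine Finset.sum_congr rfl fun d _ => ?_
  rw [pd_congr (fun w hw => H.metric_symm hw b c) hz d]
  ring

theorem pd_christoffel_symm (H : IsMetricOn U h) (hz : z ∈ U) (e a b c : Idx m) :
    pd e (christoffel h a b c) z = pd e (christoffel h a c b) z :=
  pd_congr (fun _ hw => H.christoffel_symm hw a b c) hz e

/-- The Christoffel symbols of the first kind. -/
theorem sum_metric_mul_christoffel (H : IsMetricOn U h) (hz : z ∈ U) (a b c : Idx m) :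
    ∑ e, metric h z a e * christoffel h e b c z = (1 / 2) *
      (pd b (fun w => metric h w a c) z + pd c (fun w => metric h w a b) z
      - pd a (fun w => metric h w b c) z) := by
  simp only [christoffel, Finset.mul_sum]
  rw [Finset.sum_comm]
  have h1 : ∀ d, ∑ e, metric h z a e * (1 / 2 * ((metric h z)⁻¹ e d *
      (pd b (fun w => metric h w d c) z + pd c (fun w => metric h w d b) z
        - pd d (fun w => metric h w b c) z)))
      = (if a = d then 1 else 0) * ((1 / 2) * (pd b (fun w => metric h w d c) z
        + pd c (fun w => metric h w d b) z - pd d (fun w => metric h w b c) z)) := by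
    intro d
    rw [← H.sum_metric_mul_inv hz, Finset.sum_mul]
    exact Finset.sum_congr rfl fun e _ => by ring
  simp only [h1, ite_mul, one_mul, zero_mul, Finset.sum_ite_eq, Finset.mem_univ, if_true]

/-- The Levi-Civita connection preserves the metric. -/
theorem pd_metric (H : IsMetricOn U h) (hz : z ∈ U) (c a b : Idx m) :
    pd c (fun w => metric h w a b) z = ∑ e, metric h z b e * christoffel h e c a z
      + ∑ e, metric h z a e * christoffel h e c b z := by
  rw [H.sum_metric_mul_christoffel hz, H.sum_metric_mul_christoffel hz,
    pd_congr (fun w hw => H.metric_symm hw b a) hz c]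
  rw [pd_congr (fun w hw => H.metric_symm hw c b) hz a,
    pd_congr (fun w hw => H.metric_symm hw c a) hz b]
  ring

theorem riemann_smooth (H : IsMetricOn U h) (a b c d : Idx m) :
    ContDiffOn ℝ ∞ (riemann h a b c d) U := by
  refine ((contDiffOn_pd (H.christoffel_smooth a d b) c).sub
    (contDiffOn_pd (H.christoffel_smooth a c b) d)).add (contDiffOn_fun_sum _ fun e => ?_)
  exact ((H.christoffel_smooth _ _ _).mul (H.christoffel_smooth _ _ _)).sub
    ((H.christoffel_smooth _ _ _).mul (H.christoffel_smooth _ _ _))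

/-- First Bianchi identity. -/
theorem riemann_cyclic (H : IsMetricOn U h) (hz : z ∈ U) (a b c d : Idx m) :
    riemann h a b c d z + riemann h a c d b z + riemann h a d b c z = 0 := by
  simp only [riemann]
  rw [H.pd_christoffel_symm hz c a d b, H.pd_christoffel_symm hz d a c b,
    H.pd_christoffel_symm hz b a d c]
  have h1 : ∑ e, (christoffel h a c e z * christoffel h e d b z
        - christoffel h a d e z * christoffel h e c b z)
      + ∑ e, (christoffel h a d e z * christoffel h e b c z
        - christoffel h a b e z * christoffel h e d c z)
      + ∑ e, (christoffel h a b e z * christoffel h e c d z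
        - christoffel h a c e z * christoffel h e b d z) = 0 := by
    rw [← Finset.sum_add_distrib, ← Finset.sum_add_distrib]
    refine Finset.sum_eq_zero fun e _ => ?_
    rw [H.christoffel_symm hz e d b, H.christoffel_symm hz e c b, H.christoffel_symm hz e d c]
    ring
  linear_combination h1

end IsMetricOn

theorem riemann_swap (h : Point m → Matrix (Fin m) (Fin m) ℝ) (a b c d : Idx m) (z : Point m) :
    riemann h a b c d z = -riemann h a b d c z := by
  simp only [riemann, Finset.sum_sub_distrib]
  ring

/-- The matrix of the connection in the direction `c`: its entry `(a, b)` is `Γ^a_{cb}`. -/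
noncomputable def connMat (h : Point m → Matrix (Fin m) (Fin m) ℝ) (c : Idx m) (z : Point m) :
    Matrix (Idx m) (Idx m) ℝ :=
  Matrix.of fun a b => christoffel h a c b z

/-- The curvature operator in the directions `c, d`: its entry `(a, b)` is `R^a_{bcd}`. -/
noncomputable def curvMat (h : Point m → Matrix (Fin m) (Fin m) ℝ) (c d : Idx m) (z : Point m) :
    Matrix (Idx m) (Idx m) ℝ :=
  Matrix.of fun a b => riemann h a b c d z

theorem curvMat_eq (h : Point m → Matrix (Fin m) (Fin m) ℝ) (c d : Idx m) (z : Point m) :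
    curvMat h c d z = pdMat c (connMat h d) z - pdMat d (connMat h c) z
      + (connMat h c z * connMat h d z - connMat h d z * connMat h c z) := by
  ext a b
  simp [curvMat, connMat, pdMat, riemann, Matrix.mul_apply, Finset.sum_sub_distrib]

namespace IsMetricOn

theorem pdMat_metric (H : IsMetricOn U h) (hz : z ∈ U) (c : Idx m) :
    pdMat c (metric h) z
      = (connMat h c z).transpose * metric h z + metric h z * connMat h c z := by
  ext a b
  simp only [pdMat, Matrix.of_apply, Matrix.add_apply, Matrix.mul_apply, Matrix.transpose_apply,
    connMat]
  rw [H.pd_metric hz]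
  congr 1
  refine Finset.sum_congr rfl fun e _ => ?_
  rw [H.metric_symm hz, mul_comm]

/-- The Ricci identity for the metric: the curvature operators are skew for the metric. -/
theorem curvMat_skew (H : IsMetricOn U h) (hz : z ∈ U) (c d : Idx m) :
    (curvMat h c d z).transpose * metric h z + metric h z * curvMat h c d z = 0 := by
  have hΓ : ∀ c a b, ContDiffOn ℝ ∞ (fun w => connMat h c w a b) U :=
    fun c a b => H.christoffel_smooth a c b
  have hg := H.metric_smooth
  have hT : ∀ c a b, ContDiffOn ℝ ∞ (fun w => (connMat h c w).transpose a b) U :=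
    fun c a b => H.christoffel_smooth b c a
  have hmul : ∀ {M N : Point m → Matrix (Idx m) (Idx m) ℝ},
      (∀ i j, ContDiffOn ℝ ∞ (fun w => M w i j) U) →
      (∀ i j, ContDiffOn ℝ ∞ (fun w => N w i j) U) →
      ∀ i j, ContDiffOn ℝ ∞ (fun w => (M w * N w) i j) U := fun hM hN i j => by
    simp only [Matrix.mul_apply]
    exact contDiffOn_fun_sum _ fun k => (hM i k).mul (hN k j)
  have key : ∀ c d, pdMat c (pdMat d (metric h)) z
      = (pdMat c (connMat h d) z).transpose * metric h z
        + (connMat h d z).transpose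
          * ((connMat h c z).transpose * metric h z + metric h z * connMat h c z)
        + (((connMat h c z).transpose * metric h z + metric h z * connMat h c z) * connMat h d z
        + metric h z * pdMat c (connMat h d) z) := by
    intro c d
    rw [pdMat_congr (fun w hw => H.pdMat_metric hw d) hz,
      pdMat_add (hmul (hT d) hg) (hmul hg (hΓ d)) hz, pdMat_mul (hT d) hg hz,
      pdMat_mul hg (hΓ d) hz, pdMat_transpose, H.pdMat_metric hz]
  have hcomm := pdMat_comm hg hz c d
  rw [key, key] at hcomm
  rw [curvMat_eq]
  simp only [Matrix.transpose_add, Matrix.transpose_sub, Matrix.transpose_mul]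
  rw [← sub_eq_zero] at hcomm
  rw [← hcomm]
  noncomm_ring

theorem riemann_lower_skew (H : IsMetricOn U h) (hz : z ∈ U) (a b c d : Idx m) :
    ∑ e, metric h z a e * riemann h e b c d z = -∑ e, metric h z b e * riemann h e a c d z := by
  have h1 := congrFun (congrFun (H.curvMat_skew hz c d) a) b
  simp only [Matrix.add_apply, Matrix.mul_apply, Matrix.transpose_apply, curvMat, Matrix.of_apply,
    Matrix.zero_apply] at h1
  rw [eq_neg_iff_add_eq_zero, add_comm, ← h1]
  congr 1
  refine Finset.sum_congr rfl fun e _ => ?_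
  rw [H.metric_symm hz, mul_comm]

end IsMetricOn

end Metric

/-! ### One-forms with skew covariant derivative -/

section Killing

variable {m : ℕ} {U : Opens (Point m)} {h : Point m → Matrix (Fin m) (Fin m) ℝ} {z : Point m}

/-- The covariant derivative `∇_a ξ_b` of the one-form with components `ξ_b`. -/
noncomputable def covGrad (h : Point m → Matrix (Fin m) (Fin m) ℝ) (ξ : Idx m → Point m → ℝ)
    (a b : Idx m) (z : Point m) : ℝ :=
  pd a (ξ b) z - ∑ d, christoffel h d a b z * ξ d z

/-- The matrix whose entry `(c, a)` is `∇_c ξ_a`. -/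
noncomputable def gradMat (h : Point m → Matrix (Fin m) (Fin m) ℝ)
    (ξ : Idx m → Point m → ℝ) (z : Point m) : Matrix (Idx m) (Idx m) ℝ :=
  Matrix.of fun c a => covGrad h ξ c a z

/-- The one-form `g_{ab} X^b` dual to the vector field `X`. -/
noncomputable def lower (h : Point m → Matrix (Fin m) (Fin m) ℝ) (X : Point m → Point m)
    (a : Idx m) (z : Point m) : ℝ :=
  ∑ b, metric h z a b * X z b

namespace IsMetricOn

theorem lower_smooth (H : IsMetricOn U h) {X : Point m → Point m}
    (hX : ∀ a, ContDiffOn ℝ ∞ (fun z => X z a) U) (a : Idx m) :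
    ContDiffOn ℝ ∞ (lower h X a) U :=
  contDiffOn_fun_sum _ fun b => (H.metric_smooth a b).mul (hX b)

theorem covGrad_smooth (H : IsMetricOn U h) {ξ : Idx m → Point m → ℝ}
    (hξ : ∀ a, ContDiffOn ℝ ∞ (ξ a) U) (a b : Idx m) :
    ContDiffOn ℝ ∞ (covGrad h ξ a b) U :=
  (contDiffOn_pd (hξ b) a).sub
    (contDiffOn_fun_sum _ fun d => (H.christoffel_smooth d a b).mul (hξ d))

/-- The Lie derivative of the metric is twice the symmetrized covariant derivative. -/
theorem lieMetric_eq (H : IsMetricOn U h) {X : Point m → Point m}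
    (hX : ∀ a, ContDiffOn ℝ ∞ (fun z => X z a) U) (hz : z ∈ U) (a b : Idx m) :
    lieMetric h X a b z = covGrad h (lower h X) a b z + covGrad h (lower h X) b a z := by
  have h1 : ∀ a b, pd a (lower h X b) z
      = ∑ c, (pd a (fun w => metric h w b c) z * X z c
        + metric h z b c * pd a (fun w => X w c) z) := by
    intro a b
    unfold lower
    rw [pd_sum Finset.univ (fun c => (H.metric_smooth b c).mul (hX c)) hz]
    exact Finset.sum_congr rfl fun c _ => pd_mul (H.metric_smooth b c) (hX c) hz a
  have h2 : ∀ a b, ∑ d, christoffel h d a b z * lower h X d z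
      = ∑ c, X z c * ((1 / 2) * (pd a (fun w => metric h w c b) z
        + pd b (fun w => metric h w c a) z - pd c (fun w => metric h w a b) z)) := by
    intro a b
    simp only [← H.sum_metric_mul_christoffel hz, lower, Finset.mul_sum]
    rw [Finset.sum_comm]
    refine Finset.sum_congr rfl fun c _ => Finset.sum_congr rfl fun d _ => ?_
    rw [H.metric_symm hz d c]
    ring
  simp only [covGrad, h1, h2, lieMetric]
  simp only [← Finset.sum_sub_distrib, ← Finset.sum_add_distrib]
  refine Finset.sum_congr rfl fun c _ => ?_
  rw [pd_congr (fun w hw => H.metric_symm hw c a) hz b,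
    pd_congr (fun w hw => H.metric_symm hw c b) hz a,
    pd_congr (fun w hw => H.metric_symm hw b a) hz c, H.metric_symm hz c b]
  ring

/-- The Ricci identity for one-forms, in terms of partial derivatives. -/
theorem ricci_oneForm (H : IsMetricOn U h) {ξ : Idx m → Point m → ℝ}
    (hξ : ∀ a, ContDiffOn ℝ ∞ (ξ a) U) (hz : z ∈ U) (e c a : Idx m) :
    pd e (covGrad h ξ c a) z - pd c (covGrad h ξ e a) z
      = -(∑ d, riemann h d a e c z * ξ d z)
        - ∑ d, christoffel h d c a z * covGrad h ξ e d z
        + ∑ d, christoffel h d e a z * covGrad h ξ c d z := by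
  have key : ∀ e c, pd e (pd c (ξ a)) z = pd e (covGrad h ξ c a) z
      + (∑ d, (pd e (christoffel h d c a) z
          + ∑ k, christoffel h d e k z * christoffel h k c a z) * ξ d z
        + ∑ d, christoffel h d c a z * covGrad h ξ e d z) := by
    intro e c
    have h1 : ∀ w ∈ U, pd c (ξ a) w
        = covGrad h ξ c a w + ∑ d, christoffel h d c a w * ξ d w := fun w _ => by
      simp [covGrad]
    have hs : ∀ d, ContDiffOn ℝ ∞ (fun w => christoffel h d c a w * ξ d w) U :=
      fun d => (H.christoffel_smooth d c a).mul (hξ d)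
    rw [pd_congr h1 hz, pd_add (H.covGrad_smooth hξ c a) (contDiffOn_fun_sum _ hs) hz,
      pd_sum Finset.univ hs hz]
    congr 1
    have h2 : ∀ d, pd e (fun w => christoffel h d c a w * ξ d w) z
        = pd e (christoffel h d c a) z * ξ d z + (christoffel h d c a z * covGrad h ξ e d z
          + ∑ k, christoffel h d c a z * christoffel h k e d z * ξ k z) := by
      intro d
      rw [pd_mul (H.christoffel_smooth d c a) (hξ d) hz]
      simp only [covGrad, mul_sub, Finset.mul_sum, ← mul_assoc]
      ring
    simp only [h2, Finset.sum_add_distrib, add_mul, Finset.sum_mul]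
    rw [Finset.sum_comm (f := fun d k => christoffel h d c a z * christoffel h k e d z * ξ k z)]
    have h3 : ∀ d k, christoffel h k c a z * christoffel h d e k z * ξ d z
        = christoffel h d e k z * christoffel h k c a z * ξ d z := fun d k => by ring
    simp only [h3]
    ring
  have hcomm := pd_comm (hξ a) hz e c
  rw [key, key] at hcomm
  have hR : ∑ d, riemann h d a e c z * ξ d z
      = ∑ d, (pd e (christoffel h d c a) z
          + ∑ k, christoffel h d e k z * christoffel h k c a z) * ξ d z
        - ∑ d, (pd c (christoffel h d e a) z
          + ∑ k, christoffel h d c k z * christoffel h k e a z) * ξ d z := by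
    rw [← Finset.sum_sub_distrib]
    refine Finset.sum_congr rfl fun d _ => ?_
    simp only [riemann, Finset.sum_sub_distrib]
    ring
  rw [hR]
  linear_combination hcomm

/-- A one-form with skew covariant derivative `F` (the dual of a Killing field) satisfies
`∇_e F_{ca} = R^d_{eca} ξ_d`, so that `(ξ, F)` solves a closed linear system. -/
theorem pd_covGrad_of_skew (H : IsMetricOn U h) {ξ : Idx m → Point m → ℝ}
    (hξ : ∀ a, ContDiffOn ℝ ∞ (ξ a) U)
    (hskew : ∀ w ∈ U, ∀ a b, covGrad h ξ a b w = -covGrad h ξ b a w) (hz : z ∈ U)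
    (e c a : Idx m) :
    pd e (covGrad h ξ c a) z = ∑ d, christoffel h d e c z * covGrad h ξ d a z
      + ∑ d, christoffel h d e a z * covGrad h ξ c d z + ∑ d, riemann h d e c a z * ξ d z := by
  have hpd : ∀ e c a, pd e (covGrad h ξ c a) z = -pd e (covGrad h ξ a c) z := by
    intro e c a
    have h1 : ∀ w ∈ U, covGrad h ξ c a w = (-1) * covGrad h ξ a c w := fun w hw => by
      rw [hskew w hw c a]; ring
    rw [pd_congr h1 hz, pd_smul (H.covGrad_smooth hξ a c) hz]
    ring
  have i1 := H.ricci_oneForm hξ hz e c a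
  have i2 := H.ricci_oneForm hξ hz c a e
  have i3 := H.ricci_oneForm hξ hz a e c
  have hB : ∑ d, riemann h d a e c z * ξ d z + ∑ d, riemann h d e c a z * ξ d z
      + ∑ d, riemann h d c a e z * ξ d z = 0 := by
    rw [← Finset.sum_add_distrib, ← Finset.sum_add_distrib]
    refine Finset.sum_eq_zero fun d _ => ?_
    linear_combination ξ d z * H.riemann_cyclic hz d a e c
  have hs : ∀ x y w, ∑ d, christoffel h d x y z * covGrad h ξ w d z
      = ∑ d, christoffel h d y x z * covGrad h ξ w d z := fun x y w =>
    Finset.sum_congr rfl fun d _ => by rw [H.christoffel_symm hz]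
  have hn : ∑ d, christoffel h d e c z * covGrad h ξ d a z
      = -∑ d, christoffel h d e c z * covGrad h ξ a d z := by
    rw [← Finset.sum_neg_distrib]
    exact Finset.sum_congr rfl fun d _ => by rw [hskew z hz d a]; ring
  rw [hn]
  rw [hs c a e] at i1
  rw [hs c e a, hs a e c] at i2
  linear_combination (i1 - i2 + i3) / 2 + hpd e c a / 2 + hpd c e a / 2 - hpd a e c / 2 - hB / 2

/-- The integrability condition of the closed system of `pd_covGrad_of_skew`; `Q e` is the matrix
of the curvature term `R^d_{eca} ξ_d`. -/
theorem integrability_of_skew (H : IsMetricOn U h) {ξ : Idx m → Point m → ℝ}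
    (hξ : ∀ a, ContDiffOn ℝ ∞ (ξ a) U)
    (hskew : ∀ w ∈ U, ∀ a b, covGrad h ξ a b w = -covGrad h ξ b a w) {Q : Idx m → Point m →
      Matrix (Idx m) (Idx m) ℝ} (hQs : ∀ e c a, ContDiffOn ℝ ∞ (fun w => Q e w c a) U)
    (hQ : ∀ w ∈ U, ∀ e c a, Q e w c a = ∑ d, riemann h d e c a w * ξ d w) (hz : z ∈ U)
    (k e : Idx m) :
    (curvMat h k e z).transpose * gradMat h ξ z + gradMat h ξ z * curvMat h k e z
      + ((connMat h e z).transpose * Q k z + Q k z * connMat h e z + pdMat k (Q e) z)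
      - ((connMat h k z).transpose * Q e z + Q e z * connMat h k z + pdMat e (Q k) z) = 0 := by
  have hΓ : ∀ c a b, ContDiffOn ℝ ∞ (fun w => connMat h c w a b) U :=
    fun c a b => H.christoffel_smooth a c b
  have hF : ∀ a b, ContDiffOn ℝ ∞ (fun w => gradMat h ξ w a b) U :=
    fun a b => H.covGrad_smooth hξ a b
  have hT : ∀ c a b, ContDiffOn ℝ ∞ (fun w => (connMat h c w).transpose a b) U :=
    fun c a b => H.christoffel_smooth b c a
  have hmul : ∀ {M N : Point m → Matrix (Idx m) (Idx m) ℝ},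
      (∀ i j, ContDiffOn ℝ ∞ (fun w => M w i j) U) →
      (∀ i j, ContDiffOn ℝ ∞ (fun w => N w i j) U) →
      ∀ i j, ContDiffOn ℝ ∞ (fun w => (M w * N w) i j) U := fun hM hN i j => by
    simp only [Matrix.mul_apply]
    exact contDiffOn_fun_sum _ fun k => (hM i k).mul (hN k j)
  have h1 : ∀ e, ∀ w ∈ U, pdMat e (gradMat h ξ) w = (connMat h e w).transpose * gradMat h ξ w
      + gradMat h ξ w * connMat h e w + Q e w := by
    intro e w hw
    ext c a
    simp only [pdMat, Matrix.of_apply, Matrix.add_apply, Matrix.mul_apply, Matrix.transpose_apply,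
      connMat, gradMat]
    rw [hQ w hw]
    refine (H.pd_covGrad_of_skew hξ hskew hw e c a).trans ?_
    congr 2
    exact Finset.sum_congr rfl fun d _ => mul_comm _ _
  have key : ∀ k e, pdMat k (pdMat e (gradMat h ξ)) z
      = (pdMat k (connMat h e) z).transpose * gradMat h ξ z
        + (connMat h e z).transpose * ((connMat h k z).transpose * gradMat h ξ z
          + gradMat h ξ z * connMat h k z + Q k z)
        + (((connMat h k z).transpose * gradMat h ξ z
          + gradMat h ξ z * connMat h k z + Q k z) * connMat h e z
        + gradMat h ξ z * pdMat k (connMat h e) z) + pdMat k (Q e) z := by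
    intro k e
    rw [pdMat_congr (h1 e) hz,
      pdMat_add (M := fun w => (connMat h e w).transpose * gradMat h ξ w
        + gradMat h ξ w * connMat h e w) (N := Q e)
        (fun i j => (hmul (hT e) hF i j).add (hmul hF (hΓ e) i j)) (hQs e) hz,
      pdMat_add (hmul (hT e) hF) (hmul hF (hΓ e)) hz, pdMat_mul (hT e) hF hz,
      pdMat_mul hF (hΓ e) hz, pdMat_transpose, h1 k z hz]
  have hcomm := pdMat_comm hF hz k e
  rw [key, key, ← sub_eq_zero] at hcomm
  rw [curvMat_eq, ← hcomm]
  simp only [Matrix.transpose_add, Matrix.transpose_sub, Matrix.transpose_mul]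
  noncomm_ring

end IsMetricOn

end Killing

/-! ### Killing fields are determined by their 1-jets -/

section LinearSystem

variable {m : ℕ} {U : Opens (Point m)} {J : Type*} [Fintype J]

/-- On `U`, the function `f` is a linear combination, with continuous coefficients, of the
functions of the family `s`. -/
def IsCombination (U : Opens (Point m)) (s : J → Point m → ℝ) (f : Point m → ℝ) : Prop :=
  ∃ a : J → Point m → ℝ, (∀ j, ContinuousOn (a j) U) ∧ ∀ z ∈ U, f z = ∑ j, a j z * s j z

theorem IsCombination.self [DecidableEq J] (s : J → Point m → ℝ) (j : J) :
    IsCombination U s (s j) :=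
  ⟨fun k _ => if k = j then 1 else 0, fun _ => continuousOn_const, fun z _ => by simp⟩

theorem IsCombination.add {s : J → Point m → ℝ} {f g : Point m → ℝ} (hf : IsCombination U s f)
    (hg : IsCombination U s g) : IsCombination U s (fun z => f z + g z) := by
  obtain ⟨a, ha, hfa⟩ := hf
  obtain ⟨b, hb, hgb⟩ := hg
  refine ⟨fun j z => a j z + b j z, fun j => (ha j).add (hb j), fun z hz => ?_⟩
  simp only [hfa z hz, hgb z hz, add_mul, Finset.sum_add_distrib]

theorem IsCombination.mul {s : J → Point m → ℝ} {c f : Point m → ℝ} (hc : ContinuousOn c U)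
    (hf : IsCombination U s f) : IsCombination U s (fun z => c z * f z) := by
  obtain ⟨a, ha, hfa⟩ := hf
  refine ⟨fun j z => c z * a j z, fun j => hc.mul (ha j), fun z hz => ?_⟩
  simp only [hfa z hz, Finset.mul_sum, mul_assoc]

theorem IsCombination.sum {s : J → Point m → ℝ} {κ : Type*} [Fintype κ] {f : κ → Point m → ℝ}
    (hf : ∀ k, IsCombination U s (f k)) : IsCombination U s (fun z => ∑ k, f k z) := by
  choose a ha hfa using hf
  refine ⟨fun j z => ∑ k, a k j z, fun j => continuousOn_finsetSum _ fun k _ => ha k j,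
    fun z hz => ?_⟩
  simp only [hfa _ z hz, Finset.sum_mul]
  exact Finset.sum_comm

theorem IsCombination.congr {s : J → Point m → ℝ} {f g : Point m → ℝ} (hf : IsCombination U s f)
    (hfg : ∀ z ∈ U, g z = f z) : IsCombination U s g := by
  obtain ⟨a, ha, hfa⟩ := hf
  exact ⟨a, ha, fun z hz => (hfg z hz).trans (hfa z hz)⟩

theorem fderiv_eq_sum_pd {f : Point m → ℝ} (z w : Point m) :
    fderiv ℝ f z w = ∑ c, w c * pd c f z := by
  conv_lhs => rw [pi_eq_sum_univ' w]
  simp [pd, map_sum]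

/-- Solutions of a closed linear first-order system on a connected domain are determined by their
values at one point. -/
theorem eq_zero_of_pd_isCombination (hU : IsPreconnected (U : Set (Point m)))
    {s : J → Point m → ℝ} (hs : ∀ j, ContDiffOn ℝ ∞ (s j) U)
    (hpd : ∀ c j, IsCombination U s (pd c (s j))) {z₀ : Point m} (hz₀ : z₀ ∈ U)
    (h0 : ∀ j, s j z₀ = 0) : ∀ z ∈ U, ∀ j, s j z = 0 := by
  choose a ha hpda using hpd
  have hS : ∀ z ∈ U, HasFDerivAt (fun z j => s j z)
      (ContinuousLinearMap.pi fun j => fderiv ℝ (s j) z) z := fun z hz =>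
    hasFDerivAt_pi.2 fun j => (differentiableAt_of_mem (hs j) hz).hasFDerivAt
  have key := eqOn_zero_of_norm_fderiv_le (V := J → ℝ) U.isOpen hU
    (C := fun z => ∑ c, ∑ j, ∑ k, |a c j k z|)
    (continuousOn_finsetSum _ fun c _ => continuousOn_finsetSum _ fun j _ =>
      continuousOn_finsetSum _ fun k _ => (ha c j k).abs) hS (fun z hz => ?_) hz₀ (funext h0)
  · exact fun z hz j => congrFun (key z hz) j
  refine ContinuousLinearMap.opNorm_le_bound _ (by positivity) fun w => ?_
  refine (pi_norm_le_iff_of_nonneg (by positivity)).2 fun j => ?_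
  rw [ContinuousLinearMap.pi_apply, fderiv_eq_sum_pd, Finset.sum_mul, Finset.sum_mul]
  refine (norm_sum_le _ _).trans (Finset.sum_le_sum fun c _ => ?_)
  rw [hpda c j z hz, norm_mul]
  have h1 : ‖∑ k, a c j k z * s k z‖ ≤ (∑ k, |a c j k z|) * ‖fun j => s j z‖ := by
    rw [Finset.sum_mul]
    refine (norm_sum_le _ _).trans (Finset.sum_le_sum fun k _ => ?_)
    rw [norm_mul]
    exact mul_le_mul_of_nonneg_left (norm_le_pi_norm (fun j => s j z) k) (norm_nonneg _)
  have h2 : ∑ k, |a c j k z| ≤ ∑ j, ∑ k, |a c j k z| :=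
    Finset.single_le_sum (f := fun j => ∑ k, |a c j k z|)
      (fun j _ => Finset.sum_nonneg fun k _ => abs_nonneg _) (Finset.mem_univ j)
  calc ‖w c‖ * ‖∑ k, a c j k z * s k z‖
      ≤ ‖w‖ * ((∑ j, ∑ k, |a c j k z|) * ‖fun j => s j z‖) :=
        mul_le_mul (norm_le_pi_norm w c)
          (h1.trans (mul_le_mul_of_nonneg_right h2 (norm_nonneg _))) (norm_nonneg _)
          (norm_nonneg _)
    _ = _ := by ring

end LinearSystem

section SkewMatrices

/-- The space of skew-symmetric matrices. -/
def skewMatrices (J : Type*) : Submodule ℝ (Matrix J J ℝ) where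
  carrier := {M | ∀ i j, M i j = -M j i}
  zero_mem' := fun i j => by simp
  add_mem' := fun {M N} hM hN i j => by simp only [Matrix.add_apply, hM i j, hN i j]; ring
  smul_mem' := fun c M hM i j => by simp only [Matrix.smul_apply, hM i j, smul_neg]

/-- A skew-symmetric matrix is given by its entries below the diagonal. -/
def skewMatricesEquiv (N : ℕ) : skewMatrices (Fin N) ≃ₗ[ℝ] ((Σ i : Fin N, Fin i) → ℝ) where
  toFun M p := M.1 p.1 (p.2.castLE p.1.2.le)
  map_add' _ _ := rfl
  map_smul' _ _ := rfl
  invFun v := ⟨Matrix.of fun i j => if h : j < i then v ⟨i, ⟨j, h⟩⟩ else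
      if h : i < j then -v ⟨j, ⟨i, h⟩⟩ else 0, fun i j => by
    rcases lt_trichotomy i j with h | h | h
    · simp [h, h.not_gt]
    · subst h; simp
    · simp [h, h.not_gt]⟩
  left_inv M := by
    ext i j
    rcases lt_trichotomy i j with h | h | h
    · simp [h, h.not_gt, M.2 i j]
    · subst h
      have := M.2 i i
      simp only [Matrix.of_apply, lt_self_iff_false, dite_false]
      linarith
    · simp [h]
  right_inv v := by
    ext ⟨i, j⟩
    have h : j.castLE i.2.le < i := j.2
    simp [h]

theorem finrank_skewMatrices_fin (N : ℕ) :
    Module.finrank ℝ (skewMatrices (Fin N)) = N * (N - 1) / 2 := by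
  rw [(skewMatricesEquiv N).finrank_eq, Module.finrank_fintype_fun_eq_card, Fintype.card_sigma]
  simp only [Fintype.card_fin]
  rw [Fin.sum_univ_eq_sum_range (fun i => i), Finset.sum_range_id]

theorem finrank_skewMatrices (J : Type*) [Fintype J] :
    Module.finrank ℝ (skewMatrices J) = Fintype.card J * (Fintype.card J - 1) / 2 := by
  let e := Fintype.equivFin J
  rw [← finrank_skewMatrices_fin]
  refine LinearEquiv.finrank_eq
    { toFun := fun M => ⟨M.1.submatrix e.symm e.symm, fun i j => M.2 _ _⟩
      map_add' := fun _ _ => rfl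
      map_smul' := fun _ _ => rfl
      invFun := fun M => ⟨M.1.submatrix e e, fun i j => M.2 _ _⟩
      left_inv := fun M => by ext i j; simp
      right_inv := fun M => by ext i j; simp }

end SkewMatrices

section KillingJets

variable {m : ℕ} {U : Opens (Point m)} {h : Point m → Matrix (Fin m) (Fin m) ℝ} {z : Point m}

/-- The `1`-jet at `z` of a one-form with skew covariant derivative, as a skew matrix of size
`n + 1`: the form itself borders the matrix of its covariant derivative. -/
noncomputable def jetMat (h : Point m → Matrix (Fin m) (Fin m) ℝ) (ξ : Idx m → Point m → ℝ)
    (z : Point m) : Matrix (Option (Idx m)) (Option (Idx m)) ℝ :=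
  Matrix.of fun A B => match A, B with
    | none, none => 0
    | none, some b => ξ b z
    | some a, none => -ξ a z
    | some a, some b => covGrad h ξ a b z

theorem jetMat_mem {ξ : Idx m → Point m → ℝ}
    (hskew : ∀ a b, covGrad h ξ a b z = -covGrad h ξ b a z) :
    jetMat h ξ z ∈ skewMatrices (Option (Idx m)) := by
  rintro (_ | a) (_ | b)
  · simp [jetMat]
  · simp [jetMat]
  · simp [jetMat]
  · exact hskew a b

namespace IsMetricOn

/-- A one-form with skew covariant derivative vanishes if its `1`-jet vanishes at one point. -/
theorem eq_zero_of_jet (H : IsMetricOn U h) (hU : IsPreconnected (U : Set (Point m)))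
    {ξ : Idx m → Point m → ℝ} (hξ : ∀ a, ContDiffOn ℝ ∞ (ξ a) U)
    (hskew : ∀ w ∈ U, ∀ a b, covGrad h ξ a b w = -covGrad h ξ b a w) {z₀ : Point m} (hz₀ : z₀ ∈ U)
    (h0 : ∀ a, ξ a z₀ = 0) (h0' : ∀ a b, covGrad h ξ a b z₀ = 0) :
    ∀ z ∈ U, ∀ a, ξ a z = 0 := by
  let s : Idx m ⊕ Idx m × Idx m → Point m → ℝ :=
    Sum.elim ξ (fun p => covGrad h ξ p.1 p.2)
  have hξc : ∀ a, IsCombination U s (ξ a) := fun a => IsCombination.self s (Sum.inl a)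
  have hFc : ∀ a b, IsCombination U s (covGrad h ξ a b) :=
    fun a b => IsCombination.self s (Sum.inr (a, b))
  have hΓ := fun a b c => (H.christoffel_smooth a b c).continuousOn
  have key := eq_zero_of_pd_isCombination hU (s := s) ?_ ?_ hz₀ ?_
  · exact fun z hz a => key z hz (Sum.inl a)
  · rintro (a | ⟨a, b⟩)
    · exact hξ a
    · exact H.covGrad_smooth hξ a b
  · rintro c (a | ⟨a, b⟩)
    · refine ((hFc c a).add (IsCombination.sum fun d =>
        (hξc d).mul (hΓ d c a))).congr fun z _ => ?_
      simp [s, covGrad]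
    · refine (((IsCombination.sum fun d => (hFc d b).mul (hΓ d c a)).add
        (IsCombination.sum fun d => (hFc a d).mul (hΓ d c b))).add
        (IsCombination.sum fun d => (hξc d).mul (H.riemann_smooth d c a b).continuousOn)).congr
        fun z hz => ?_
      exact H.pd_covGrad_of_skew hξ hskew hz c a b
  · rintro (a | ⟨a, b⟩)
    · exact h0 a
    · exact h0' a b

theorem covGrad_lower_skew (H : IsMetricOn U h) {X : Point m → Point m}
    (hX : X ∈ killingAlgebra U h) (hz : z ∈ U) (a b : Idx m) :
    covGrad h (lower h X) a b z = -covGrad h (lower h X) b a z := by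
  have := hX.2 z hz a b
  rw [H.lieMetric_eq hX.1.smooth hz] at this
  linarith

theorem lower_add (X Y : Point m → Point m) (a : Idx m) (z : Point m) :
    lower h (X + Y) a z = lower h X a z + lower h Y a z := by
  simp [lower, mul_add, Finset.sum_add_distrib, -Fintype.sum_sum_type]

theorem lower_smul (c : ℝ) (X : Point m → Point m) (a : Idx m) (z : Point m) :
    lower h (c • X) a z = c * lower h X a z := by
  simp only [lower, Finset.mul_sum, Pi.smul_apply, smul_eq_mul]
  exact Finset.sum_congr rfl fun b _ => by ring

/-- The `1`-jet at `z` of a Killing field. -/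
noncomputable def killingJet (H : IsMetricOn U h) (hz : z ∈ U) :
    killingAlgebra U h →ₗ[ℝ] skewMatrices (Option (Idx m)) where
  toFun X := ⟨jetMat h (lower h X.1) z, jetMat_mem fun a b => H.covGrad_lower_skew X.2 hz a b⟩
  map_add' X Y := by
    have hadd : ∀ a b, covGrad h (lower h (X.1 + Y.1)) a b z
        = covGrad h (lower h X.1) a b z + covGrad h (lower h Y.1) a b z := by
      intro a b
      have h1 : pd a (lower h (X.1 + Y.1) b) z
          = pd a (lower h X.1 b) z + pd a (lower h Y.1 b) z := by
        rw [← pd_add (H.lower_smooth X.2.1.smooth b) (H.lower_smooth Y.2.1.smooth b) hz]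
        exact pd_congr (fun w _ => lower_add X.1 Y.1 b w) hz a
      simp only [covGrad, h1, lower_add, mul_add, Finset.sum_add_distrib]
      ring
    ext (_ | a) (_ | b)
    · simp [jetMat]
    · exact lower_add X.1 Y.1 b z
    · simp [jetMat, lower_add]; ring
    · exact hadd a b
  map_smul' c X := by
    have hsmul : ∀ a b, covGrad h (lower h (c • X.1)) a b z
        = c * covGrad h (lower h X.1) a b z := by
      intro a b
      have h1 : pd a (lower h (c • X.1) b) z = c * pd a (lower h X.1 b) z := by
        rw [← pd_smul (H.lower_smooth X.2.1.smooth b) hz]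
        exact pd_congr (fun w _ => lower_smul c X.1 b w) hz a
      simp only [covGrad, h1, lower_smul, mul_sub, Finset.mul_sum, mul_left_comm]
    ext (_ | a) (_ | b)
    · simp [jetMat]
    · exact lower_smul c X.1 b z
    · simp [jetMat, lower_smul]
    · exact hsmul a b

theorem killingJet_injective (H : IsMetricOn U h) (hU : IsPreconnected (U : Set (Point m)))
    (hz : z ∈ U) : Function.Injective (H.killingJet hz) := by
  refine (injective_iff_map_eq_zero _).2 fun X hX => ?_
  have hM : jetMat h (lower h X.1) z = 0 := congrArg Subtype.val hX
  have h1 := H.eq_zero_of_jet hU (H.lower_smooth X.2.1.smooth)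
    (fun w hw => H.covGrad_lower_skew X.2 hw) hz
    (fun a => congrFun (congrFun hM none) (some a))
    (fun a b => congrFun (congrFun hM (some a)) (some b))
  ext1
  funext w
  by_cases hw : w ∈ U
  · refine H.eq_of_lower_eq hw fun a => ?_
    have := h1 w hw a
    simpa [lower, -Fintype.sum_sum_type] using this
  · exact X.2.1.zero_outside w hw

end IsMetricOn

theorem finrank_jets (m : ℕ) :
    Module.finrank ℝ (skewMatrices (Option (Idx m))) = (m + 1) * (m + 2) / 2 := by
  rw [finrank_skewMatrices]
  simp only [Fintype.card_option, Fintype.card_sum, Fintype.card_fin, Fintype.card_unit]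
  rw [mul_comm]
  rfl

/-- The Killing fields form a space of dimension at most `n (n + 1) / 2`. -/
theorem IsMetricOn.killing_finite (H : IsMetricOn U h) (hU : IsConnected (U : Set (Point m))) :
    Module.Finite ℝ (killingAlgebra U h) ∧
      Module.finrank ℝ (killingAlgebra U h) ≤ (m + 1) * (m + 2) / 2 := by
  obtain ⟨z, hz⟩ := hU.nonempty
  have hinj := H.killingJet_injective hU.isPreconnected hz
  exact ⟨Module.Finite.of_injective _ hinj,
    (LinearMap.finrank_le_finrank_of_injective hinj).trans (finrank_jets m).le⟩

end KillingJets

/-! ### Maximally symmetric spaces have constant curvature -/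

section CurvatureAlgebra

variable {I : Type*} [Fintype I] [DecidableEq I]

/-- A curvature tensor at a point that satisfies the integrability condition for every skew `F`
is determined by its Ricci contraction. -/
theorem curvature_eq_ricci {R : I → I → I → I → ℝ}
    (hswap : ∀ q b c a, R q b c a = -R q b a c)
    (hcyc : ∀ q b c a, R q b c a + R q c a b + R q a b c = 0)
    (htr : ∀ c a, ∑ p, R p p c a = 0)
    (hinv : ∀ F : I → I → ℝ, (∀ x y, F x y = -F y x) → ∀ k e c a,
      ∑ d, R d c k e * F d a + ∑ d, F c d * R d a k e
        + ∑ d, R d e c a * F k d - ∑ d, R d k c a * F e d = 0) (q b c a : I) :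
    ((Fintype.card I : ℝ) - 1) * R q b c a
      = (if q = c then 1 else 0) * ∑ p, R p a p b - (if q = a then 1 else 0) * ∑ p, R p c p b := by
  have h1 : ∀ p, (if a = q then R p c p b else 0) - (if a = p then R q c p b else 0)
      + ((if c = p then R q a p b else 0) - (if c = q then R p a p b else 0))
      + (R q b c a - (if p = q then R p b c a else 0))
      - ((if b = p then R q p c a else 0) - (if b = q then R p p c a else 0)) = 0 := by
    intro p
    have h2 := hinv (fun x y => (if x = p then if y = q then 1 else 0 else 0)
      - (if x = q then if y = p then 1 else 0 else 0)) (fun x y => by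
        split_ifs <;> norm_num) p b c a
    simp only [mul_sub, sub_mul, Finset.sum_sub_distrib, mul_ite, ite_mul, mul_one, one_mul,
      mul_zero, zero_mul, Finset.sum_ite_eq', Finset.mem_univ, if_true] at h2
    have h3 : ∀ (P : Prop) [Decidable P] (f : I → ℝ) (y : I),
        ∑ x, (if P then if x = y then f x else 0 else 0) = if P then f y else 0 := by
      intro P _ f y
      by_cases hP : P <;> simp [hP]
    simp only [h3] at h2
    linarith
  have h4 := Finset.sum_eq_zero fun p (_ : p ∈ Finset.univ) => h1 p
  simp only [Finset.sum_add_distrib, Finset.sum_sub_distrib, Finset.sum_ite_eq, Finset.sum_ite_eq',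
    Finset.mem_univ, if_true, Finset.sum_const, Finset.card_univ, nsmul_eq_mul] at h4
  have h5 : ∀ (P : Prop) [Decidable P] (f : I → ℝ),
      ∑ x, (if P then f x else 0) = if P then ∑ x, f x else 0 := by
    intro P _ f
    by_cases hP : P <;> simp [hP]
  simp only [h5, htr, ite_self] at h4
  simp only [ite_mul, one_mul, zero_mul, eq_comm (a := q)]
  have h6 := hcyc q b c a
  have h7 := hswap q a c b
  linarith

/-- Such a curvature tensor is that of a space of constant curvature. -/
theorem curvature_eq_scalar {g G : I → I → ℝ} (hg : ∀ a b, g a b = g b a)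
    (hG : ∀ a b, G a b = G b a)
    (hgG : ∀ a b, ∑ c, g a c * G c b = if a = b then 1 else 0) {R : I → I → I → I → ℝ}
    (hcard : (Fintype.card I : ℝ) ≠ 1)
    (hswap : ∀ q b c a, R q b c a = -R q b a c)
    (hcyc : ∀ q b c a, R q b c a + R q c a b + R q a b c = 0)
    (hskew : ∀ q b c a, ∑ e, g q e * R e b c a = -∑ e, g b e * R e q c a)
    (hinv : ∀ F : I → I → ℝ, (∀ x y, F x y = -F y x) → ∀ k e c a,
      ∑ d, R d c k e * F d a + ∑ d, F c d * R d a k e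
        + ∑ d, R d e c a * F k d - ∑ d, R d k c a * F e d = 0) (q b c a : I) :
    R q b c a = (∑ d, ∑ c, G d c * ∑ p, R p c p d)
        / ((Fintype.card I : ℝ) * ((Fintype.card I : ℝ) - 1))
      * ((if q = c then 1 else 0) * g b a - (if q = a then 1 else 0) * g b c) := by
  set n : ℝ := (Fintype.card I : ℝ) with hn
  set Ric : I → I → ℝ := fun a b => ∑ p, R p a p b with hRic
  set S : I → I → I → I → ℝ := fun q b c a => ∑ e, g q e * R e b c a with hS
  have hnpos : n ≠ 0 := by
    have : Nonempty I := ⟨q⟩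
    exact Nat.cast_ne_zero.2 Fintype.card_ne_zero
  have hn1 : n - 1 ≠ 0 := sub_ne_zero.2 hcard
  have hup : ∀ q b c a, R q b c a = ∑ x, G q x * S x b c a := by
    intro q b c a
    simp only [hS, Finset.mul_sum]
    rw [Finset.sum_comm]
    have : ∀ e, ∑ x, G q x * (g x e * R e b c a) = (if e = q then 1 else 0) * R e b c a := by
      intro e
      rw [← hgG, Finset.sum_mul]
      exact Finset.sum_congr rfl fun x _ => by rw [hG q x, hg x e]; ring
    simp [this]
  have htr : ∀ c a, ∑ p, R p p c a = 0 := by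
    intro c a
    have h1 : ∑ p, R p p c a = ∑ p, ∑ x, G p x * S x p c a :=
      Finset.sum_congr rfl fun p _ => hup p p c a
    have h2 : ∑ p, ∑ x, G p x * S x p c a = -∑ p, ∑ x, G p x * S x p c a := by
      conv_lhs => rw [Finset.sum_comm]
      simp only [← Finset.sum_neg_distrib]
      refine Finset.sum_congr rfl fun x _ => Finset.sum_congr rfl fun p _ => ?_
      rw [show S x p c a = -S p x c a from hskew x p c a, hG p x]
      ring
    linarith
  have hR := curvature_eq_ricci hswap hcyc htr hinv
  have hSR : ∀ q b c a, (n - 1) * S q b c a = g q c * Ric a b - g q a * Ric c b := by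
    intro q b c a
    simp only [hS, Finset.mul_sum]
    have : ∀ e, (n - 1) * (g q e * R e b c a) = (if e = c then g q e * Ric a b else 0)
        - (if e = a then g q e * Ric c b else 0) := by
      intro e
      have h1 : (n - 1) * (g q e * R e b c a) = g q e * ((n - 1) * R e b c a) := by ring
      rw [h1, hR e b c a]
      simp only [hRic]
      split_ifs <;> ring
    simp [this]
  have h1 : ∀ a b c d, g d c * Ric a b - g d a * Ric c b + g b c * Ric a d - g b a * Ric c d
      = 0 := by
    intro a b c d
    have := hskew d b c a
    have e1 := hSR d b c a
    have e2 := hSR b d c a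
    rw [show S d b c a = -S b d c a from this] at e1
    linarith
  have hGg : ∀ a b, ∑ c, G a c * g c b = if a = b then 1 else 0 := by
    intro a b
    rw [show (if a = b then (1 : ℝ) else 0) = if b = a then 1 else 0 by simp only [eq_comm],
      ← hgG b a]
    exact Finset.sum_congr rfl fun c _ => by rw [hG a c, hg c b]; ring
  have hRicg : ∀ a b, n * Ric a b = (∑ d, ∑ c, G d c * Ric c d) * g b a := by
    intro a b
    have e0 : ∑ d, ∑ c, G d c * (g d c * Ric a b - g d a * Ric c b + g b c * Ric a d
        - g b a * Ric c d) = 0 :=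
      Finset.sum_eq_zero fun d _ => Finset.sum_eq_zero fun c _ => by rw [h1, mul_zero]
    have e1 : ∑ d, ∑ c, G d c * (g d c * Ric a b) = n * Ric a b := by
      have : ∀ d, ∑ c, G d c * (g d c * Ric a b) = Ric a b := by
        intro d
        have h2 := hgG d d
        rw [if_pos rfl] at h2
        calc _ = (∑ c, g d c * G c d) * Ric a b := by
              rw [Finset.sum_mul]
              exact Finset.sum_congr rfl fun c _ => by rw [hG d c]; ring
          _ = _ := by rw [h2, one_mul]
      simp [this, hn]
    have e2 : ∑ d, ∑ c, G d c * (g d a * Ric c b) = Ric a b := by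
      rw [Finset.sum_comm]
      have : ∀ c, ∑ d, G d c * (g d a * Ric c b) = (if c = a then 1 else 0) * Ric c b := by
        intro c
        rw [← hGg, Finset.sum_mul]
        exact Finset.sum_congr rfl fun d _ => by rw [hG d c]; ring
      simp [this]
    have e3 : ∑ d, ∑ c, G d c * (g b c * Ric a d) = Ric a b := by
      have : ∀ d, ∑ c, G d c * (g b c * Ric a d) = (if d = b then 1 else 0) * Ric a d := by
        intro d
        rw [← hGg, Finset.sum_mul]
        exact Finset.sum_congr rfl fun c _ => by rw [hg b c]; ring
      simp [this]
    have e4 : ∑ d, ∑ c, G d c * (g b a * Ric c d) = (∑ d, ∑ c, G d c * Ric c d) * g b a := by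
      simp only [Finset.sum_mul]
      exact Finset.sum_congr rfl fun d _ => Finset.sum_congr rfl fun c _ => by ring
    simp only [mul_add, mul_sub, Finset.sum_add_distrib, Finset.sum_sub_distrib] at e0
    rw [e1, e2, e3, e4] at e0
    linarith
  have h2 : n * (n - 1) * R q b c a = (∑ d, ∑ c, G d c * Ric c d)
      * ((if q = c then 1 else 0) * g b a - (if q = a then 1 else 0) * g b c) := by
    have e1 := hR q b c a
    have e2 : n * (n - 1) * R q b c a = (if q = c then 1 else 0) * (n * Ric a b)
        - (if q = a then 1 else 0) * (n * Ric c b) := by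
      rw [mul_assoc, e1]; ring
    rw [e2, hRicg, hRicg]; ring
  rw [div_mul_eq_mul_div, eq_div_iff (mul_ne_zero hnpos hn1), ← h2]
  ring

end CurvatureAlgebra

section MaximallySymmetric

variable {m : ℕ} {U : Opens (Point m)} {h : Point m → Matrix (Fin m) (Fin m) ℝ} {z : Point m}

/-- In a maximally symmetric space every skew jet is the jet of a Killing field. -/
theorem IsMetricOn.exists_oneForm_of_jet (H : IsMetricOn U h)
    (hU : IsConnected (U : Set (Point m))) (hmax : IsMaximallySymmetric U h) (hz : z ∈ U)
    (v : Idx m → ℝ) (F : Idx m → Idx m → ℝ) (hF : ∀ a b, F a b = -F b a) :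
    ∃ ξ : Idx m → Point m → ℝ, (∀ a, ContDiffOn ℝ ∞ (ξ a) U) ∧
      (∀ w ∈ U, ∀ a b, covGrad h ξ a b w = -covGrad h ξ b a w) ∧ (∀ a, ξ a z = v a) ∧
      ∀ a b, covGrad h ξ a b z = F a b := by
  have := (H.killing_finite hU).1
  have hsurj : Function.Surjective (H.killingJet hz) :=
    (LinearMap.injective_iff_surjective_of_finrank_eq_finrank
      (hmax.trans (finrank_jets m).symm)).1 (H.killingJet_injective hU.isPreconnected hz)
  let M : skewMatrices (Option (Idx m)) := ⟨Matrix.of fun A B => match A, B with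
    | none, none => 0
    | none, some b => v b
    | some a, none => -v a
    | some a, some b => F a b, by
      rintro (_ | a) (_ | b)
      · simp
      · simp
      · simp
      · exact hF a b⟩
  obtain ⟨X, hX⟩ := hsurj M
  have hM : jetMat h (lower h X.1) z = M.1 := congrArg Subtype.val hX
  exact ⟨lower h X.1, H.lower_smooth X.2.1.smooth, fun w hw => H.covGrad_lower_skew X.2 hw,
    fun a => congrFun (congrFun hM none) (some a),
    fun a b => congrFun (congrFun hM (some a)) (some b)⟩

/-- The candidate for the constant curvature: the scalar curvature, up to a factor. -/
noncomputable def sectionalCurv (h : Point m → Matrix (Fin m) (Fin m) ℝ) (z : Point m) : ℝ :=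
  (∑ d, ∑ c, (metric h z)⁻¹ d c * ∑ p, riemann h p c p d z)
    / ((Fintype.card (Idx m) : ℝ) * ((Fintype.card (Idx m) : ℝ) - 1))

theorem IsMetricOn.sectionalCurv_smooth (H : IsMetricOn U h) :
    ContDiffOn ℝ ∞ (sectionalCurv h) U :=
  (contDiffOn_fun_sum _ fun d => contDiffOn_fun_sum _ fun c => (H.inv_smooth d c).mul
    (contDiffOn_fun_sum _ fun p => H.riemann_smooth p c p d)).div_const _

/-- The integrability condition at jets with `ξ = 0` and arbitrary skew `F`. -/
theorem IsMetricOn.riemann_eq_of_maximal (H : IsMetricOn U h)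
    (hU : IsConnected (U : Set (Point m))) (hm : 1 ≤ m) (hmax : IsMaximallySymmetric U h)
    (hz : z ∈ U) (q b c a : Idx m) :
    riemann h q b c a z = sectionalCurv h z * ((if q = c then 1 else 0) * metric h z b a
      - (if q = a then 1 else 0) * metric h z b c) := by
  have hcard : (Fintype.card (Idx m) : ℝ) ≠ 1 := by
    simp only [Fintype.card_sum, Fintype.card_fin, Fintype.card_unit]
    push_cast
    have : (1 : ℝ) ≤ m := by exact_mod_cast hm
    intro h; linarith
  refine curvature_eq_scalar (H.metric_symm hz) (H.inv_symm hz) (H.sum_metric_mul_inv hz)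
    (R := fun q b c a => riemann h q b c a z) hcard
    (fun q b c a => riemann_swap h q b c a z) (fun q b c a => H.riemann_cyclic hz q b c a)
    (fun q b c a => H.riemann_lower_skew hz q b c a) (fun F hF k e c a => ?_) q b c a
  obtain ⟨ξ, hξ, hskew, hv, hFξ⟩ := H.exists_oneForm_of_jet hU hmax hz (fun _ => 0) F hF
  have hRs : ∀ e c a d, ContDiffOn ℝ ∞ (fun w => riemann h d e c a w * ξ d w) U :=
    fun e c a d => (H.riemann_smooth d e c a).mul (hξ d)
  have key := H.integrability_of_skew hξ hskew
    (Q := fun e w => Matrix.of fun c a => ∑ d, riemann h d e c a w * ξ d w)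
    (fun e c a => by simp only [Matrix.of_apply]; exact contDiffOn_fun_sum _ (hRs e c a))
    (fun _ _ _ _ _ => rfl) hz k e
  have hQ0 : ∀ e, (Matrix.of fun c a => ∑ d, riemann h d e c a z * ξ d z) = 0 := by
    intro e; ext c a; simp [hv]
  have hpd : ∀ k d, pd k (ξ d) z = F k d := by
    intro k d
    rw [← hFξ k d, covGrad]
    simp [hv]
  have hQ' : ∀ k e, pdMat k (fun w => Matrix.of fun c a => ∑ d, riemann h d e c a w * ξ d w) z
      = Matrix.of fun c a => ∑ d, riemann h d e c a z * F k d := by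
    intro k e
    ext c a
    simp only [pdMat, Matrix.of_apply]
    rw [pd_sum Finset.univ (hRs e c a) hz]
    refine Finset.sum_congr rfl fun d _ => ?_
    rw [pd_mul (H.riemann_smooth d e c a) (hξ d) hz, hv, hpd]
    ring
  simp only [hQ0, hQ', mul_zero, zero_mul, zero_add] at key
  have key2 := congrFun (congrFun key c) a
  simp only [Matrix.add_apply, Matrix.sub_apply, Matrix.mul_apply, Matrix.transpose_apply,
    Matrix.of_apply, curvMat, gradMat, hFξ, Matrix.zero_apply] at key2
  exact key2

/-- The integrability condition at jets with `F = 0` and arbitrary `ξ`. -/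
theorem IsMetricOn.pd_sectionalCurv_of_maximal (H : IsMetricOn U h)
    (hU : IsConnected (U : Set (Point m))) (hm : 1 ≤ m) (hmax : IsMaximallySymmetric U h)
    (hz : z ∈ U) (k : Idx m) : pd k (sectionalCurv h) z = 0 := by
  have hκ := H.sectionalCurv_smooth
  have hg := H.metric_smooth
  have h1 : ∀ v : Idx m → ℝ, ∀ k e c a : Idx m,
      pd k (sectionalCurv h) z * (v c * metric h z e a - v a * metric h z e c)
        = pd e (sectionalCurv h) z * (v c * metric h z k a - v a * metric h z k c) := by
    intro v k e c a
    obtain ⟨ξ, hξ, hskew, hv, hFξ⟩ := H.exists_oneForm_of_jet hU hmax hz v (fun _ _ => 0)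
      (fun _ _ => by simp)
    have hsm : ∀ e c a, ContDiffOn ℝ ∞
        (fun w => ξ c w * metric h w e a - ξ a w * metric h w e c) U :=
      fun e c a => ((hξ c).mul (hg e a)).sub ((hξ a).mul (hg e c))
    have key := H.integrability_of_skew hξ hskew
      (Q := fun e w => Matrix.of fun c a =>
        sectionalCurv h w * (ξ c w * metric h w e a - ξ a w * metric h w e c))
      (fun e c a => hκ.mul (hsm e c a)) (fun w hw e c a => by
        simp only [H.riemann_eq_of_maximal hU hm hmax hw, Matrix.of_apply]
        have : ∀ d, sectionalCurv h w * ((if d = c then 1 else 0) * metric h w e a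
            - (if d = a then 1 else 0) * metric h w e c) * ξ d w
            = (if d = c then sectionalCurv h w * metric h w e a * ξ d w else 0)
              - (if d = a then sectionalCurv h w * metric h w e c * ξ d w else 0) := by
          intro d
          split_ifs <;> ring
        simp only [this, Finset.sum_sub_distrib, Finset.sum_ite_eq', Finset.mem_univ, if_true]
        ring) hz k e
    have hF0 : gradMat h ξ z = 0 := by ext a b; exact hFξ a b
    set y : Idx m → Idx m → ℝ := fun k c => ∑ d, christoffel h d k c z * ξ d z with hy
    set γ : Idx m → Idx m → Idx m → ℝ := fun b c a => ∑ d, metric h z b d * christoffel h d c a z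
      with hγ
    have hysymm : ∀ k c, y k c = y c k := fun k c =>
      Finset.sum_congr rfl fun d _ => by rw [H.christoffel_symm hz]
    have hγsymm : ∀ b k c, γ b k c = γ b c k := fun b k c =>
      Finset.sum_congr rfl fun d _ => by rw [H.christoffel_symm hz]
    have hpd : ∀ k d, pd k (ξ d) z = y k d := by
      intro k d
      have := hFξ k d
      rw [covGrad, sub_eq_zero] at this
      exact this
    have hpdg : ∀ k e a, pd k (fun w => metric h w e a) z = γ a k e + γ e k a :=
      fun k e a => H.pd_metric hz k e a
    have hQ' : ∀ k e c a, pd k (fun w =>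
        sectionalCurv h w * (ξ c w * metric h w e a - ξ a w * metric h w e c)) z
        = pd k (sectionalCurv h) z * (ξ c z * metric h z e a - ξ a z * metric h z e c)
          + sectionalCurv h z * (y k c * metric h z e a + ξ c z * (γ a k e + γ e k a)
            - (y k a * metric h z e c + ξ a z * (γ c k e + γ e k c))) := by
      intro k e c a
      rw [pd_mul hκ (hsm e c a) hz, pd_sub ((hξ c).mul (hg e a)) ((hξ a).mul (hg e c)) hz,
        pd_mul (hξ c) (hg e a) hz, pd_mul (hξ a) (hg e c) hz, hpd, hpd, hpdg, hpdg]
    have hΓQ : ∀ k e c a, ∑ d, christoffel h d e c z *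
        (sectionalCurv h z * (ξ d z * metric h z k a - ξ a z * metric h z k d))
        = sectionalCurv h z * (y e c * metric h z k a - ξ a z * γ k e c) := by
      intro k e c a
      simp only [hy, hγ, Finset.sum_mul, Finset.mul_sum, ← Finset.sum_sub_distrib]
      exact Finset.sum_congr rfl fun d _ => by ring
    have hQΓ : ∀ k e c a, ∑ d,
        (sectionalCurv h z * (ξ c z * metric h z k d - ξ d z * metric h z k c))
          * christoffel h d e a z
        = sectionalCurv h z * (ξ c z * γ k e a - y e a * metric h z k c) := by
      intro k e c a
      simp only [hy, hγ, Finset.sum_mul, Finset.mul_sum, ← Finset.sum_sub_distrib]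
      exact Finset.sum_congr rfl fun d _ => by ring
    rw [hF0] at key
    have key2 := congrFun (congrFun key c) a
    simp only [Matrix.add_apply, Matrix.sub_apply, Matrix.mul_apply, Matrix.transpose_apply,
      Matrix.of_apply, connMat, pdMat, Matrix.zero_apply, mul_zero, zero_mul,
      zero_add, hQ', hΓQ, hQΓ] at key2
    rw [← hv, ← hv]
    rw [hγsymm a e k, hγsymm c e k] at key2
    linear_combination key2
  have hcard : (Fintype.card (Idx m) : ℝ) = m + 1 := by
    simp only [Fintype.card_sum, Fintype.card_fin, Fintype.card_unit]
    push_cast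
    ring
  have hm' : (m : ℝ) ≠ 0 := by exact_mod_cast (by omega : m ≠ 0)
  -- contracting with `v = δ_c` over `c`
  have h2 : ∀ e a, pd k (sectionalCurv h) z * metric h z e a
      = pd e (sectionalCurv h) z * metric h z k a := by
    intro e a
    have h3 := Finset.sum_congr (s₁ := Finset.univ) rfl fun c (_ : c ∈ Finset.univ) =>
      h1 (fun x => if x = c then 1 else 0) k e c a
    simp only [if_true, one_mul, ite_mul, zero_mul, ← Finset.mul_sum, Finset.sum_sub_distrib,
      Finset.sum_const, Finset.card_univ, nsmul_eq_mul, Finset.sum_ite_eq, Finset.mem_univ,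
      hcard] at h3
    refine mul_left_cancel₀ hm' ?_
    linear_combination h3
  have h4 : ∑ e, ∑ a, metric h z e a * (metric h z)⁻¹ a e = m + 1 := by
    simp only [H.sum_metric_mul_inv hz, if_true, Finset.sum_const, Finset.card_univ, nsmul_eq_mul,
      hcard, mul_one]
  have h5 : ∑ e, pd e (sectionalCurv h) z * ∑ a, metric h z k a * (metric h z)⁻¹ a e
      = pd k (sectionalCurv h) z := by
    simp only [H.sum_metric_mul_inv hz, mul_ite, mul_one, mul_zero, Finset.sum_ite_eq,
      Finset.mem_univ, if_true]
  have h6 : pd k (sectionalCurv h) z * ∑ e, ∑ a, metric h z e a * (metric h z)⁻¹ a e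
      = ∑ e, pd e (sectionalCurv h) z * ∑ a, metric h z k a * (metric h z)⁻¹ a e := by
    simp only [Finset.mul_sum]
    refine Finset.sum_congr rfl fun e _ => Finset.sum_congr rfl fun a _ => ?_
    linear_combination (metric h z)⁻¹ a e * h2 e a
  rw [h4, h5] at h6
  refine mul_left_cancel₀ hm' ?_
  linear_combination h6

/-- A maximally symmetric space has constant curvature. -/
theorem IsMetricOn.constantCurvature_of_maximal (H : IsMetricOn U h)
    (hU : IsConnected (U : Set (Point m))) (hm : 1 ≤ m) (hmax : IsMaximallySymmetric U h) :
    HasConstantCurvature U h := by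
  obtain ⟨z₀, hz₀⟩ := hU.nonempty
  have hconst : ∀ z ∈ U, sectionalCurv h z = sectionalCurv h z₀ := by
    intro z hz
    refine U.isOpen.is_const_of_fderiv_eq_zero hU.isPreconnected
      (H.sectionalCurv_smooth.differentiableOn (by simp)) (fun w hw => ?_) hz hz₀
    ext v
    rw [fderiv_eq_sum_pd]
    simp only [H.pd_sectionalCurv_of_maximal hU hm hmax hw, mul_zero, Finset.sum_const_zero]
    rfl
  refine ⟨sectionalCurv h z₀, fun z hz a b c d => ?_⟩
  simp only [H.riemann_eq_of_maximal hU hm hmax hz, ← hconst z hz]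
  have : ∀ e, metric h z a e * (sectionalCurv h z * ((if e = c then 1 else 0) * metric h z b d
      - (if e = d then 1 else 0) * metric h z b c))
      = (if e = c then metric h z a e * sectionalCurv h z * metric h z b d else 0)
        - (if e = d then metric h z a e * sectionalCurv h z * metric h z b c else 0) := by
    intro e
    split_ifs <;> ring
  simp only [this, Finset.sum_sub_distrib, Finset.sum_ite_eq', Finset.mem_univ, if_true]
  ring

end MaximallySymmetric

/-! ### Fundamental solutions of integrable linear systems -/

section FlatSystem

variable {m : ℕ} {U : Opens (Point m)} {J : Type*}

theorem contDiffOn_succ_of_pd {n : ℕ} {f : Point m → ℝ} (hf : DifferentiableOn ℝ f U)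
    (hpd : ∀ c, ContDiffOn ℝ n (pd c f) U) : ContDiffOn ℝ (n + 1 : ℕ) f U := by
  rw [Nat.cast_add, Nat.cast_one, contDiffOn_succ_iff_fderiv_of_isOpen U.isOpen]
  refine ⟨hf, by simp, ?_⟩
  have h1 : fderiv ℝ f = fun z => ∑ c, pd c f z •
      (ContinuousLinearMap.proj c : Point m →L[ℝ] ℝ) := by
    funext z
    ext w
    rw [fderiv_eq_sum_pd]
    simp only [sum_apply, smul_apply, ContinuousLinearMap.proj_apply, smul_eq_mul]
    exact Finset.sum_congr rfl fun c _ => mul_comm _ _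
  rw [h1]
  exact ContDiffOn.sum fun c _ => (hpd c).smul contDiffOn_const

variable [Fintype J] [DecidableEq J]

variable {𝔸 : Type*} [NormedRing 𝔸] [NormedAlgebra ℝ 𝔸] (φ : Matrix J J ℝ ≃ₐ[ℝ] 𝔸)

/-- The connection form with coefficient matrices `a c`. Matrices carry no norm of their own, so
they are transported to a normed algebra. -/
noncomputable def connectionForm (a : Idx m → Point m → Matrix J J ℝ) (z : Point m) :
    Point m →L[ℝ] 𝔸 :=
  ∑ c, ∑ i, ∑ j, a c z i j •
    (ContinuousLinearMap.proj c : Point m →L[ℝ] ℝ).smulRight (φ (Matrix.single i j 1))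

theorem sum_smul_single (M : Matrix J J ℝ) :
    ∑ i, ∑ j, M i j • Matrix.single i j (1 : ℝ) = M := by
  conv_rhs => rw [Matrix.matrix_eq_sum_single M]
  simp [Matrix.smul_single]

theorem connectionForm_apply (a : Idx m → Point m → Matrix J J ℝ) (z w : Point m) :
    connectionForm φ a z w = φ (∑ c, w c • a c z) := by
  simp only [connectionForm, sum_apply, smul_apply, ContinuousLinearMap.smulRight_apply,
    ContinuousLinearMap.proj_apply, map_sum, map_smul]
  refine Finset.sum_congr rfl fun c _ => ?_
  conv_rhs => rw [← sum_smul_single (a c z)]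
  simp only [map_sum, map_smul, Finset.smul_sum, smul_comm (w c)]

theorem connectionForm_smooth {a : Idx m → Point m → Matrix J J ℝ}
    (ha : ∀ c i j, ContDiffOn ℝ ∞ (fun z => a c z i j) U) :
    ContDiffOn ℝ ∞ (connectionForm φ a) U :=
  ContDiffOn.sum fun c _ => ContDiffOn.sum fun i _ => ContDiffOn.sum fun j _ =>
    (ha c i j).smul contDiffOn_const

theorem fderiv_connectionForm {a : Idx m → Point m → Matrix J J ℝ}
    (ha : ∀ c i j, ContDiffOn ℝ ∞ (fun z => a c z i j) U) {z : Point m} (hz : z ∈ U)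
    (u w : Point m) :
    fderiv ℝ (connectionForm φ a) z u w
      = φ (∑ c, ∑ e, w c • u e • pdMat e (a c) z) := by
  have h1 : HasFDerivAt (connectionForm φ a) (∑ c, ∑ i, ∑ j,
      (fderiv ℝ (fun z => a c z i j) z).smulRight
        ((ContinuousLinearMap.proj c : Point m →L[ℝ] ℝ).smulRight (φ (Matrix.single i j 1)))) z := by
    unfold connectionForm
    refine HasFDerivAt.fun_sum fun c _ => HasFDerivAt.fun_sum fun i _ =>
      HasFDerivAt.fun_sum fun j _ => ?_
    exact (differentiableAt_of_mem (ha c i j) hz).hasFDerivAt.smul_const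
      ((ContinuousLinearMap.proj c : Point m →L[ℝ] ℝ).smulRight (φ (Matrix.single i j 1)))
  rw [h1.fderiv]
  simp only [sum_apply, ContinuousLinearMap.smulRight_apply, smul_apply,
    ContinuousLinearMap.proj_apply]
  rw [map_sum]
  refine Finset.sum_congr rfl fun c _ => ?_
  have h2 : ∑ e, u e • pdMat e (a c) z
      = Matrix.of fun i j => fderiv ℝ (fun z => a c z i j) z u := by
    ext i j
    rw [Matrix.sum_apply]
    simp only [Matrix.smul_apply, pdMat, Matrix.of_apply, fderiv_eq_sum_pd, smul_eq_mul]
  rw [← Finset.smul_sum, h2, ← sum_smul_single (Matrix.of _)]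
  simp only [map_sum, map_smul, Finset.smul_sum, smul_comm (w c), Matrix.of_apply]

/-- The fundamental solution, as a parallel section of the connection form. It is smooth because its
derivatives are expressed by the solution itself. -/
theorem exists_fundamental_solution_of_algEquiv
    (φ : Matrix J J ℝ ≃ₐ[ℝ] 𝔸) [CompleteSpace 𝔸] [SimplyConnectedSpace U]
    {a : Idx m → Point m → Matrix J J ℝ}
    (ha : ∀ c i j, ContDiffOn ℝ ∞ (fun z => a c z i j) U)
    (hflat : ∀ z ∈ U, ∀ e c, pdMat e (a c) z + a c z * a e z = pdMat c (a e) z + a e z * a c z)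
    {z₀ : Point m} (hz₀ : z₀ ∈ U) :
    ∃ S : Point m → Matrix J J ℝ, S z₀ = 1 ∧ (∀ i j, ContDiffOn ℝ ∞ (fun z => S z i j) U) ∧
      ∀ z ∈ U, ∀ c, pdMat c S z = a c z * S z := by
  have hsc : SimplyConnectedSpace (U : Set (Point m)) := ‹_›
  obtain ⟨S, hS0, hS⟩ := exists_parallel_section U.isOpen
    (A := connectionForm φ a) ((connectionForm_smooth φ ha).of_le (by norm_cast)) (fun z hz u w => by
      have h1 : ∀ u w : Point m, fderiv ℝ (connectionForm φ a) z u w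
          + connectionForm φ a z w * connectionForm φ a z u
          = φ (∑ c, ∑ e, (w c * u e) • (pdMat e (a c) z + a c z * a e z)) := by
        intro u w
        rw [fderiv_connectionForm φ ha hz, connectionForm_apply, connectionForm_apply,
          ← map_mul, ← map_add, Finset.sum_mul_sum]
        congr 1
        simp only [← Finset.sum_add_distrib, smul_add, smul_smul, smul_mul_assoc, mul_smul_comm]
        refine Finset.sum_congr rfl fun c _ => Finset.sum_congr rfl fun e _ => ?_
        rw [mul_comm (u e)]
      rw [h1, h1, Finset.sum_comm]
      congr 1
      refine Finset.sum_congr rfl fun e _ => Finset.sum_congr rfl fun c _ => ?_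
      rw [hflat z hz e c, mul_comm]) hz₀
  have hfin : FiniteDimensional ℝ 𝔸 := φ.toLinearEquiv.finiteDimensional
  let entry : J → J → 𝔸 →L[ℝ] ℝ := fun i j =>
    LinearMap.toContinuousLinearMap
      ((Matrix.entryLinearMap ℝ ℝ i j).comp φ.symm.toLinearMap)
  have hentry : ∀ z ∈ U, ∀ i j, HasFDerivAt (fun z => φ.symm (S z) i j)
      ((entry i j).comp (((ContinuousLinearMap.mul ℝ 𝔸).flip (S z)).comp
        (connectionForm φ a z))) z :=
    fun z hz i j => (entry i j).hasFDerivAt.comp z (hS z hz)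
  have hpd : ∀ z ∈ U, ∀ c i j, pd c (fun z => φ.symm (S z) i j) z
      = ∑ k, a c z i k * φ.symm (S z) k j := by
    intro z hz c i j
    rw [pd, (hentry z hz i j).fderiv]
    have h1 : connectionForm φ a z (Pi.single c 1) = φ (a c z) := by
      rw [connectionForm_apply]
      congr 1
      rw [Finset.sum_eq_single c]
      · simp
      · intro b _ hb; simp [hb]
      · simp
    change φ.symm (connectionForm φ a z (Pi.single c 1) * S z) i j = _
    rw [h1, map_mul, AlgEquiv.symm_apply_apply, Matrix.mul_apply]
  have hsmooth : ∀ n : ℕ, ∀ i j, ContDiffOn ℝ n (fun z => φ.symm (S z) i j) U := by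
    intro n
    induction n with
    | zero =>
      exact fun i j => contDiffOn_zero.2 fun z hz =>
        (hentry z hz i j).continuousAt.continuousWithinAt
    | succ n ih =>
      refine fun i j => contDiffOn_succ_of_pd
        (fun z hz => (hentry z hz i j).differentiableAt.differentiableWithinAt) fun c => ?_
      refine ContDiffOn.congr (ContDiffOn.sum fun k _ => ((ha c i k).of_le ?_).mul (ih k j))
        fun z hz => hpd z hz c i j
      exact_mod_cast le_top
  refine ⟨fun z => φ.symm (S z), by beta_reduce; rw [hS0, map_one],
    fun i j => contDiffOn_infty.2 fun n => hsmooth n i j, fun z hz c => ?_⟩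
  ext i j
  rw [Matrix.mul_apply]
  exact hpd z hz c i j

/-- A linear system `∂_c S = a_c S` whose integrability condition holds has, on a simply connected
domain, a smooth fundamental solution. -/
theorem exists_fundamental_solution {m : ℕ} {U : Opens (Point m)} {J : Type*} [Fintype J]
    [DecidableEq J] [SimplyConnectedSpace U]
    {a : Idx m → Point m → Matrix J J ℝ}
    (ha : ∀ c i j, ContDiffOn ℝ ∞ (fun z => a c z i j) U)
    (hflat : ∀ z ∈ U, ∀ e c, pdMat e (a c) z + a c z * a e z = pdMat c (a e) z + a e z * a c z)
    {z₀ : Point m} (hz₀ : z₀ ∈ U) :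
    ∃ S : Point m → Matrix J J ℝ, S z₀ = 1 ∧ (∀ i j, ContDiffOn ℝ ∞ (fun z => S z i j) U) ∧
      ∀ z ∈ U, ∀ c, pdMat c S z = a c z * S z :=
  exists_fundamental_solution_of_algEquiv
    (Matrix.toLinAlgEquiv'.trans (Module.End.toContinuousLinearMap (J → ℝ))) ha hflat hz₀

end FlatSystem

/-! ### Killing fields of simply connected spaces of constant curvature -/

section ConstantCurvature

variable {m : ℕ} {U : Opens (Point m)} {h : Point m → Matrix (Fin m) (Fin m) ℝ} {z : Point m}

/-- The coefficient matrices of the system `∂_c f = θ_c`, `∂_c θ_a = Γ^d_{ca} θ_d - K g_{ca} f`,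
which expresses that the Hessian of `f` is `-K f g`; the index `none` labels `f`. -/
noncomputable def hessianMat (h : Point m → Matrix (Fin m) (Fin m) ℝ) (K : ℝ) (c : Idx m)
    (z : Point m) : Matrix (Option (Idx m)) (Option (Idx m)) ℝ :=
  Matrix.of fun A B => match A, B with
    | none, none => 0
    | none, some d => if c = d then 1 else 0
    | some a, none => -K * metric h z c a
    | some a, some d => christoffel h d c a z

namespace IsMetricOn

theorem hessianMat_smooth (H : IsMetricOn U h) (K : ℝ) (c : Idx m) (A B : Option (Idx m)) :
    ContDiffOn ℝ ∞ (fun z => hessianMat h K c z A B) U := by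
  rcases A with _ | a <;> rcases B with _ | b
  · exact contDiffOn_const
  · exact contDiffOn_const
  · exact contDiffOn_const.mul (H.metric_smooth c a)
  · exact H.christoffel_smooth b c a

/-- The curvature tensor of a space of constant curvature, with the first index raised. -/
theorem riemann_eq_of_constant (H : IsMetricOn U h) {K : ℝ}
    (hK : ∀ z ∈ U, ∀ a b c d : Idx m, ∑ e, metric h z a e * riemann h e b c d z
      = K * (metric h z a c * metric h z b d - metric h z a d * metric h z b c)) (hz : z ∈ U)
    (q b c a : Idx m) :
    riemann h q b c a z = K * ((if q = c then 1 else 0) * metric h z b a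
      - (if q = a then 1 else 0) * metric h z b c) := by
  have h1 := H.eq_of_lower_eq hz (v := fun q => riemann h q b c a z)
    (w := fun q => K * ((if q = c then 1 else 0) * metric h z b a
      - (if q = a then 1 else 0) * metric h z b c)) (fun x => by
      rw [hK z hz]
      have : ∀ e, metric h z x e * (K * ((if e = c then 1 else 0) * metric h z b a
          - (if e = a then 1 else 0) * metric h z b c))
          = (if e = c then metric h z x e * K * metric h z b a else 0)
            - (if e = a then metric h z x e * K * metric h z b c else 0) := by
        intro e
        split_ifs <;> ring
      simp only [this, Finset.sum_sub_distrib, Finset.sum_ite_eq', Finset.mem_univ, if_true]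
      ring)
  exact congrFun h1 q

/-- In constant curvature `K` the equation `Hess f = -K f g` is integrable. -/
theorem hessianMat_flat (H : IsMetricOn U h) {K : ℝ}
    (hK : ∀ z ∈ U, ∀ a b c d : Idx m, ∑ e, metric h z a e * riemann h e b c d z
      = K * (metric h z a c * metric h z b d - metric h z a d * metric h z b c)) (hz : z ∈ U)
    (e c : Idx m) :
    pdMat e (hessianMat h K c) z + hessianMat h K c z * hessianMat h K e z
      = pdMat c (hessianMat h K e) z + hessianMat h K e z * hessianMat h K c z := by
  ext (_ | a) (_ | b)
  · simp only [Matrix.add_apply, Matrix.mul_apply, Fintype.sum_option, pdMat, Matrix.of_apply,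
      hessianMat, pd_const, ite_mul, one_mul, zero_mul, Finset.sum_ite_eq, Finset.mem_univ,
      if_true]
    rw [H.metric_symm hz e c]
  · simp only [Matrix.add_apply, Matrix.mul_apply, Fintype.sum_option, pdMat, Matrix.of_apply,
      hessianMat, pd_const, ite_mul, one_mul, zero_mul, Finset.sum_ite_eq, Finset.mem_univ,
      if_true]
    rw [H.christoffel_symm hz b e c]
  · simp only [Matrix.add_apply, Matrix.mul_apply, Fintype.sum_option, pdMat, Matrix.of_apply,
      hessianMat, mul_zero, zero_add]
    have h1 : ∀ e c, ∑ d, christoffel h d c a z * (-K * metric h z e d)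
        = -K * ∑ d, metric h z e d * christoffel h d c a z := by
      intro e c
      rw [Finset.mul_sum]
      exact Finset.sum_congr rfl fun d _ => by ring
    rw [pd_smul (H.metric_smooth c a) hz, pd_smul (H.metric_smooth e a) hz, h1, h1,
      H.pd_metric hz, H.pd_metric hz]
    have h2 : ∑ d, metric h z a d * christoffel h d e c z
        = ∑ d, metric h z a d * christoffel h d c e z :=
      Finset.sum_congr rfl fun d _ => by rw [H.christoffel_symm hz]
    rw [h2]
    ring
  · have hR := H.riemann_eq_of_constant hK hz b a e c
    simp only [riemann, Finset.sum_sub_distrib] at hR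
    simp only [Matrix.add_apply, Matrix.mul_apply, Fintype.sum_option, pdMat, Matrix.of_apply,
      hessianMat, mul_ite, mul_one, mul_zero]
    have h1 : ∀ e c, ∑ d, christoffel h d c a z * christoffel h b e d z
        = ∑ d, christoffel h b e d z * christoffel h d c a z :=
      fun e c => Finset.sum_congr rfl fun d _ => mul_comm _ _
    rw [h1, h1, H.metric_symm hz c a, H.metric_symm hz e a]
    have e1 : pd e (fun w => christoffel h b c a w) z = pd e (christoffel h b c a) z := rfl
    have e2 : pd c (fun w => christoffel h b e a w) z = pd c (christoffel h b e a) z := rfl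
    rw [e1, e2]
    simp only [eq_comm (a := e) (b := b), eq_comm (a := c) (b := b)]
    have e3 : ∀ x : Idx m, (if b = x then -K * metric h z a c else 0)
        = -K * ((if b = x then 1 else 0) * metric h z a c) := fun x => by split_ifs <;> ring
    have e4 : ∀ x : Idx m, (if b = x then -K * metric h z a e else 0)
        = -K * ((if b = x then 1 else 0) * metric h z a e) := fun x => by split_ifs <;> ring
    rw [e3, e4]
    linear_combination hR

/-- On a simply connected space of constant curvature every skew jet is the jet of a Killing field:
with `f_A` the solutions of `Hess f = -K f g` and `M` skew, the one-form `M_{AB} f_A df_B` has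
skew covariant derivative `M_{AB} df_A ⊗ df_B`. -/
theorem killingJet_surjective (H : IsMetricOn U h) [SimplyConnectedSpace U]
    (hc : HasConstantCurvature U h) (hz : z ∈ U) : Function.Surjective (H.killingJet hz) := by
  obtain ⟨K, hK⟩ := hc
  obtain ⟨S, hS0, hSs, hS⟩ := exists_fundamental_solution
    (fun c A B => H.hessianMat_smooth K c A B) (fun w hw e c => H.hessianMat_flat hK hw e c) hz
  rintro ⟨M, hM⟩
  set N : Point m → Matrix (Option (Idx m)) (Option (Idx m)) ℝ :=
    fun w => S w * M * (S w).transpose with hN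
  have hMT : M.transpose = -M := by
    ext A B; exact hM B A
  have hNskew : ∀ w A B, N w A B = -N w B A := by
    intro w A B
    have h1 : (N w).transpose = -N w := by
      simp only [hN, Matrix.transpose_mul, Matrix.transpose_transpose, hMT]
      noncomm_ring
    exact congrFun (congrFun h1 B) A
  have hSMs : ∀ A B, ContDiffOn ℝ ∞ (fun w => (S w * M) A B) U := fun A B => by
    simp only [Matrix.mul_apply]
    exact contDiffOn_fun_sum _ fun k => (hSs A k).mul contDiffOn_const
  have hNs : ∀ A B, ContDiffOn ℝ ∞ (fun w => N w A B) U := fun A B => by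
    simp only [hN, Matrix.mul_apply (M := S _ * M)]
    exact contDiffOn_fun_sum _ fun k => (hSMs A k).mul (hSs B k)
  have hpdN : ∀ w ∈ U, ∀ c, pdMat c N w
      = hessianMat h K c w * N w + N w * (hessianMat h K c w).transpose := by
    intro w hw c
    have h0 : pdMat c (fun _ : Point m => M) w = 0 := by
      ext A B; exact pd_const _ c w
    have h1 : pdMat c N w = (pdMat c S w * M + S w * pdMat c (fun _ : Point m => M) w)
        * (S w).transpose + S w * M * (pdMat c S w).transpose := by
      rw [← pdMat_mul (N := fun _ : Point m => M) hSs (fun A B => contDiffOn_const) hw]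
      exact pdMat_mul (N := fun v => (S v).transpose) hSMs (fun A B => hSs B A) hw c
    rw [h1, h0, hS w hw]
    simp only [hN, Matrix.transpose_mul]
    noncomm_ring
  set ξ : Idx m → Point m → ℝ := fun a w => N w none (some a) with hξ
  have hξs : ∀ a, ContDiffOn ℝ ∞ (ξ a) U := fun a => hNs none (some a)
  have hcov : ∀ w ∈ U, ∀ c a, covGrad h ξ c a w = N w (some c) (some a) := by
    intro w hw c a
    have h1 := congrFun (congrFun (hpdN w hw c) none) (some a)
    have h2 : N w none none = 0 := by
      have := hNskew w none none
      linarith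
    simp only [pdMat, Matrix.of_apply, Matrix.add_apply, Matrix.mul_apply, Matrix.transpose_apply,
      Fintype.sum_option, hessianMat, h2, zero_mul, zero_add, ite_mul, one_mul, Finset.sum_ite_eq,
      Finset.mem_univ, if_true] at h1
    rw [covGrad]
    change pd c (fun w => N w none (some a)) w - _ = _
    rw [h1]
    simp only [hξ, mul_comm (christoffel h _ c a w)]
    ring
  classical
  set X : Point m → Point m := fun w => if w ∈ U then
    fun a => ∑ b, (metric h w)⁻¹ a b * ξ b w else 0 with hX
  have hXU : ∀ w ∈ U, ∀ a, X w a = ∑ b, (metric h w)⁻¹ a b * ξ b w := fun w hw a => by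
    simp only [hX, if_pos hw]
  have hXs : IsFieldOn U X := by
    refine ⟨fun a => ?_, fun w hw => by simp only [hX, if_neg hw]⟩
    exact (contDiffOn_fun_sum _ fun b => (H.inv_smooth a b).mul (hξs b)).congr
      fun w hw => hXU w hw a
  have hlow : ∀ w ∈ U, ∀ a, lower h X a w = ξ a w := by
    intro w hw a
    simp only [lower, hXU w hw, Finset.mul_sum]
    rw [Finset.sum_comm]
    have h1 : ∀ b, ∑ c, metric h w a c * ((metric h w)⁻¹ c b * ξ b w)
        = (if a = b then 1 else 0) * ξ b w := by
      intro b
      rw [← H.sum_metric_mul_inv hw, Finset.sum_mul]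
      exact Finset.sum_congr rfl fun c _ => by ring
    simp only [h1, ite_mul, one_mul, zero_mul, Finset.sum_ite_eq, Finset.mem_univ, if_true]
  have hcovX : ∀ w ∈ U, ∀ a b, covGrad h (lower h X) a b w = N w (some a) (some b) := by
    intro w hw a b
    rw [← hcov w hw, covGrad, covGrad, pd_congr (fun y hy => hlow y hy b) hw]
    simp only [hlow w hw]
  have hkill : X ∈ killingAlgebra U h := by
    refine ⟨hXs, fun w hw a b => ?_⟩
    rw [H.lieMetric_eq hXs.smooth hw, hcovX w hw, hcovX w hw, hNskew w (some a) (some b)]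
    ring
  have hN0 : N z = M := by simp only [hN, hS0, one_mul, Matrix.transpose_one, mul_one]
  refine ⟨⟨X, hkill⟩, Subtype.ext ?_⟩
  change jetMat h (lower h X) z = M
  ext (_ | a) (_ | b)
  · have := hM none none
    simp only [jetMat, Matrix.of_apply]
    linarith
  · exact (hlow z hz b).trans (congrFun (congrFun hN0 none) (some b))
  · rw [hM]
    exact congrArg Neg.neg ((hlow z hz a).trans (congrFun (congrFun hN0 none) (some a)))
  · exact (hcovX z hz a b).trans (congrFun (congrFun hN0 (some a)) (some b))

/-- A simply connected space of constant curvature is maximally symmetric. -/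
theorem maximal_of_constantCurvature (H : IsMetricOn U h) (hU : IsConnected (U : Set (Point m)))
    [SimplyConnectedSpace U] (hc : HasConstantCurvature U h) : IsMaximallySymmetric U h := by
  obtain ⟨z, hz⟩ := hU.nonempty
  rw [IsMaximallySymmetric, ← finrank_jets m]
  exact (LinearEquiv.ofBijective (H.killingJet hz)
    ⟨H.killingJet_injective hU.isPreconnected hz, H.killingJet_surjective hc hz⟩).finrank_eq

end IsMetricOn

end ConstantCurvature

/-! ### Square roots of quadratic polynomials and the trace condition -/

section QuadraticForms

/-- A nonconstant `√(1 + κ t²)` times an affine function is a quadratic polynomial only if both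
vanish. -/
theorem quadratic_eq_zero_of_eq_sqrt_mul_affine {κ a b c d e : ℝ} (hκ : κ ≠ 0)
    (H : ∀ t : ℝ, 0 < 1 + κ * t ^ 2 →
      c + d * t + e * t ^ 2 = √(1 + κ * t ^ 2) * (a + b * t)) :
    c = 0 ∧ d = 0 ∧ e = 0 := by
  have hsq : ∀ t : ℝ, 0 < 1 + κ * t ^ 2 →
      (c + e * t ^ 2) ^ 2 = (1 + κ * t ^ 2) * a ^ 2 ∧
      (d * t) ^ 2 = (1 + κ * t ^ 2) * (b * t) ^ 2 := by
    intro t ht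
    -- the parts of the identity that are even and odd in `t`
    have h1 := H t ht
    have h2 := H (-t) (by simpa using ht)
    rw [neg_sq] at h2
    have he : c + e * t ^ 2 = √(1 + κ * t ^ 2) * a := by linear_combination (h1 + h2) / 2
    have ho : d * t = √(1 + κ * t ^ 2) * (b * t) := by linear_combination (h1 - h2) / 2
    rw [he, ho, mul_pow, mul_pow √_, Real.sq_sqrt ht.le]
    exact ⟨rfl, rfl⟩
  have hpos : 0 < |κ| := abs_pos.2 hκ
  obtain ⟨τ, hτ, hτκ⟩ : ∃ τ : ℝ, 0 < τ ∧ 4 * (|κ| * τ ^ 2) < 1 := by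
    refine ⟨1 / (2 * (|κ| + 1)), by positivity, ?_⟩
    rw [div_pow, one_pow, mul_one_div, mul_div_assoc', div_lt_one (by positivity)]
    nlinarith
  have hle : -(|κ| * τ ^ 2) ≤ κ * τ ^ 2 := by
    have := mul_le_mul_of_nonneg_right (neg_abs_le κ) (sq_nonneg τ)
    linarith
  have hτ2 : 0 < τ ^ 2 := by positivity
  have hm : 0 ≤ |κ| * τ ^ 2 := by positivity
  obtain ⟨p0, -⟩ := hsq 0 (by simp)
  obtain ⟨p1, q1⟩ := hsq τ (by nlinarith)
  obtain ⟨p2, q2⟩ := hsq (2 * τ) (by nlinarith)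
  have hb : b = 0 := by
    have h1 : κ * τ ^ 4 * b ^ 2 = 0 := by linear_combination q1 / 3 - q2 / 12
    simpa [hκ, hτ.ne'] using h1
  have hd : d = 0 := by
    rw [hb] at q1
    simpa [hτ.ne'] using q1
  have he : e = 0 := by
    have h1 : τ ^ 4 * e ^ 2 = 0 := by linear_combination (p2 - 4 * p1 + 3 * p0) / 12
    simpa [hτ.ne'] using h1
  have ha : a = 0 := by
    rw [he] at p0 p1
    have h1 : κ * τ ^ 2 * a ^ 2 = 0 := by linear_combination p0 - p1
    simpa [hκ, hτ.ne'] using h1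
  refine ⟨?_, hd, he⟩
  rw [ha] at p0
  simpa using p0

open Matrix

variable {J : Type*} [Fintype J]

theorem dotProduct_mulVec_add_smul {A : Matrix J J ℝ} (hA : A.IsSymm) (v w : J → ℝ) (t : ℝ) :
    (v + t • w) ⬝ᵥ A *ᵥ (v + t • w)
      = v ⬝ᵥ A *ᵥ v + 2 * (v ⬝ᵥ A *ᵥ w) * t + (w ⬝ᵥ A *ᵥ w) * t ^ 2 := by
  have h1 : w ⬝ᵥ A *ᵥ v = v ⬝ᵥ A *ᵥ w := by
    rw [dotProduct_mulVec, ← mulVec_transpose, hA, dotProduct_comm]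
  simp only [mulVec_add, mulVec_smul, add_dotProduct, dotProduct_add, smul_dotProduct,
    dotProduct_smul, smul_eq_mul, h1]
  ring

variable [DecidableEq J]

/-- Polarization. -/
theorem eq_zero_of_dotProduct_mulVec_self {A : Matrix J J ℝ} (hA : A.IsSymm)
    (h0 : ∀ v, v ⬝ᵥ A *ᵥ v = 0) : A = 0 := by
  ext i j
  have h1 := dotProduct_mulVec_add_smul hA (Pi.single i 1) (Pi.single j 1) 1
  rw [h0, h0, h0] at h1
  have h2 : (Pi.single i (1 : ℝ) : J → ℝ) ⬝ᵥ A *ᵥ Pi.single j 1 = A i j := by simp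
  rw [h2] at h1
  change A i j = 0
  linarith

/-- An affine-quadratic function that vanishes off the null cone of a nonzero symmetric form
vanishes. -/
theorem affineQuadratic_eq_zero {g A : Matrix J J ℝ} (hg : g.IsSymm) (hg0 : g ≠ 0)
    (hA : A.IsSymm) (r : J → ℝ) (H : ∀ v, v ⬝ᵥ g *ᵥ v ≠ 0 → r ⬝ᵥ v = 0 ∧ v ⬝ᵥ A *ᵥ v = 0) :
    r = 0 ∧ A = 0 := by
  obtain ⟨w, hw⟩ : ∃ w, w ⬝ᵥ g *ᵥ w ≠ 0 := by
    by_contra! hcon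
    exact hg0 (eq_zero_of_dotProduct_mulVec_self hg hcon)
  have key : ∀ {a b c α β γ : ℝ}, c ≠ 0 →
      (∀ t : ℝ, a + b * t + c * t ^ 2 ≠ 0 → α + β * t + γ * t ^ 2 = 0) → α = 0 := by
    intro a b c α β γ hc h1
    have h2 : ∀ t : ℝ, (a + b * t + c * t ^ 2) * (α + β * t + γ * t ^ 2) = 0 := by
      intro t
      by_cases h3 : a + b * t + c * t ^ 2 = 0
      · rw [h3, zero_mul]
      · rw [h1 t h3, mul_zero]
    have e0 := h2 0
    have e1 := h2 1
    have e2 := h2 (-1)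
    have e3 := h2 2
    have e4 := h2 (-2)
    have c4 : c * γ = 0 := by linear_combination (e3 + e4 - 4 * e1 - 4 * e2 + 6 * e0) / 24
    have hγ : γ = 0 := by simpa [hc] using c4
    subst hγ
    have c3 : c * β = 0 := by linear_combination (e3 - e4 - 2 * e1 + 2 * e2) / 12
    have hβ : β = 0 := by simpa [hc] using c3
    subst hβ
    have c2 : c * α = 0 := by linear_combination (e1 + e2 - 2 * e0) / 2
    simpa [hc] using c2
  constructor
  · refine dotProduct_eq_zero_iff.1 fun v => ?_
    refine key (b := 2 * (v ⬝ᵥ g *ᵥ w)) (a := v ⬝ᵥ g *ᵥ v) (β := r ⬝ᵥ w) (γ := 0) hw fun t ht => ?_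
    rw [← dotProduct_mulVec_add_smul hg] at ht
    have h1 := (H _ ht).1
    rw [dotProduct_add, dotProduct_smul, smul_eq_mul] at h1
    linarith
  · refine eq_zero_of_dotProduct_mulVec_self hA fun v => ?_
    refine key (b := 2 * (v ⬝ᵥ g *ᵥ w)) (a := v ⬝ᵥ g *ᵥ v)
      (β := 2 * (v ⬝ᵥ A *ᵥ w)) (γ := w ⬝ᵥ A *ᵥ w) hw fun t ht => ?_
    rw [← dotProduct_mulVec_add_smul hg] at ht
    rw [← dotProduct_mulVec_add_smul hA]
    exact (H _ ht).2

/-- The algebraic core of the Noether condition: the square root of the nondegenerate quadratic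
`D (1 + g(v, v))` is irrational along non-null lines, so that both sides of the identity vanish,
and the resulting relation `S = s g` has trace zero. -/
theorem eq_zero_of_noether_identity [Nonempty J] {g S : Matrix J J ℝ} (hg : g.IsSymm)
    (hdet : g.det ≠ 0) (hS : S.IsSymm) (r β : J → ℝ) {s D α : ℝ} (hD : 0 < D)
    (H : ∀ v, 0 < D + D * (v ⬝ᵥ g *ᵥ v) →
      D * ((g⁻¹ * S).trace + 2 * (r ⬝ᵥ v) + (s + (g⁻¹ * S).trace) * (v ⬝ᵥ g *ᵥ v) - v ⬝ᵥ S *ᵥ v)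
        = 2 * √(D + D * (v ⬝ᵥ g *ᵥ v)) * (α + β ⬝ᵥ v)) :
    S = 0 ∧ r = 0 ∧ s = 0 := by
  have hg0 : g ≠ 0 := by
    rintro rfl
    exact hdet (det_zero)
  have line : ∀ v, v ⬝ᵥ g *ᵥ v ≠ 0 → (g⁻¹ * S).trace = 0 ∧ r ⬝ᵥ v = 0 ∧
      (s + (g⁻¹ * S).trace) * (v ⬝ᵥ g *ᵥ v) - v ⬝ᵥ S *ᵥ v = 0 := by
    intro v hv
    have h1 := quadratic_eq_zero_of_eq_sqrt_mul_affine (c := D * (g⁻¹ * S).trace)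
      (d := D * (2 * (r ⬝ᵥ v)))
      (e := D * ((s + (g⁻¹ * S).trace) * (v ⬝ᵥ g *ᵥ v) - v ⬝ᵥ S *ᵥ v))
      (a := 2 * √D * α) (b := 2 * √D * (β ⬝ᵥ v)) hv (by
      intro t ht
      have hq : (t • v) ⬝ᵥ g *ᵥ (t • v) = (v ⬝ᵥ g *ᵥ v) * t ^ 2 := by
        simp only [mulVec_smul, smul_dotProduct, dotProduct_smul, smul_eq_mul]; ring
      have hqS : (t • v) ⬝ᵥ S *ᵥ (t • v) = (v ⬝ᵥ S *ᵥ v) * t ^ 2 := by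
        simp only [mulVec_smul, smul_dotProduct, dotProduct_smul, smul_eq_mul]; ring
      have hf : D + D * ((v ⬝ᵥ g *ᵥ v) * t ^ 2) = D * (1 + (v ⬝ᵥ g *ᵥ v) * t ^ 2) := by ring
      have h2 := H (t • v) (by rw [hq, hf]; positivity)
      rw [hq, hqS, hf, Real.sqrt_mul hD.le] at h2
      simp only [dotProduct_smul, smul_eq_mul] at h2
      linear_combination h2)
    simpa [hD.ne'] using h1
  have h2 : r = 0 ∧ (s + (g⁻¹ * S).trace) • g - S = 0 := by
    refine affineQuadratic_eq_zero hg hg0 ((hg.smul _).sub hS) r fun v hv => ?_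
    obtain ⟨-, h3, h4⟩ := line v hv
    refine ⟨h3, ?_⟩
    rwa [sub_mulVec, dotProduct_sub, smul_mulVec, dotProduct_smul, smul_eq_mul]
  obtain ⟨w, hw⟩ : ∃ w, w ⬝ᵥ g *ᵥ w ≠ 0 := by
    by_contra! hcon
    exact hg0 (eq_zero_of_dotProduct_mulVec_self hg hcon)
  have htr := (line w hw).1
  have hSg := (sub_eq_zero.1 h2.2).symm
  rw [htr, add_zero] at hSg
  have hs : s = 0 := by
    rw [hSg, Matrix.mul_smul, nonsing_inv_mul _ (isUnit_iff_ne_zero.2 hdet), trace_smul, trace_one,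
      smul_eq_mul] at htr
    have hJ : (Fintype.card J : ℝ) ≠ 0 := by exact_mod_cast Fintype.card_ne_zero
    exact (mul_eq_zero.1 htr).resolve_right hJ
  refine ⟨?_, h2.1, hs⟩
  rw [hSg, hs, zero_smul]

end QuadraticForms

/-! ### The Noether condition is the Killing equation -/

section Noether

open Matrix

variable {m : ℕ} {U : Opens (Point m)} {h : Point m → Matrix (Fin m) (Fin m) ℝ} {z : Point m}

/-- The derivative of a field of matrices along `X`. -/
noncomputable def alongMat (X : Point m → Point m) (h : Point m → Matrix (Fin m) (Fin m) ℝ)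
    (z : Point m) : Matrix (Fin m) (Fin m) ℝ :=
  ∑ a, X z a • pdMat a h z

/-- The Jacobian of the components of `X` along the `x^i`: its entry `(i, j)` is `∂_j ξ^i`. -/
noncomputable def jacMat (X : Point m → Point m) (z : Point m) : Matrix (Fin m) (Fin m) ℝ :=
  Matrix.of fun i j => pd (Sum.inl j) (fun w => X w (Sum.inl i)) z

/-- The `x`-block of the Lie derivative of the metric. -/
noncomputable def lieBlock (h : Point m → Matrix (Fin m) (Fin m) ℝ) (X : Point m → Point m)
    (z : Point m) : Matrix (Fin m) (Fin m) ℝ :=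
  Matrix.of fun i j => lieMetric h X (Sum.inl i) (Sum.inl j) z

theorem lieBlock_eq (h : Point m → Matrix (Fin m) (Fin m) ℝ) (X : Point m → Point m)
    (z : Point m) :
    lieBlock h X z = alongMat X h z + (jacMat X z)ᵀ * h z + h z * jacMat X z := by
  ext i j
  simp only [lieBlock, of_apply, lieMetric, alongMat, jacMat, Matrix.add_apply, Matrix.sum_apply,
    Matrix.smul_apply, pdMat, smul_eq_mul, Matrix.mul_apply, Matrix.transpose_apply,
    Finset.sum_add_distrib]
  simp only [Fintype.sum_sum_type, metric, fromBlocks_apply₁₁, fromBlocks_apply₂₁,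
    fromBlocks_apply₁₂, Matrix.zero_apply, zero_mul, Finset.sum_const_zero, add_zero,
    mul_comm (h z _ j)]

theorem lieMetric_inl_inr (h : Point m → Matrix (Fin m) (Fin m) ℝ) (X : Point m → Point m)
    (z : Point m) (i : Fin m) : lieMetric h X (Sum.inl i) uIdx z
      = pd (Sum.inl i) (fun w => X w uIdx) z
        + ∑ j, h z i j * pd uIdx (fun w => X w (Sum.inl j)) z := by
  simp [lieMetric, metric, Finset.sum_add_distrib, pd_const]

theorem lieMetric_inr_inr (h : Point m → Matrix (Fin m) (Fin m) ℝ) (X : Point m → Point m)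
    (z : Point m) : lieMetric h X uIdx uIdx z = 2 * pd uIdx (fun w => X w uIdx) z := by
  simp [lieMetric, metric, pd_const]
  ring

theorem radicand_eq (h : Point m → Matrix (Fin m) (Fin m) ℝ) (z : Point m) (p : Fin m → ℝ) :
    radicand h z p = |(h z).det| + |(h z).det| * (p ⬝ᵥ (h z)⁻¹ *ᵥ p) := by
  simp only [radicand, dotProduct, mulVec, Finset.mul_sum]
  congr 1
  exact Finset.sum_congr rfl fun i _ => Finset.sum_congr rfl fun j _ => by ring

namespace IsMetricOn

theorem lieMetric_symm (H : IsMetricOn U h) (hz : z ∈ U) (X : Point m → Point m) (a b : Idx m) :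
    lieMetric h X a b z = lieMetric h X b a z := by
  simp only [lieMetric]
  refine Finset.sum_congr rfl fun c _ => ?_
  rw [pd_congr (fun w hw => H.metric_symm hw a b) hz, H.metric_symm hz a c, H.metric_symm hz c b]
  ring

theorem pd_abs_det (H : IsMetricOn U h) (hz : z ∈ U) (a : Idx m) :
    pd a (fun w => |(h w).det|) z = |(h z).det| * ((h z)⁻¹ * pdMat a h z).trace := by
  have hd := H.nondeg z hz
  have hdiff : DifferentiableAt ℝ (fun w => (h w).det) z :=
    differentiableAt_of_mem (contDiffOn_det H.smooth) hz
  have h1 := (hasDerivAt_abs hd).comp_hasFDerivAt z hdiff.hasFDerivAt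
  have h2 : pd a (fun w => |(h w).det|) z
      = SignType.sign (h z).det * pd a (fun w => (h w).det) z := by
    rw [pd, show (fun w => |(h w).det|) = abs ∘ fun w => (h w).det from rfl, h1.fderiv]
    rfl
  rw [h2, pd_det H.smooth H.nondeg hz, ← mul_assoc, mul_comm _ (h z).det, self_mul_sign]
  rfl

theorem pd_radicand (H : IsMetricOn U h) (hz : z ∈ U) (a : Idx m) (p : Fin m → ℝ) :
    pd a (fun w => radicand h w p) z = |(h z).det| *
      (((h z)⁻¹ * pdMat a h z).trace * (1 + p ⬝ᵥ (h z)⁻¹ *ᵥ p)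
        - ((h z)⁻¹ *ᵥ p) ⬝ᵥ pdMat a h z *ᵥ ((h z)⁻¹ *ᵥ p)) := by
  have hk := contDiffOn_inv H.smooth H.nondeg
  have hD : ContDiffOn ℝ ∞ (fun w => |(h w).det|) U := by
    intro w hw
    have h1 : ContDiffAt ℝ ∞ (fun w => (h w).det) w :=
      (contDiffOn_det H.smooth).contDiffAt (U.isOpen.mem_nhds hw)
    exact ((contDiffAt_abs (H.nondeg w hw)).comp w h1).contDiffWithinAt
  have hs : ContDiffOn ℝ ∞ (fun w => ∑ i, ∑ j, (h w)⁻¹ i j * p i * p j) U :=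
    contDiffOn_fun_sum _ fun i => contDiffOn_fun_sum _ fun j =>
      ((hk i j).mul contDiffOn_const).mul contDiffOn_const
  have hps : pd a (fun w => ∑ i, ∑ j, (h w)⁻¹ i j * p i * p j) z
      = p ⬝ᵥ pdMat a (fun w => (h w)⁻¹) z *ᵥ p := by
    have hterm : ∀ i j, ContDiffOn ℝ ∞ (fun w => (h w)⁻¹ i j * p i * p j) U := fun i j =>
      ((hk i j).mul contDiffOn_const).mul contDiffOn_const
    rw [pd_sum _ (fun i => contDiffOn_fun_sum _ fun j => hterm i j) hz]
    simp only [dotProduct, mulVec, Finset.mul_sum]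
    refine Finset.sum_congr rfl fun i _ => ?_
    rw [pd_sum _ (fun j => hterm i j) hz]
    refine Finset.sum_congr rfl fun j _ => ?_
    rw [pd_mul ((hk i j).mul contDiffOn_const) contDiffOn_const hz,
      pd_mul (hk i j) contDiffOn_const hz, pd_const, pd_const]
    simp only [pdMat, of_apply]
    ring
  have hP : p ⬝ᵥ pdMat a (fun w => (h w)⁻¹) z *ᵥ p
      = -(((h z)⁻¹ *ᵥ p) ⬝ᵥ pdMat a h z *ᵥ ((h z)⁻¹ *ᵥ p)) := by
    rw [pdMat_inv H.smooth H.nondeg hz, neg_mulVec, dotProduct_neg, ← mulVec_mulVec,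
      ← mulVec_mulVec, dotProduct_mulVec p, ← mulVec_transpose, transpose_nonsing_inv,
      H.symm z hz]
  have hsum : ∑ i, ∑ j, (h z)⁻¹ i j * p i * p j = p ⬝ᵥ (h z)⁻¹ *ᵥ p := by
    simp only [dotProduct, mulVec, Finset.mul_sum]
    exact Finset.sum_congr rfl fun i _ => Finset.sum_congr rfl fun j _ => by ring
  simp only [radicand]
  rw [pd_add hD (hD.mul hs) hz, pd_mul hD hs hz, H.pd_abs_det hz, hps, hP, hsum]
  ring

theorem pd_lagrangian (H : IsMetricOn U h) (hz : z ∈ U) (a : Idx m) {p : Fin m → ℝ}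
    (hp : 0 < radicand h z p) :
    2 * lagrangian h z p * pd a (fun w => lagrangian h w p) z
      = pd a (fun w => radicand h w p) z := by
  have hk := contDiffOn_inv H.smooth H.nondeg
  have hdiff : DifferentiableAt ℝ (fun w => radicand h w p) z := by
    have hD : DifferentiableAt ℝ (fun w => |(h w).det|) z :=
      (differentiableAt_of_mem (contDiffOn_det H.smooth) hz).abs (H.nondeg z hz)
    have hs : ContDiffOn ℝ ∞ (fun w => ∑ i, ∑ j, (h w)⁻¹ i j * p i * p j) U :=
      contDiffOn_fun_sum _ fun i => contDiffOn_fun_sum _ fun j =>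
        ((hk i j).mul contDiffOn_const).mul contDiffOn_const
    exact hD.add (hD.mul (differentiableAt_of_mem hs hz))
  have hpos : 0 < lagrangian h z p := Real.sqrt_pos.2 hp
  simp only [pd]
  rw [show (fun w => lagrangian h w p) = fun w => √(radicand h w p) from rfl,
    fderiv_sqrt hdiff hp.ne', _root_.smul_apply, smul_eq_mul, ← mul_assoc]
  change 2 * lagrangian h z p * (1 / (2 * lagrangian h z p)) * _ = _
  rw [mul_one_div_cancel (by positivity), one_mul]

theorem fderiv_lagrangian (H : IsMetricOn U h) (hz : z ∈ U) (i : Fin m) {p : Fin m → ℝ}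
    (hp : 0 < radicand h z p) :
    2 * lagrangian h z p * fderiv ℝ (lagrangian h z) p (Pi.single i 1)
      = 2 * |(h z).det| * ((h z)⁻¹ *ᵥ p) i := by
  have hsymm : (h z)⁻¹.IsSymm := Matrix.IsSymm.inv (H.symm z hz)
  have hdiff : DifferentiableAt ℝ (radicand h z) p := by
    unfold radicand
    fun_prop
  have hpos : 0 < lagrangian h z p := Real.sqrt_pos.2 hp
  have h1 : fderiv ℝ (radicand h z) p (Pi.single i 1) = 2 * |(h z).det| * ((h z)⁻¹ *ᵥ p) i := by
    rw [← hdiff.lineDeriv_eq_fderiv]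
    refine HasLineDerivAt.lineDeriv ?_
    have h2 : ∀ t : ℝ, radicand h z (p + t • Pi.single i 1)
        = radicand h z p + 2 * |(h z).det| * ((h z)⁻¹ *ᵥ p) i * t
          + |(h z).det| * (h z)⁻¹ i i * t ^ 2 := by
      intro t
      rw [radicand_eq, radicand_eq, dotProduct_mulVec_add_smul hsymm, mulVec_single_one,
        single_dotProduct, one_mul]
      have h3 : p ⬝ᵥ (h z)⁻¹.col i = ((h z)⁻¹ *ᵥ p) i := by
        simp only [dotProduct, mulVec, Matrix.col_apply]
        exact Finset.sum_congr rfl fun j _ => by rw [hsymm.apply i j, mul_comm]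
      rw [h3]
      simp only [Matrix.col_apply]
      ring
    rw [HasLineDerivAt, funext h2]
    have := (((hasDerivAt_id (0 : ℝ)).const_mul (2 * |(h z).det| * ((h z)⁻¹ *ᵥ p) i)).const_add
      (radicand h z p)).add
      (((hasDerivAt_id (0 : ℝ)).pow 2).const_mul (|(h z).det| * (h z)⁻¹ i i))
    simpa [Pi.add_def] using this
  rw [show lagrangian h z = fun q => √(radicand h z q) from rfl,
    fderiv_sqrt hdiff hp.ne', _root_.smul_apply, smul_eq_mul, ← mul_assoc, h1]
  change 2 * lagrangian h z p * (1 / (2 * lagrangian h z p)) * _ = _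
  rw [mul_one_div_cancel (by positivity), one_mul]

/-- The left-hand side of the Noether condition, multiplied by `2 L`, is a quadratic polynomial in
`p`, with coefficients given by the Lie derivative of the metric: the cubic terms cancel. It is
written in terms of `v = h⁻¹ p`. -/
theorem two_mul_lagrangian_mul_noether (H : IsMetricOn U h) {X : Point m → Point m}
    (hz : z ∈ U) (v : Fin m → ℝ) (hp : 0 < radicand h z (h z *ᵥ v)) :
    2 * lagrangian h z (h z *ᵥ v) * (prolong X (lagrangian h) z (h z *ᵥ v)
        + lagrangian h z (h z *ᵥ v)
          * ∑ i, totalD i (fun w => X w (Sum.inl i)) z (h z *ᵥ v))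
      = |(h z).det| * (((h z)⁻¹ * lieBlock h X z).trace
        + 2 * ((fun i => lieMetric h X (Sum.inl i) uIdx z) ⬝ᵥ v)
        + (lieMetric h X uIdx uIdx z + ((h z)⁻¹ * lieBlock h X z).trace) * (v ⬝ᵥ h z *ᵥ v)
        - v ⬝ᵥ lieBlock h X z *ᵥ v) := by
  have hu : IsUnit (h z).det := isUnit_iff_ne_zero.2 (H.nondeg z hz)
  have hsymm := H.symm z hz
  set p := h z *ᵥ v with hpdef
  have hv : (h z)⁻¹ *ᵥ p = v := by
    rw [hpdef, mulVec_mulVec, nonsing_inv_mul _ hu, one_mulVec]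
  have hLL : lagrangian h z p * lagrangian h z p = |(h z).det| * (1 + v ⬝ᵥ p) := by
    rw [lagrangian, Real.mul_self_sqrt hp.le, radicand_eq, hv, dotProduct_comm p v]
    ring
  -- the Lie derivative in terms of the derivatives of `X` and `h`
  set ξu : Fin m → ℝ := fun j => pd uIdx (fun w => X w (Sum.inl j)) z with hξu
  set ηx : Fin m → ℝ := fun i => pd (Sum.inl i) (fun w => X w uIdx) z with hηx
  set ηu : ℝ := pd uIdx (fun w => X w uIdx) z with hηu
  have etr : ((h z)⁻¹ * lieBlock h X z).trace
      = ((h z)⁻¹ * alongMat X h z).trace + 2 * (jacMat X z).trace := by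
    rw [lieBlock_eq, mul_add, mul_add, trace_add, trace_add, ← mul_assoc (h z)⁻¹ (h z),
      nonsing_inv_mul _ hu, one_mul, trace_mul_comm _ ((jacMat X z)ᵀ * h z), mul_assoc,
      mul_nonsing_inv _ hu, mul_one, trace_transpose]
    ring
  have er : (fun i => lieMetric h X (Sum.inl i) uIdx z) ⬝ᵥ v = ηx ⬝ᵥ v + p ⬝ᵥ ξu := by
    have h1 : (fun i => lieMetric h X (Sum.inl i) uIdx z) = ηx + h z *ᵥ ξu := by
      ext i; exact lieMetric_inl_inr h X z i
    rw [h1, add_dotProduct, dotProduct_comm (h z *ᵥ ξu), dotProduct_mulVec, ← mulVec_transpose,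
      hsymm]
  have equad : v ⬝ᵥ lieBlock h X z *ᵥ v
      = v ⬝ᵥ alongMat X h z *ᵥ v + 2 * (p ⬝ᵥ jacMat X z *ᵥ v) := by
    have h1 : v ⬝ᵥ h z *ᵥ (jacMat X z *ᵥ v) = p ⬝ᵥ jacMat X z *ᵥ v := by
      rw [dotProduct_mulVec v, ← mulVec_transpose, hsymm]
    have h2 : v ⬝ᵥ (jacMat X z)ᵀ *ᵥ p = p ⬝ᵥ jacMat X z *ᵥ v := by
      rw [mulVec_transpose, dotProduct_comm, dotProduct_mulVec]
    rw [lieBlock_eq, add_mulVec, add_mulVec, dotProduct_add, dotProduct_add, ← mulVec_mulVec,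
      ← mulVec_mulVec, h1, h2]
    ring
  -- the three parts of the Noether expression
  have ez : 2 * lagrangian h z p * ∑ a, X z a * pd a (fun w => lagrangian h w p) z
      = |(h z).det| * (((h z)⁻¹ * alongMat X h z).trace * (1 + v ⬝ᵥ p)
        - v ⬝ᵥ alongMat X h z *ᵥ v) := by
    have h1 : ∀ a, 2 * lagrangian h z p * (X z a * pd a (fun w => lagrangian h w p) z)
        = |(h z).det| * (X z a * ((h z)⁻¹ * pdMat a h z).trace * (1 + v ⬝ᵥ p)
          - X z a * (v ⬝ᵥ pdMat a h z *ᵥ v)) := by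
      intro a
      rw [mul_left_comm, H.pd_lagrangian hz a hp, H.pd_radicand hz, hv, dotProduct_comm p v]
      ring
    rw [Finset.mul_sum, Finset.sum_congr rfl fun a _ => h1 a, ← Finset.mul_sum,
      Finset.sum_sub_distrib, ← Finset.sum_mul]
    simp only [alongMat, Matrix.mul_sum, Matrix.mul_smul, trace_sum, trace_smul, smul_eq_mul,
      sum_mulVec, dotProduct_sum, smul_mulVec, dotProduct_smul]
  have ep : 2 * lagrangian h z p * ∑ i, prolongCoeff X i z p
        * fderiv ℝ (lagrangian h z) p (Pi.single i 1)
      = 2 * |(h z).det| * (ηx ⬝ᵥ v + ηu * (v ⬝ᵥ p) - p ⬝ᵥ jacMat X z *ᵥ v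
        - (p ⬝ᵥ ξu) * (v ⬝ᵥ p)) := by
    have h1 : ∀ i, 2 * lagrangian h z p * (prolongCoeff X i z p
        * fderiv ℝ (lagrangian h z) p (Pi.single i 1))
        = 2 * |(h z).det| * (ηx i * v i + ηu * (v i * p i) - ((jacMat X z)ᵀ *ᵥ p) i * v i
          - (p ⬝ᵥ ξu) * (v i * p i)) := by
      intro i
      have h2 : prolongCoeff X i z p
          = ηx i + p i * ηu - (((jacMat X z)ᵀ *ᵥ p) i + p i * (p ⬝ᵥ ξu)) := by
        simp only [prolongCoeff, totalD, mulVec, dotProduct, transpose_apply, jacMat, of_apply,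
          Finset.mul_sum, ← Finset.sum_add_distrib, hξu, hηx, hηu]
        congr 1
        exact Finset.sum_congr rfl fun j _ => by ring
      rw [mul_left_comm, H.fderiv_lagrangian hz i hp, hv, h2]
      ring
    have h3 : p ⬝ᵥ jacMat X z *ᵥ v = ((jacMat X z)ᵀ *ᵥ p) ⬝ᵥ v := by
      rw [mulVec_transpose, dotProduct_mulVec]
    rw [Finset.mul_sum, Finset.sum_congr rfl fun i _ => h1 i, ← Finset.mul_sum, h3]
    simp only [Finset.sum_sub_distrib, Finset.sum_add_distrib, ← Finset.mul_sum]
    rfl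
  have ediv : ∑ i, totalD i (fun w => X w (Sum.inl i)) z p = (jacMat X z).trace + p ⬝ᵥ ξu := by
    simp only [totalD, Finset.sum_add_distrib]
    rfl
  rw [prolong, ediv, etr, er, equad, lieMetric_inr_inr]
  change _ = |(h z).det| * (_ + _ + (2 * ηu + _) * (v ⬝ᵥ p) - _)
  linear_combination ez + ep + 2 * ((jacMat X z).trace + p ⬝ᵥ ξu) * hLL

/-- The Noether algebra of the minimal surface Lagrangian is the algebra of Killing fields. -/
theorem noetherAlgebra_eq_killingAlgebra (H : IsMetricOn U h) (hm : 1 ≤ m) :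
    noetherAlgebra U h = killingAlgebra U h := by
  have : Nonempty (Fin m) := ⟨⟨0, hm⟩⟩
  have hrad : ∀ z ∈ U, ∀ v, radicand h z (h z *ᵥ v)
      = |(h z).det| + |(h z).det| * (v ⬝ᵥ h z *ᵥ v) := by
    intro z hz v
    rw [radicand_eq, mulVec_mulVec, nonsing_inv_mul _ (isUnit_iff_ne_zero.2 (H.nondeg z hz)),
      one_mulVec, dotProduct_comm]
  ext X
  refine and_congr_right fun hX => ?_
  constructor
  · rintro ⟨A, hA, hN⟩ z hz
    have hsymm := H.symm z hz
    have hS : (lieBlock h X z).IsSymm := by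
      ext i j
      exact H.lieMetric_symm hz X _ _
    obtain ⟨hS0, hr0, hs0⟩ := eq_zero_of_noether_identity hsymm (H.nondeg z hz) hS
      (fun i => lieMetric h X (Sum.inl i) uIdx z)
      (h z *ᵥ fun i => pd uIdx (fun w => A w i) z)
      (s := lieMetric h X uIdx uIdx z) (α := ∑ i, pd (Sum.inl i) (fun w => A w i) z)
      (abs_pos.2 (H.nondeg z hz)) (by
        intro v hpos
        rw [← hrad z hz] at hpos ⊢
        rw [← H.two_mul_lagrangian_mul_noether hz v hpos, hN z hz _ hpos]
        change 2 * lagrangian h z (h z *ᵥ v) * _ = 2 * lagrangian h z (h z *ᵥ v) * _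
        congr 1
        rw [dotProduct_comm (h z *ᵥ _), dotProduct_mulVec, ← mulVec_transpose, hsymm]
        simp only [totalD, Finset.sum_add_distrib]
        rfl)
    have hru : ∀ i, lieMetric h X (Sum.inl i) uIdx z = 0 := fun i => congrFun hr0 i
    rintro (i | i) (j | j)
    · exact congrFun (congrFun hS0 i) j
    · exact hru i
    · exact (H.lieMetric_symm hz X _ _).trans (hru j)
    · exact hs0
  · intro hK
    refine ⟨0, fun _ => contDiffOn_const, fun z hz p hp => ?_⟩
    have hv : h z *ᵥ ((h z)⁻¹ *ᵥ p) = p := by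
      rw [mulVec_mulVec, mul_nonsing_inv _ (isUnit_iff_ne_zero.2 (H.nondeg z hz)), one_mulVec]
    have h1 := H.two_mul_lagrangian_mul_noether (X := X) hz ((h z)⁻¹ *ᵥ p) (by rwa [hv])
    have hS : lieBlock h X z = 0 := by
      ext i j; exact hK z hz _ _
    have hpos : 0 < lagrangian h z p := Real.sqrt_pos.2 hp
    simp only [hK z hz, hS, hv, mul_zero, trace_zero, zero_mulVec, dotProduct_zero, zero_mul,
      add_zero, sub_zero] at h1
    have h2 : (fun _ : Fin m => (0 : ℝ)) ⬝ᵥ ((h z)⁻¹ *ᵥ p) = 0 := zero_dotProduct _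
    simp only [h2, mul_zero, add_zero] at h1
    rw [(mul_eq_zero.1 h1).resolve_left (by positivity)]
    simp [totalD, pd_zero]

end IsMetricOn

end Noether

end MinimalSurface

open MinimalSurface in
theorem corollary4 (n : ℕ) (hn : 2 ≤ n)
    (U : TopologicalSpace.Opens (Point (n - 1)))
    (hU : IsConnected (U : Set (Point (n - 1))))
    (h : Point (n - 1) → Matrix (Fin (n - 1)) (Fin (n - 1)) ℝ)
    (h_smooth : ∀ i j, ContDiffOn ℝ ∞ (fun z => h z i j) U)
    (h_symm : ∀ z ∈ U, (h z).IsSymm)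
    (h_nondeg : ∀ z ∈ U, (h z).det ≠ 0) :
    -- the dimension of `G_N` is at most `n (n + 1) / 2`
    Module.Finite ℝ (noetherAlgebra U h) ∧
    Module.finrank ℝ (noetherAlgebra U h) ≤ n * (n + 1) / 2 ∧
    -- it is maximal exactly for the maximally symmetric spaces
    (Module.finrank ℝ (noetherAlgebra U h) = n * (n + 1) / 2 ↔ IsMaximallySymmetric U h) ∧
    -- these have constant curvature, and conversely on simply connected domains
    (Module.finrank ℝ (noetherAlgebra U h) = n * (n + 1) / 2 → HasConstantCurvature U h) ∧
    (SimplyConnectedSpace U →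
      (Module.finrank ℝ (noetherAlgebra U h) = n * (n + 1) / 2 ↔
        HasConstantCurvature U h)) := by
  have H : IsMetricOn U h := ⟨h_smooth, h_symm, h_nondeg⟩
  have hm : 1 ≤ n - 1 := by lia
  have hdim : n * (n + 1) / 2 = (n - 1 + 1) * (n - 1 + 2) / 2 := by
    obtain ⟨m, rfl⟩ : ∃ m, n = m + 1 := ⟨n - 1, by lia⟩
    rfl
  have hfin := H.killing_finite hU
  rw [H.noetherAlgebra_eq_killingAlgebra hm, hdim]
  exact ⟨hfin.1, hfin.2, Iff.rfl, H.constantCurvature_of_maximal hU hm, fun _ =>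
    ⟨H.constantCurvature_of_maximal hU hm, H.maximal_of_constantCurvature hU⟩⟩
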